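/- **Setting.** Let $(M,\omega)$ be a symplectic manifold and $L\subset M$ a compact Lagrangian submanifold. Let $U\subset M$ be a Darboux neighbourhood of $L$: an open neighbourhood with a symplectomorphism $\Psi$ from $(U,\omega)$ onto an open neighbourhood of the zero section of $(T^*L,-d\Theta)$, where $\Theta=p\,dq$ is the Liouville form, such that $\Psi$ maps each point of $L$ to the zero covector at that point. Let $V$ be an open neighbourhood of $L$ with compact closure $\overline V\subset U$, with the Darboux chart $\Psi|_V$. Fix a Riemannian metric $g$ on $L$ and let $J_g$ be the canonical (Sasakian) almost complex structure on $T^*L$: for the Levi-Civita connection of $g$ it maps the horizontal lift of $a\in T_qL$ to the vertical lift of $g(a,\cdot)\in T_q^*L$, and the vertical lift of $p \in T_q^*L$ to minus the horizontal lift of $p^\sharp$. Identify $V$ with its image in $T^*L$, write $|p|$ for the $g$-norm of covectors, and put $$d(V,\Theta)=\inf\{\,|p| : (q,p)\in T^*L\setminus V\,\},$$ the radius of the largest open disc bundle $\{|p|<r\}$ contained in $V$ (so $d(V,\Theta)=\sup_V|p|$ if $V$ is itself a disc bundle). Let $J_0$ be a smooth $\omega$-compatible almost complex structure on $M$ with $J_0=J_g$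 on $V$. Let $d$ be the distance of the Riemannian metric $\omega(\cdot,J_0\cdot)$ on $M$, $d_{\mathrm H}$ the corresponding Hausdorff distance, $D_\delta(L)=\{x\in M : d(x,L)\le\delta\}$, and $$\overline d(\phi,\mathrm{id})=\max\bigl(\sup_x d(\phi(x),x),\ \sup_x d(\phi^{-1}(x),x)\bigr).$$ **Theorem.** For every $0\le\delta<d(V,\Theta)$ there is a constant $C>0$, depending only on $\delta$, $V$ (as a Darboux neighbourhood of $L$ in $(M,\omega)$) and $J_0|_V=J_g$, with the following property. Let $H$ be a smooth time-dependent Hamiltonian on $[0,1]\times M$ whose flow $\phi_H^t$, $t\in[0,1]$, is defined by diffeomorphisms of $M$. Suppose that $\phi_H$ is $V$-engulfable, i.e. $\phi_H^t(L)\subset V$ for all $t\in[0,1]$, and that $\overline d(\phi_H^1,\mathrm{id})\le\delta$. Then every smooth map $v:\mathbb R\times[0,1]\to M$ with $$\frac{\partial v}{\partial\tau}+J_0\frac{\partial v}{\partial t}=0,\qquad v(\tau,0)\in\phi_H^1(L),\qquad v(\tau,1)\in L$$ satisfies one of the following alternatives: 1. $\operatorname{Image} v\subset D_\delta(L)\subset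 V$, and $d(v(z),L)\le d_{\mathrm H}(\phi_H^1(L),L)$ for all $z\in\mathbb R\times[0,1]$; or 2. $\operatorname{Image} v\not\subset V$, and $\int v^*\omega\ge C$ (where $\int v^*\omega\in[0,\infty]$). -/

import Mathlib

open Set Bundle MeasureTheory
open scoped Manifold ContDiff ENNReal NNReal

noncomputable section

namespace LocalFloer

/-! ### Differential forms on manifolds -/

section Forms

variable {E : Type*} [NormedAddCommGroup E] [NormedSpace ℝ E]
  {H : Type*} [TopologicalSpace H] (I : ModelWithCorners ℝ E H)
  {N : Type*} [TopologicalSpace N] [ChartedSpace H N]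

/-- Differential `k`-forms on `N`, without any smoothness. -/
abbrev DiffForm (k : ℕ) : Type _ := ∀ x : N, TangentSpace I x [⋀^Fin k]→L[ℝ] ℝ

/-- The expression of a `k`-form in the preferred chart around `x₀`, i.e. its pullback under the
inverse of that chart. -/
def DiffForm.inChart {k : ℕ} (α : DiffForm I (N := N) k) (x₀ : N) : E → E [⋀^Fin k]→L[ℝ] ℝ :=
  fun y => ContinuousAlternatingMap.compContinuousLinearMap (M := E) (M' := E)
    (α ((extChartAt I x₀).symm y)) (mfderiv 𝓘(ℝ, E) I (extChartAt I x₀).symm y)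

/-- Smoothness of a form: its expression in every preferred chart is smooth. -/
def DiffForm.IsSmooth {k : ℕ} (α : DiffForm I (N := N) k) : Prop :=
  ∀ x₀ : N, ContDiffOn ℝ ∞ (α.inChart I x₀) (extChartAt I x₀).target

/-- The exterior derivative of a form on a manifold without boundary, computed at each point `x` in
the preferred chart around `x` (through which Mathlib identifies `TangentSpace I x` with `E`). -/
def DiffForm.extDeriv {k : ℕ} (α : DiffForm I (N := N) k) : DiffForm I (N := N) (k + 1) :=
  fun x =>
    let d : E [⋀^Fin (k + 1)]→L[ℝ] ℝ := _root_.extDeriv (α.inChart I x) (extChartAt I x x)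
    d

end Forms

/-! ### Symplectic manifolds and compatible almost complex structures -/

section Symplectic

variable {E : Type*} [NormedAddCommGroup E] [NormedSpace ℝ E]
  {M : Type*} [TopologicalSpace M] [ChartedSpace E M]

/-- A symplectic form: a smooth, closed, nondegenerate 2-form. -/
structure IsSymplectic (Ω : DiffForm 𝓘(ℝ, E) (N := M) 2) : Prop where
  smooth : Ω.IsSmooth
  closed : Ω.extDeriv = 0
  nondegenerate : ∀ (x : M) (u : TangentSpace 𝓘(ℝ, E) x), (∀ w, Ω x ![u, w] = 0) → u = 0

variable [IsManifold 𝓘(ℝ, E) ∞ M]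

/-- A smooth almost complex structure compatible with the 2-form `Ω`: `J² = -1`, `J` preserves `Ω`
and `Ω(·, J ·)` is positive definite. -/
structure IsCompatible (Ω : DiffForm 𝓘(ℝ, E) (N := M) 2)
    (J : ∀ x : M, TangentSpace 𝓘(ℝ, E) x →L[ℝ] TangentSpace 𝓘(ℝ, E) x) : Prop where
  smooth : ContMDiff 𝓘(ℝ, E) (𝓘(ℝ, E).prod 𝓘(ℝ, E →L[ℝ] E)) ∞
    (fun x => TotalSpace.mk' (E →L[ℝ] E)
      (E := fun x : M => TangentSpace 𝓘(ℝ, E) x →L[ℝ] TangentSpace 𝓘(ℝ, E) x) x (J x))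
  sq : ∀ (x : M) (u : TangentSpace 𝓘(ℝ, E) x), J x (J x u) = -u
  invariant : ∀ (x : M) (u w : TangentSpace 𝓘(ℝ, E) x), Ω x ![J x u, J x w] = Ω x ![u, w]
  pos : ∀ (x : M) (u : TangentSpace 𝓘(ℝ, E) x), u ≠ 0 → 0 < Ω x ![u, J x u]

/-- A Lagrangian submanifold, given as a smooth embedding `ι : L → M` of half the dimension along
which `Ω` vanishes. -/
structure IsLagrangianEmbedding {F : Type*} [NormedAddCommGroup F] [NormedSpace ℝ F]
    {L : Type*} [TopologicalSpace L] [ChartedSpace F L]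
    (Ω : DiffForm 𝓘(ℝ, E) (N := M) 2) (ι : L → M) : Prop where
  embedding : Manifold.IsSmoothEmbedding 𝓘(ℝ, F) 𝓘(ℝ, E) ∞ ι
  isotropic : ∀ (q : L) (u w : TangentSpace 𝓘(ℝ, F) q),
    Ω (ι q) ![mfderiv 𝓘(ℝ, F) 𝓘(ℝ, E) ι q u, mfderiv 𝓘(ℝ, F) 𝓘(ℝ, E) ι q w] = 0
  half_dim : 2 * Module.finrank ℝ F = Module.finrank ℝ E

/-- `φ` is the flow, for times in `[0,1]`, of the smooth time-dependent Hamiltonian `H` on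
`[0,1] × M`: `φ⁰ = id` and `φᵗ` has velocity `X_H(t, φᵗ)`, where `Ω(X_H, ·) = dH_t`. -/
structure IsHamiltonianPath (Ω : DiffForm 𝓘(ℝ, E) (N := M) 2) (H : ℝ → M → ℝ)
    (φ : ℝ → (M ≃ₘ^∞⟮𝓘(ℝ, E), 𝓘(ℝ, E)⟯ M)) : Prop where
  smooth : ContMDiffOn (𝓘(ℝ, ℝ).prod 𝓘(ℝ, E)) 𝓘(ℝ, ℝ) ∞
    (fun z : ℝ × M => H z.1 z.2) (Icc (0 : ℝ) 1 ×ˢ univ)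
  init : ∀ x, φ 0 x = x
  flow : ∀ t ∈ Icc (0 : ℝ) 1, ∀ x : M, ∃ X : TangentSpace 𝓘(ℝ, E) (φ t x),
    HasMFDerivWithinAt 𝓘(ℝ, ℝ) 𝓘(ℝ, E) (fun s => φ s x) (Icc (0 : ℝ) 1) t
      (ContinuousLinearMap.toSpanSingleton ℝ X) ∧
    ∀ w : TangentSpace 𝓘(ℝ, E) (φ t x),
      Ω (φ t x) ![X, w] = mfderiv 𝓘(ℝ, E) 𝓘(ℝ, ℝ) (H t) (φ t x) w

end Symplectic

/-! ### Distances defined by `Ω` and `J` -/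

section Distance

variable {E : Type*} [NormedAddCommGroup E] [NormedSpace ℝ E]
  {M : Type*} [TopologicalSpace M] [ChartedSpace E M]
  (Ω : DiffForm 𝓘(ℝ, E) (N := M) 2)
  (J : ∀ x : M, TangentSpace 𝓘(ℝ, E) x →L[ℝ] TangentSpace 𝓘(ℝ, E) x)

/-- The distance on `M` of the Riemannian metric `Ω(·, J ·)`: the infimum of the lengths of `C¹`
paths (`∞` between different components). -/
def dist (x y : M) : ℝ≥0∞ :=
  letI : ∀ x : M, ENorm (TangentSpace 𝓘(ℝ, E) x) :=
    fun x => ⟨fun u => ENNReal.ofReal (Real.sqrt (Ω x ![u, J x u]))⟩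
  Manifold.riemannianEDist 𝓘(ℝ, E) x y

/-- The distance from a point to a set. -/
def distToSet (x : M) (A : Set M) : ℝ≥0∞ := ⨅ y ∈ A, dist Ω J x y

/-- The Hausdorff distance between two sets. -/
def hausdorffDist (A B : Set M) : ℝ≥0∞ :=
  max (⨆ x ∈ A, distToSet Ω J x B) (⨆ x ∈ B, distToSet Ω J x A)

/-- The closed `δ`-neighbourhood of a set. -/
def nbhd (δ : ℝ≥0∞) (A : Set M) : Set M := {x | distToSet Ω J x A ≤ δ}

/-- The `C⁰` distance of two diffeomorphisms, symmetrized by their inverses. -/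
def dBar (φ ψ : M ≃ₘ^∞⟮𝓘(ℝ, E), 𝓘(ℝ, E)⟯ M) : ℝ≥0∞ :=
  max (⨆ x, dist Ω J (φ x) (ψ x)) (⨆ x, dist Ω J (φ.symm x) (ψ.symm x))

end Distance

/-! ### The cotangent bundle -/

section Cotangent

variable {F : Type*} [NormedAddCommGroup F] [NormedSpace ℝ F]
  {L : Type*} [TopologicalSpace L] [ChartedSpace F L] [IsManifold 𝓘(ℝ, F) ∞ L]

variable (F L) in
/-- The total space of the cotangent bundle `T*L`, with Mathlib's manifold structure. -/
abbrev Cotangent : Type _ :=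
  TotalSpace (F →L[ℝ] ℝ) (fun q : L => TangentSpace 𝓘(ℝ, F) q →L[ℝ] Trivial L ℝ q)

variable (F) in
/-- The model with corners of `T*L`. -/
abbrev cotangentModel : ModelWithCorners ℝ (F × (F →L[ℝ] ℝ)) (ModelProd F (F →L[ℝ] ℝ)) :=
  𝓘(ℝ, F).prod 𝓘(ℝ, F →L[ℝ] ℝ)

/-- The zero covector at `q`. -/
def zeroCovector (q : L) : Cotangent F L := ⟨q, 0⟩

/-- The covector at the base point of a point of `T*L`. -/
def covector (ξ : Cotangent F L) : TangentSpace 𝓘(ℝ, F) ξ.proj →L[ℝ] ℝ := ξ.2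

variable (F L) in
/-- The Liouville one-form `Θ = p dq`: `Θ_ξ(η) = ξ(dπ η)`, with `π : T*L → L` the projection. -/
def liouville : DiffForm (cotangentModel F) (N := Cotangent F L) 1 := fun ξ =>
  (ContinuousAlternatingMap.ofSubsingleton ℝ _ _ (0 : Fin 1))
    ((covector ξ).comp
      (mfderiv (cotangentModel F) 𝓘(ℝ, F) (fun ζ : Cotangent F L => ζ.proj) ξ))

variable (F L) in
/-- Riemannian metrics on `L`. -/
abbrev Metric : Type _ :=
  ContMDiffRiemannianMetric 𝓘(ℝ, F) ∞ F (fun q : L => TangentSpace 𝓘(ℝ, F) q)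

variable (g : Metric F L)

theorem flat_injective (q : L) : Function.Injective (g.inner q) := by
  intro u w h
  by_contra hne
  have hp := g.pos q (u - w) (sub_ne_zero.2 hne)
  have h0 : g.inner q (u - w) = 0 := by rw [map_sub, h, sub_self]
  rw [h0] at hp
  simp at hp

theorem flat_bijective [FiniteDimensional ℝ F] (q : L) :
    Function.Bijective (g.inner q).toLinearMap := by
  have : FiniteDimensional ℝ (TangentSpace 𝓘(ℝ, F) q) := inferInstanceAs (FiniteDimensional ℝ F)
  refine ⟨flat_injective g q, ?_⟩
  have e : (F →L[ℝ] ℝ) ≃ₗ[ℝ] Module.Dual ℝ F := LinearMap.toContinuousLinearMap.symm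
  have hd : Module.finrank ℝ (F →L[ℝ] ℝ) = Module.finrank ℝ F := by
    rw [e.finrank_eq, Subspace.dual_finrank_eq]
  have h := (LinearMap.injective_iff_surjective_of_finrank_eq_finrank
    (V := F) (V₂ := F →L[ℝ] ℝ) hd.symm (f := (g.inner q).toLinearMap)).1 (flat_injective g q)
  exact h

/-- The vector `p♯` with `g(p♯, ·) = p`. -/
def sharp [FiniteDimensional ℝ F] (q : L) (p : TangentSpace 𝓘(ℝ, F) q →L[ℝ] ℝ) :
    TangentSpace 𝓘(ℝ, F) q :=
  (LinearEquiv.ofBijective (g.inner q).toLinearMap (flat_bijective g q)).symm p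

/-- The norm `|p|` of a covector with respect to `g`. -/
def conorm [FiniteDimensional ℝ F] (ξ : Cotangent F L) : ℝ :=
  Real.sqrt (covector ξ (sharp g ξ.proj (covector ξ)))

/-- The coefficients of `g` in the preferred chart around `q`. -/
def metricInChart (q : L) : F → F →L[ℝ] F →L[ℝ] ℝ := fun y =>
  let G : F →L[ℝ] F →L[ℝ] ℝ := g.inner ((extChartAt 𝓘(ℝ, F) q).symm y)
  let A : F →L[ℝ] F := mfderiv 𝓘(ℝ, F) 𝓘(ℝ, F) (extChartAt 𝓘(ℝ, F) q).symm y
  G.bilinearComp A A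

set_option synthInstance.maxHeartbeats 200000 in
/-- The Christoffel symbols (of the first kind) of `g` at `q`, in the preferred chart around `q`:
`christoffel g q a w` is the covector
`c ↦ g(Γ(a, c), w) = ½ ((∂_a g)(c, w) + (∂_c g)(a, w) - (∂_w g)(a, c))`. -/
def christoffel (q : L) (a w : F) : F →L[ℝ] ℝ :=
  let D : F →L[ℝ] F →L[ℝ] F →L[ℝ] ℝ := fderiv ℝ (metricInChart g q) (extChartAt 𝓘(ℝ, F) q q)
  let D₁ : F →L[ℝ] F →L[ℝ] ℝ := D a
  let D₂ : F →L[ℝ] F →L[ℝ] ℝ := D.flip a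
  let D₃ : F →L[ℝ] F →L[ℝ] ℝ := D w
  (1 / 2 : ℝ) • (D₁.flip w + D₂.flip w - D₃ a)

variable [FiniteDimensional ℝ F]

/-- The connection map of the Levi-Civita connection of `g` on `T*L`. In the coordinates of the
preferred chart, a tangent vector at `ξ = (q, p)` is a pair `(a, b)` in `F × F*`, its image in `L` is
`a`, and its vertical part is the covector `c ↦ b(c) - p(Γ(a, c))`. -/
def connectionMap (ξ : Cotangent F L) (η : F × (F →L[ℝ] ℝ)) : F →L[ℝ] ℝ :=
  let s : F := sharp g ξ.proj (covector ξ)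
  η.2 - christoffel (F := F) g ξ.proj η.1 s

/-- The canonical (Sasakian) almost complex structure `J_g` on `T*L`: it maps the horizontal lift of
`a` to the vertical lift of `g(a, ·)`, and the vertical lift of a covector `p` to minus the
horizontal lift of `p♯`. -/
def sasakiJ (ξ : Cotangent F L) (η : TangentSpace (cotangentModel F) ξ) :
    TangentSpace (cotangentModel F) ξ :=
  let a' : F := -sharp g ξ.proj (connectionMap (F := F) g ξ η)
  let flat : F →L[ℝ] ℝ := g.inner ξ.proj (show F × (F →L[ℝ] ℝ) from η).1
  let s : F := sharp g ξ.proj (covector ξ)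
  ((a', flat + christoffel (F := F) g ξ.proj a' s) : F × (F →L[ℝ] ℝ))

end Cotangent

/-! ### Darboux neighbourhoods -/

section Darboux

variable {E : Type*} [NormedAddCommGroup E] [NormedSpace ℝ E]
  {M : Type*} [TopologicalSpace M] [ChartedSpace E M]
  {F : Type*} [NormedAddCommGroup F] [NormedSpace ℝ F]
  {L : Type*} [TopologicalSpace L] [ChartedSpace F L] [IsManifold 𝓘(ℝ, F) ∞ L]

/-- `Ψ` is a Darboux chart along the Lagrangian submanifold `ι : L → M`: a symplectomorphism from an
open neighbourhood `U = Ψ.source` of `L`, with the form `Ω`, onto an open neighbourhood of the zero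
section of `T*L`, with the form `-dΘ`, which maps `L` to the zero section by the identity. -/
structure IsDarbouxChart (Ω : DiffForm 𝓘(ℝ, E) (N := M) 2) (ι : L → M)
    (Ψ : OpenPartialHomeomorph M (Cotangent F L)) : Prop where
  smooth : ContMDiffOn 𝓘(ℝ, E) (cotangentModel F) ∞ Ψ Ψ.source
  smooth_symm : ContMDiffOn (cotangentModel F) 𝓘(ℝ, E) ∞ Ψ.symm Ψ.target
  mem_source : ∀ q, ι q ∈ Ψ.source
  map_zero : ∀ q, Ψ (ι q) = zeroCovector q
  symplectic : ∀ x ∈ Ψ.source, ∀ u w : TangentSpace 𝓘(ℝ, E) x,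
    -(DiffForm.extDeriv (cotangentModel F) (liouville F L) (Ψ x)
      ![mfderiv 𝓘(ℝ, E) (cotangentModel F) Ψ x u, mfderiv 𝓘(ℝ, E) (cotangentModel F) Ψ x w])
      = Ω x ![u, w]

/-- `V` is a Darboux neighbourhood of `L` with compact closure in the Darboux neighbourhood
`U = Ψ.source`. -/
structure IsInnerDarbouxNhd (ι : L → M) (Ψ : OpenPartialHomeomorph M (Cotangent F L))
    (V : Set M) : Prop where
  isOpen : IsOpen V
  subset : range ι ⊆ V
  closure_subset : closure V ⊆ Ψ.source
  isCompact_closure : IsCompact (closure V)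

variable [FiniteDimensional ℝ F]

/-- The size `d(V, Θ)` of `V`, regarded as a neighbourhood of the zero section of `T*L`: the largest
`r` for which the open disc bundle `{|p| < r}` is contained in `V`, i.e. the infimum of `|p|` over the
complement of `V` in `T*L`. If `V` is itself a disc bundle, this is its radius `sup_V |p|`. -/
def size (g : Metric F L) (Ψ : OpenPartialHomeomorph M (Cotangent F L)) (V : Set M) : ℝ≥0∞ :=
  ⨅ ξ ∈ (Ψ '' V)ᶜ, ENNReal.ofReal (conorm g ξ)

/-- On `V` the almost complex structure `J` is the structure `J_g` of `T*L`, transported by `Ψ`. -/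
def IsSasakiOn (g : Metric F L) (Ψ : OpenPartialHomeomorph M (Cotangent F L)) (V : Set M)
    (J : ∀ x : M, TangentSpace 𝓘(ℝ, E) x →L[ℝ] TangentSpace 𝓘(ℝ, E) x) : Prop :=
  ∀ x ∈ V, ∀ u : TangentSpace 𝓘(ℝ, E) x,
    mfderiv 𝓘(ℝ, E) (cotangentModel F) Ψ x (J x u)
      = sasakiJ g (Ψ x) (mfderiv 𝓘(ℝ, E) (cotangentModel F) Ψ x u)

end Darboux

/-! ### Holomorphic strips -/

section Strip

variable {E : Type*} [NormedAddCommGroup E] [NormedSpace ℝ E]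
  {M : Type*} [TopologicalSpace M] [ChartedSpace E M]

/-- The strip `ℝ × [0,1]`, with coordinates `(τ, t)`. -/
def strip : Set (ℝ × ℝ) := univ ×ˢ Icc 0 1

/-- The partial derivative of a map on the strip in the direction `e`. -/
def partialDeriv (v : ℝ × ℝ → M) (e z : ℝ × ℝ) : TangentSpace 𝓘(ℝ, E) (v z) :=
  mfderivWithin 𝓘(ℝ, ℝ × ℝ) 𝓘(ℝ, E) v strip z e

/-- `v` is a smooth `J`-holomorphic strip with boundary on `(L₀, L₁)`:
`∂v/∂τ + J ∂v/∂t = 0`, `v(τ, 0) ∈ L₀`, `v(τ, 1) ∈ L₁`. -/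
structure IsHolomorphicStrip
    (J : ∀ x : M, TangentSpace 𝓘(ℝ, E) x →L[ℝ] TangentSpace 𝓘(ℝ, E) x)
    (L₀ L₁ : Set M) (v : ℝ × ℝ → M) : Prop where
  smooth : ContMDiffOn 𝓘(ℝ, ℝ × ℝ) 𝓘(ℝ, E) ∞ v strip
  cauchyRiemann : ∀ z ∈ strip,
    partialDeriv (E := E) v (1, 0) z + J (v z) (partialDeriv (E := E) v (0, 1) z) = 0
  bottom : ∀ τ : ℝ, v (τ, 0) ∈ L₀
  top : ∀ τ : ℝ, v (τ, 1) ∈ L₁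

/-- The symplectic area `∫ v^*Ω` in `[0, ∞]` of a strip for which `Ω(∂v/∂τ, ∂v/∂t)` is nonnegative,
as is the case for `J`-holomorphic strips with `J` compatible with `Ω`. -/
def area (Ω : DiffForm 𝓘(ℝ, E) (N := M) 2) (v : ℝ × ℝ → M) : ℝ≥0∞ :=
  ∫⁻ z in strip, ENNReal.ofReal
    (Ω (v z) ![partialDeriv (E := E) v (1, 0) z, partialDeriv (E := E) v (0, 1) z])

end Strip

end LocalFloer

end

/-!
The square `|p|²` of the norm of covectors carries the whole argument. On `V` one has `d(|p|²) ∘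
J_g = 2 Θ`, so that along a `J_g`-holomorphic map `W` the Laplacian of `|p|²` is `-2 dΘ(W_τ, J_g
W_τ) ≥ 0` (`lap_conormSq_nonneg`). Moreover `|d(|p|²)| ≤ 2 |p|` in the Sasaki metric, and the
segment from `(q, p)` to the zero covector has length `|p|`. Hence, for `m` smaller than `d(V,
Θ)`, the points at distance at most `m` from `L` are exactly those of the disc bundle `{|p| ≤ m}`
(`mem_of_distToSet_le`, `distToSet_le_of_conormSq_le`). In particular the boundary of a
holomorphic strip as in the theorem lies in `{|p| ≤ min(d_H, δ)}`: its lower part lies on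
`φ_H^1(L)`, whose points have distance at most `d_H` and at most `δ` from `L`, and its upper part
on `L`.

*Strips inside `V`.* Along such a strip `|p|²` is bounded and subharmonic, so the maximum
principle on the strip (`le_of_lap_nonneg_of_boundary`, `IsHolomorphicStrip.conormSq_le`) bounds
it by its boundary values. This is the first alternative.

*Escaping strips.* Fix `δ < ρ₁ < ρ₂ < d(V, Θ)`. A vertical segment of the strip that leaves `V`
starts on `L` and crosses the annulus `{ρ₁ ≤ |p| ≤ ρ₂}`; by the mean value theorem it does so at
some point with non-zero derivative (`IsHolomorphicStrip.exists_crossing`). The annulus is compact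
and contained in the open set `{|p| > δ}` of `V`, which the boundary of the strip avoids. A
monotonicity estimate (`exists_area_lower_bound_of_isCompact`) then bounds the area of the strip
from below.

*Monotonicity.* In coordinates, let `h` be the squared distance from the image of an interior
point, for an inner product that makes `J` orthogonal at this image. By the Cauchy-Riemann
equation, `h` satisfies, up to errors of relative size `√h`, the relations `Δh = 4 e` and `|∇h|² ≤
4 h e`, with `e` the energy density (`almost_holomorphic_inequalities`). Therefore `log (h + η) +
4 C √(h + η)` is subharmonic, with Laplacian of total mass bounded below near the point, uniformly
in the scale `η` (`log_laplacian_lower_bound`). Cutting it off at `h = r²` gives a function whose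
Laplacian has integral zero, and the negative part, supported in `{r²/2 ≤ h ≤ r²}`, is paid for by
energy (`exists_energy_lower_bound`). The function need not have compact support on the strip, and
the energy may be infinite; a cutoff in the variable `τ` with small second derivative takes care
of the ends.

The constant is found from one compatible structure that is the Sasaki structure on `V`. It serves
for all of them, since they agree on `V` (`IsSasakiOn.modelStructure_eq`) and the monotonicity
estimate uses the Cauchy-Riemann equation only on an open subset of `V`.
-/

noncomputable section

namespace LocalFloer

open Filter
open scoped Topology RealInnerProductSpace

/-! ### Subharmonic functions on the strip -/

section Laplacian

variable {X : Type*} [NormedAddCommGroup X] [NormedSpace ℝ X]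

/-- The Laplacian of a function of two real variables. -/
def lap (u : ℝ × ℝ → X) (z : ℝ × ℝ) : X :=
  fderiv ℝ (fun w => fderiv ℝ u w (1, 0)) z (1, 0) +
    fderiv ℝ (fun w => fderiv ℝ u w (0, 1)) z (0, 1)

theorem lap_congr {u w : ℝ × ℝ → X} {z : ℝ × ℝ} (h : u =ᶠ[𝓝 z] w) :
    lap u z = lap w z := by
  have h' : ∀ e : ℝ × ℝ, (fun y => fderiv ℝ u y e) =ᶠ[𝓝 z] fun y => fderiv ℝ w y e := fun e =>
    (h.fderiv (𝕜 := ℝ)).mono fun y hy => by simp only [hy]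
  unfold lap
  rw [(h' _).fderiv_eq, (h' _).fderiv_eq]

theorem differentiableAt_fderiv_apply {u : ℝ × ℝ → X} {z : ℝ × ℝ} (hu : ContDiffAt ℝ 2 u z)
    (e : ℝ × ℝ) : DifferentiableAt ℝ (fun w => fderiv ℝ u w e) z := by
  have h1 : ContDiffAt ℝ 1 (fderiv ℝ u) z := hu.fderiv_right (by norm_num)
  exact (h1.differentiableAt one_ne_zero).clm_apply (differentiableAt_const e)

theorem eventually_differentiableAt {u : ℝ × ℝ → X} {z : ℝ × ℝ} (hu : ContDiffAt ℝ 2 u z) :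
    ∀ᶠ w in 𝓝 z, DifferentiableAt ℝ u w := by
  filter_upwards [hu.eventually (by simp)] with w hw using hw.differentiableAt two_ne_zero

/-- Restriction of a `C²` function to a horizontal line. -/
theorem hasDerivAt_horizontal {u : ℝ × ℝ → X} {z : ℝ × ℝ} (hu : ContDiffAt ℝ 2 u z) :
    (∀ᶠ s in 𝓝 z.1, HasDerivAt (fun r => u (r, z.2)) (fderiv ℝ u (s, z.2) (1, 0)) s) ∧
      HasDerivAt (fun s => fderiv ℝ u (s, z.2) (1, 0))
        (fderiv ℝ (fun w => fderiv ℝ u w (1, 0)) z (1, 0)) z.1 := by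
  have hline : ∀ s : ℝ, HasDerivAt (fun r : ℝ => (r, z.2)) ((1 : ℝ), (0 : ℝ)) s := fun s =>
    (hasDerivAt_id s).prodMk (hasDerivAt_const s z.2)
  refine ⟨?_, ?_⟩
  · have hc : Tendsto (fun s : ℝ => (s, z.2)) (𝓝 z.1) (𝓝 z) := (hline z.1).continuousAt
    filter_upwards [hc.eventually (eventually_differentiableAt hu)] with s hs
    exact hs.hasFDerivAt.comp_hasDerivAt s (hline s)
  · exact (differentiableAt_fderiv_apply hu (1, 0)).hasFDerivAt.comp_hasDerivAt z.1 (hline z.1)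

/-- Restriction of a `C²` function to a vertical line. -/
theorem hasDerivAt_vertical {u : ℝ × ℝ → X} {z : ℝ × ℝ} (hu : ContDiffAt ℝ 2 u z) :
    (∀ᶠ s in 𝓝 z.2, HasDerivAt (fun r => u (z.1, r)) (fderiv ℝ u (z.1, s) (0, 1)) s) ∧
      HasDerivAt (fun s => fderiv ℝ u (z.1, s) (0, 1))
        (fderiv ℝ (fun w => fderiv ℝ u w (0, 1)) z (0, 1)) z.2 := by
  have hline : ∀ s : ℝ, HasDerivAt (fun r : ℝ => (z.1, r)) ((0 : ℝ), (1 : ℝ)) s := fun s =>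
    (hasDerivAt_const s z.1).prodMk (hasDerivAt_id s)
  refine ⟨?_, ?_⟩
  · have hc : Tendsto (fun s : ℝ => (z.1, s)) (𝓝 z.2) (𝓝 z) := (hline z.2).continuousAt
    filter_upwards [hc.eventually (eventually_differentiableAt hu)] with s hs
    exact hs.hasFDerivAt.comp_hasDerivAt s (hline s)
  · exact (differentiableAt_fderiv_apply hu (0, 1)).hasFDerivAt.comp_hasDerivAt z.2 (hline z.2)

end Laplacian

theorem second_deriv_nonpos_of_isLocalMax {f f' : ℝ → ℝ} {x d : ℝ}
    (hf : ∀ᶠ s in 𝓝 x, HasDerivAt f (f' s) s) (hf' : HasDerivAt f' d x) (hmax : IsLocalMax f x) :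
    d ≤ 0 := by
  by_contra! hd
  have he : deriv f =ᶠ[𝓝 x] f' := hf.mono fun s hs => hs.deriv
  have h2 : deriv (deriv f) x = d := by rw [he.deriv_eq]; exact hf'.deriv
  have hmin : IsLocalMin f x := isLocalMin_of_deriv_deriv_pos (by rw [h2]; exact hd)
    hmax.deriv_eq_zero hf.self_of_nhds.continuousAt
  have hconst : f =ᶠ[𝓝 x] fun _ => f x := by
    filter_upwards [hmin, hmax] with s h1 h2 using le_antisymm h2 h1
  have h0 : deriv f =ᶠ[𝓝 x] fun _ => 0 := by
    have := hconst.deriv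
    simpa using this
  rw [h0.deriv_eq] at h2
  simp at h2
  linarith

theorem abs_le_cosh (x : ℝ) : |x| ≤ Real.cosh x := by
  have h1 := Real.add_one_le_exp x
  have h2 := Real.add_one_le_exp (-x)
  have h3 := Real.exp_pos x
  have h4 := Real.exp_pos (-x)
  have h5 : Real.exp x * Real.exp (-x) = 1 := by rw [← Real.exp_add]; simp
  rw [Real.cosh_eq]
  have h6 := Real.quadratic_le_exp_of_nonneg (abs_nonneg x)
  rcases abs_cases x with ⟨h, h'⟩ | ⟨h, h'⟩
  · rw [h] at h6 ⊢
    nlinarith [sq_nonneg (x - 1)]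
  · rw [h] at h6 ⊢
    nlinarith [sq_nonneg (x + 1)]

/-- The maximum principle on the strip for bounded subharmonic functions. The strip is not compact,
and no behaviour at the two ends is assumed: there the harmonic function `cosh τ · cos (t - 1/2)`,
which is positive on the strip, dominates the bound `B`. -/
theorem le_of_lap_nonneg_of_boundary {u : ℝ × ℝ → ℝ} {m B : ℝ} (hc : ContinuousOn u strip)
    (hd : ∀ z : ℝ × ℝ, z.2 ∈ Ioo (0 : ℝ) 1 → ContDiffAt ℝ 2 u z)
    (hl : ∀ z : ℝ × ℝ, z.2 ∈ Ioo (0 : ℝ) 1 → 0 ≤ lap u z)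
    (hB : ∀ z ∈ strip, u z ≤ B) (hbot : ∀ τ, u (τ, 0) ≤ m) (htop : ∀ τ, u (τ, 1) ≤ m) :
    ∀ z ∈ strip, u z ≤ m := by
  intro z₀ hz₀
  by_contra! hlt
  have hgap : 0 < u z₀ - m := by linarith
  set ε₂ : ℝ := (u z₀ - m) / 3 with hε₂
  have hε₂pos : 0 < ε₂ := by positivity
  have hcosh : 0 < Real.cosh z₀.1 := Real.cosh_pos _
  set ε₁ : ℝ := (u z₀ - m) / (3 * Real.cosh z₀.1) with hε₁
  have hε₁pos : 0 < ε₁ := by positivity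
  have hε₁c : ε₁ * Real.cosh z₀.1 = ε₂ := by rw [hε₁, hε₂]; field_simp
  have hcos : ∀ t ∈ Icc (0 : ℝ) 1, 1 / 2 ≤ Real.cos (t - 1 / 2) := by
    intro t ht
    have := Real.one_sub_sq_div_two_le_cos (x := t - 1 / 2)
    nlinarith [ht.1, ht.2]
  -- subtracting the harmonic barrier forces an interior maximum; the term `ε₂ t²` makes the
  -- Laplacian strictly positive, which is impossible there
  let w : ℝ × ℝ → ℝ := fun z =>
    u z - ε₁ * (Real.cosh z.1 * Real.cos (z.2 - 1 / 2)) + ε₂ * z.2 ^ 2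
  have hw₀ : m + ε₂ < w z₀ := by
    have h1 : Real.cosh z₀.1 * Real.cos (z₀.2 - 1 / 2) ≤ Real.cosh z₀.1 := by
      nlinarith [Real.cos_le_one (z₀.2 - 1 / 2)]
    have h2 : ε₁ * (Real.cosh z₀.1 * Real.cos (z₀.2 - 1 / 2)) ≤ ε₂ := by
      rw [← hε₁c]; gcongr
    have h3 : 0 ≤ ε₂ * z₀.2 ^ 2 := by positivity
    have h4 : u z₀ = m + 3 * ε₂ := by rw [hε₂]; ring
    simp only [w]
    linarith
  set R : ℝ := max |z₀.1| (2 * (|B| + |m|) / ε₁) + 1 with hR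
  have hR1 : |z₀.1| < R := by
    have := le_max_left |z₀.1| (2 * (|B| + |m|) / ε₁); linarith
  have hR2 : |B| + |m| ≤ ε₁ * R / 2 := by
    have := le_max_right |z₀.1| (2 * (|B| + |m|) / ε₁)
    have h' : 2 * (|B| + |m|) / ε₁ ≤ R := by linarith
    rw [div_le_iff₀ hε₁pos] at h'
    linarith
  have hend : ∀ z ∈ strip, |z.1| = R → w z ≤ m + ε₂ := by
    intro z hz hzR
    have ht : z.2 ∈ Icc (0 : ℝ) 1 := hz.2
    have h1 : R / 2 ≤ Real.cosh z.1 * Real.cos (z.2 - 1 / 2) := by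
      have h2 := hcos _ ht
      have h3 := abs_le_cosh z.1
      have h4 : 0 ≤ |z.1| := abs_nonneg _
      rw [hzR] at h3 h4
      nlinarith
    have h2 : ε₁ * (R / 2) ≤ ε₁ * (Real.cosh z.1 * Real.cos (z.2 - 1 / 2)) := by gcongr
    have h3 : ε₂ * z.2 ^ 2 ≤ ε₂ * 1 := by gcongr; exact pow_le_one₀ ht.1 ht.2
    have h4 := hB z hz
    have h5 := le_abs_self B
    have h6 := neg_abs_le m
    simp only [w]
    linarith
  have hbot' : ∀ τ, w (τ, 0) ≤ m + ε₂ := by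
    intro τ
    have h1 : 0 ≤ ε₁ * (Real.cosh τ * Real.cos (0 - 1 / 2)) := by
      have := hcos 0 (by simp)
      have := Real.cosh_pos τ
      positivity
    have := hbot τ
    simp only [w]
    nlinarith
  have htop' : ∀ τ, w (τ, 1) ≤ m + ε₂ := by
    intro τ
    have h1 : 0 ≤ ε₁ * (Real.cosh τ * Real.cos (1 - 1 / 2)) := by
      have := hcos 1 (by simp)
      have := Real.cosh_pos τ
      positivity
    have := htop τ
    simp only [w]
    nlinarith
  have hK : IsCompact (Icc (-R) R ×ˢ Icc (0 : ℝ) 1) := isCompact_Icc.prod isCompact_Icc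
  have hKs : Icc (-R) R ×ˢ Icc (0 : ℝ) 1 ⊆ strip := fun z hz => ⟨mem_univ _, hz.2⟩
  have hwc : ContinuousOn w (Icc (-R) R ×ˢ Icc (0 : ℝ) 1) := by
    have := hc.mono hKs
    simp only [w]
    fun_prop
  have hz₀K : z₀ ∈ Icc (-R) R ×ˢ Icc (0 : ℝ) 1 := by
    refine ⟨?_, hz₀.2⟩
    have := abs_lt.1 hR1
    exact ⟨this.1.le, this.2.le⟩
  obtain ⟨z₁, hz₁, hmax⟩ := hK.exists_isMaxOn ⟨z₀, hz₀K⟩ hwc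
  have hw₁ : m + ε₂ < w z₁ := hw₀.trans_le (hmax hz₀K)
  have ht : z₁.2 ∈ Ioo (0 : ℝ) 1 := by
    refine ⟨lt_of_le_of_ne hz₁.2.1 fun h => ?_, lt_of_le_of_ne hz₁.2.2 fun h => ?_⟩
    · have := hbot' z₁.1
      rw [h] at this
      exact absurd hw₁ this.not_gt
    · have := htop' z₁.1
      rw [← h] at this
      exact absurd hw₁ this.not_gt
  have hτ : z₁.1 ∈ Ioo (-R) R := by
    refine abs_lt.1 (lt_of_le_of_ne (abs_le.2 hz₁.1) fun h => ?_)
    exact absurd hw₁ (hend z₁ (hKs hz₁) h).not_gt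
  have hlocal : IsLocalMax w z₁ := hmax.isLocalMax
    (prod_mem_nhds (Icc_mem_nhds hτ.1 hτ.2) (Icc_mem_nhds ht.1 ht.2))
  obtain ⟨a1, a2⟩ := hasDerivAt_horizontal (hd z₁ ht)
  obtain ⟨b1, b2⟩ := hasDerivAt_vertical (hd z₁ ht)
  have hc1 : Tendsto (fun s : ℝ => (s, z₁.2)) (𝓝 z₁.1) (𝓝 z₁) :=
    (by fun_prop : Continuous fun s : ℝ => (s, z₁.2)).tendsto z₁.1
  have hc2 : Tendsto (fun s : ℝ => (z₁.1, s)) (𝓝 z₁.2) (𝓝 z₁) :=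
    (by fun_prop : Continuous fun s : ℝ => (z₁.1, s)).tendsto z₁.2
  have h1 := second_deriv_nonpos_of_isLocalMax (f := fun s => w (s, z₁.2))
    (f' := fun s => fderiv ℝ u (s, z₁.2) (1, 0) -
      ε₁ * (Real.sinh s * Real.cos (z₁.2 - 1 / 2)))
    (d := fderiv ℝ (fun w => fderiv ℝ u w (1, 0)) z₁ (1, 0) -
      ε₁ * (Real.cosh z₁.1 * Real.cos (z₁.2 - 1 / 2)))
    (a1.mono fun s hs =>
      (hs.fun_sub (((Real.hasDerivAt_cosh s).mul_const (Real.cos (z₁.2 - 1 / 2))).const_mul ε₁)).add_const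
        (ε₂ * z₁.2 ^ 2))
    (a2.fun_sub (((Real.hasDerivAt_sinh _).mul_const _).const_mul ε₁))
    (hc1.eventually hlocal)
  have hsub : ∀ s : ℝ, HasDerivAt (fun s : ℝ => s - 1 / 2) 1 s := fun s =>
    (hasDerivAt_id s).sub_const _
  have h2 := second_deriv_nonpos_of_isLocalMax (f := fun s => w (z₁.1, s))
    (f' := fun s => fderiv ℝ u (z₁.1, s) (0, 1) -
      ε₁ * (Real.cosh z₁.1 * (-Real.sin (s - 1 / 2) * 1)) + ε₂ * (2 * s))
    (d := fderiv ℝ (fun w => fderiv ℝ u w (0, 1)) z₁ (0, 1) -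
      ε₁ * (Real.cosh z₁.1 * (-(Real.cos (z₁.2 - 1 / 2) * 1) * 1)) + ε₂ * (2 * 1))
    (b1.mono fun s hs => by
      have hsq : HasDerivAt (fun s : ℝ => s ^ 2) (2 * s) s := by
        simpa using hasDerivAt_pow 2 s
      exact (hs.fun_sub (((hsub s).cos.const_mul (Real.cosh z₁.1)).const_mul ε₁)).fun_add
        (hsq.const_mul ε₂))
    ((b2.fun_sub (((((hsub z₁.2).sin).fun_neg.mul_const
      1).const_mul (Real.cosh z₁.1)).const_mul ε₁)).fun_add
        (((hasDerivAt_id z₁.2).const_mul 2).const_mul ε₂))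
    (hc2.eventually hlocal)
  have h3 := hl z₁ ht
  unfold lap at h3
  linarith

/-! ### Integration by parts -/

/-- Integrating the Laplacian of a `C²` function supported in the strip against a compactly supported
function of the first variable: since `χ` does not depend on the second variable, only `χ''`
remains. -/
theorem integral_mul_lap {χ χ₁ χ₂ : ℝ → ℝ} (h1 : ∀ s, HasDerivAt χ (χ₁ s) s)
    (h2 : ∀ s, HasDerivAt χ₁ (χ₂ s) s) (hχ₂ : Continuous χ₂) {a : ℝ} (hχ : ∀ s, a ≤ |s| → χ s = 0)
    (hχ₁ : ∀ s, a ≤ |s| → χ₁ s = 0) (hχ₂' : ∀ s, a ≤ |s| → χ₂ s = 0)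
    {F : ℝ × ℝ → ℝ} (hF : ContDiff ℝ 2 F) (hFs : ∀ z ∉ strip, F z = 0) :
    Integrable (fun z => χ z.1 * lap F z) ∧
      ∫ z, χ z.1 * lap F z = ∫ z, χ₂ z.1 * F z := by
  have hstrip : IsClosed strip := by
    unfold strip; exact isClosed_univ.prod isClosed_Icc
  have hzero : ∀ z ∉ strip, F =ᶠ[𝓝 z] fun _ => 0 := fun z hz => by
    filter_upwards [hstrip.isOpen_compl.mem_nhds hz] with w hw using hFs w hw
  have hF1 : ContDiff ℝ 1 (fderiv ℝ F) := hF.fderiv_right (by norm_num)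
  have hG : ∀ e, ContDiff ℝ 1 fun w => fderiv ℝ F w e := fun e => hF1.clm_apply contDiff_const
  have hGs : ∀ e, ∀ z ∉ strip, (fun w => fderiv ℝ F w e) =ᶠ[𝓝 z] fun _ => 0 := fun e z hz => by
    filter_upwards [(hzero z hz).fderiv (𝕜 := ℝ)] with w hw
    rw [hw]; simp
  have hGG : ∀ e, Continuous fun z => fderiv ℝ (fun w => fderiv ℝ F w e) z e := fun e =>
    ((hG e).continuous_fderiv one_ne_zero).clm_apply continuous_const
  have hGGs : ∀ e, ∀ z ∉ strip, fderiv ℝ (fun w => fderiv ℝ F w e) z e = 0 := fun e z hz => by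
    rw [(hGs e z hz).fderiv_eq]; simp
  -- products with a function of `τ` supported in `[-a, a]` have compact support
  have hint : ∀ (ψ : ℝ → ℝ) (G : ℝ × ℝ → ℝ), Continuous ψ → Continuous G →
      (∀ s, a ≤ |s| → ψ s = 0) → (∀ z ∉ strip, G z = 0) → Integrable fun z => ψ z.1 * G z := by
    intro ψ G hψ hG hψs hGs
    apply Continuous.integrable_of_hasCompactSupport (by fun_prop)
    refine HasCompactSupport.intro (K := Icc (-a) a ×ˢ Icc (0 : ℝ) 1)
      (isCompact_Icc.prod isCompact_Icc) fun z hz => ?_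
    by_cases h : z ∈ strip
    · rw [hψs, zero_mul]
      by_contra! hlt
      have := abs_lt.1 hlt
      exact hz ⟨⟨this.1.le, this.2.le⟩, h.2⟩
    · rw [hGs z h, mul_zero]
  have hχc : Continuous χ := continuous_iff_continuousAt.2 fun s => (h1 s).continuousAt
  have hχ₁c : Continuous χ₁ := continuous_iff_continuousAt.2 fun s => (h2 s).continuousAt
  have hd : ∀ (ψ ψ' : ℝ → ℝ), (∀ s, HasDerivAt ψ (ψ' s) s) → ∀ z : ℝ × ℝ,
      HasFDerivAt (fun z : ℝ × ℝ => ψ z.1)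
        ((ContinuousLinearMap.toSpanSingleton ℝ (ψ' z.1)).comp
          (ContinuousLinearMap.fst ℝ ℝ ℝ)) z := fun ψ ψ' h z =>
    (h z.1).hasFDerivAt.comp z hasFDerivAt_fst
  have hfd : ∀ (ψ ψ' : ℝ → ℝ), (∀ s, HasDerivAt ψ (ψ' s) s) → ∀ z e : ℝ × ℝ,
      fderiv ℝ (fun z : ℝ × ℝ => ψ z.1) z e = e.1 * ψ' z.1 := fun ψ ψ' h z e => by
    rw [(hd ψ ψ' h z).fderiv]; simp
  have parts : ∀ (ψ ψ' : ℝ → ℝ) (G : ℝ × ℝ → ℝ) (e : ℝ × ℝ), (∀ s, HasDerivAt ψ (ψ' s) s) →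
      Continuous ψ' → ContDiff ℝ 1 G → (∀ s, a ≤ |s| → ψ s = 0) → (∀ s, a ≤ |s| → ψ' s = 0) →
      (∀ z ∉ strip, G =ᶠ[𝓝 z] fun _ => 0) →
      ∫ z, ψ z.1 * fderiv ℝ G z e = - ∫ z, e.1 * (ψ' z.1 * G z) := by
    intro ψ ψ' G e hψ hψ'c hG hψs hψ's hGs
    have hψc : Continuous ψ := continuous_iff_continuousAt.2 fun s => (hψ s).continuousAt
    have hG0 : ∀ z ∉ strip, G z = 0 := fun z hz => (hGs z hz).self_of_nhds
    have hG1 : ∀ z ∉ strip, fderiv ℝ G z e = 0 := fun z hz => by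
      rw [(hGs z hz).fderiv_eq]; simp
    have := integral_mul_fderiv_eq_neg_fderiv_mul_of_integrable (𝕜 := ℝ) (μ := volume)
      (f := fun z : ℝ × ℝ => ψ z.1) (g := G) (v := e)
      (by
        simp only [hfd ψ ψ' hψ, mul_assoc]
        exact (hint ψ' G hψ'c hG.continuous hψ's hG0).const_mul _)
      (hint ψ _ hψc ((hG.continuous_fderiv one_ne_zero).clm_apply continuous_const) hψs hG1)
      (hint ψ G hψc hG.continuous hψs hG0)
      (fun z _ => (hd ψ ψ' hψ z).differentiableAt) (fun z _ => hG.differentiable one_ne_zero z)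
    rw [this]
    simp only [hfd ψ ψ' hψ, mul_assoc]
  have i1 := hint χ _ hχc (hGG (1, 0)) hχ (hGGs (1, 0))
  have i2 := hint χ _ hχc (hGG (0, 1)) hχ (hGGs (0, 1))
  have hsplit : ∀ z, χ z.1 * lap F z =
      χ z.1 * fderiv ℝ (fun w => fderiv ℝ F w (1, 0)) z (1, 0) +
      χ z.1 * fderiv ℝ (fun w => fderiv ℝ F w (0, 1)) z (0, 1) := fun z => by
    unfold lap; ring
  simp only [hsplit]
  refine ⟨i1.add i2, ?_⟩
  rw [integral_add i1 i2, parts χ χ₁ _ (1, 0) h1 hχ₁c (hG _) hχ hχ₁ (hGs _),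
    parts χ χ₁ _ (0, 1) h1 hχ₁c (hG _) hχ hχ₁ (hGs _)]
  have := parts χ₁ χ₂ F (1, 0) h2 hχ₂ (hF.of_le (by norm_num)) hχ₁ hχ₂' hzero
  simp only [one_mul] at this ⊢
  rw [this]
  simp

/-! ### A logarithmic test function -/

theorem exists_bound_deriv_smoothTransition :
    ∃ b : ℝ, 0 < b ∧ ∀ x, |deriv Real.smoothTransition x| ≤ b := by
  have hsm : ContDiff ℝ 1 Real.smoothTransition := Real.smoothTransition.contDiff
  have hc : Continuous (deriv Real.smoothTransition) := hsm.continuous_deriv le_rfl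
  obtain ⟨b, hb⟩ := (isCompact_Icc (a := (-1 : ℝ)) (b := 2)).exists_bound_of_continuousOn
    hc.continuousOn
  refine ⟨max b 1, by positivity, fun x => ?_⟩
  by_cases hx : x ∈ Icc (-1 : ℝ) 2
  · exact (hb x hx).trans (le_max_left _ _)
  · have h0 : deriv Real.smoothTransition x = 0 := by
      rw [mem_Icc, not_and_or, not_le, not_le] at hx
      rcases hx with hx | hx
      · have : Real.smoothTransition =ᶠ[𝓝 x] fun _ => 0 := by
          filter_upwards [Iio_mem_nhds hx] with y hy
          exact Real.smoothTransition.zero_of_nonpos (by have : y < -1 := hy; linarith)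
        rw [this.deriv_eq]; simp
      · have : Real.smoothTransition =ᶠ[𝓝 x] fun _ => 1 := by
          filter_upwards [Ioi_mem_nhds hx] with y hy
          exact Real.smoothTransition.one_of_one_le (by have : 2 < y := hy; linarith)
        rw [this.deriv_eq]; simp
    rw [h0, abs_zero]
    positivity

/-- The pointwise inequality behind the test function: `h ↦ log (h + η) + 4 C √(h + η)` is
subharmonic along a map for which `h` satisfies the two differential inequalities, with a definite
Laplacian near the zeros of `h`. Here `σ = √(h + η)`. -/
theorem log_laplacian_lower_bound {C σ h η e l q : ℝ} (hC : 0 ≤ C) (hσ : 0 < σ)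
    (hη : 0 < η) (hh : 0 ≤ h) (hσh : σ ^ 2 = h + η) (hCσ : 3 * C * σ ≤ 2) (he : 0 ≤ e)
    (hl : (4 - C * √h) * e ≤ l) (hq : q ≤ (4 + C * √h) * (h * e)) :
    4 * η / (h + η) ^ 2 * e ≤
      (1 + 2 * C * σ) / σ ^ 2 * l - (1 / σ ^ 4 + C / σ ^ 3) * q := by
  have hs : √h ≤ σ := by
    rw [Real.sqrt_le_left hσ.le]; nlinarith
  have hl' : (4 - C * σ) * e ≤ l := by
    refine le_trans ?_ hl; gcongr
  have hq' : q ≤ (4 + C * σ) * ((σ ^ 2 - η) * e) := by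
    refine hq.trans ?_
    have : h = σ ^ 2 - η := by linarith
    rw [this] at hh hs ⊢
    gcongr
  have h1 : (1 + 2 * C * σ) / σ ^ 2 * ((4 - C * σ) * e) ≤ (1 + 2 * C * σ) / σ ^ 2 * l := by
    gcongr
  have h2 : (1 / σ ^ 4 + C / σ ^ 3) * q ≤
      (1 / σ ^ 4 + C / σ ^ 3) * ((4 + C * σ) * ((σ ^ 2 - η) * e)) := by
    gcongr
  have h3 : (1 + 2 * C * σ) / σ ^ 2 * ((4 - C * σ) * e) -
      (1 / σ ^ 4 + C / σ ^ 3) * ((4 + C * σ) * ((σ ^ 2 - η) * e)) - 4 * η / (h + η) ^ 2 * e =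
      e * (C * σ * (2 - 3 * C * σ) * σ ^ 2 + η * (5 * C * σ + (C * σ) ^ 2)) / σ ^ 4 := by
    rw [← hσh]
    field_simp
    ring
  have h4 : 0 ≤ e * (C * σ * (2 - 3 * C * σ) * σ ^ 2 + η * (5 * C * σ + (C * σ) ^ 2)) / σ ^ 4 := by
    have : 0 ≤ 2 - 3 * C * σ := by linarith
    positivity
  linarith

/-- A test function `T` on `[0, ∞)` which vanishes beyond `r²`, and whose derivative is that of
`log (h + η) + 4 C √(h + η)` for `h < r² / 2`. Composed with a function `h` that satisfies the two
differential inequalities with energy density `e`, it has Laplacian at least `-O(r⁻²) e`, and a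
definite positive Laplacian where `h` is at most of the order of `η`. -/
theorem exists_logarithmic_test_function {b : ℝ}
    (hb' : ∀ x, |deriv Real.smoothTransition x| ≤ b) {C r η : ℝ} (hC : 0 ≤ C) (hr : 0 < r)
    (hη : 0 < η) (hηr : η ≤ 3 * r ^ 2) (hCr : 3 * C * r ≤ 1) :
    ∃ T T₁ T₂ : ℝ → ℝ, ContDiffOn ℝ 2 T (Ioi (-η)) ∧ (∀ h > -η, HasDerivAt T (T₁ h) h) ∧
      (∀ h > -η, HasDerivAt T₁ (T₂ h) h) ∧ (∀ h, r ^ 2 ≤ h → T h = 0) ∧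
      ∀ h e l q : ℝ, 0 ≤ h → h ≤ r ^ 2 → 0 ≤ e → 0 ≤ q → (4 - C * √h) * e ≤ l →
        q ≤ (4 + C * √h) * (h * e) →
        -(24 * b / r ^ 2) * e ≤ T₁ h * l + T₂ h * q ∧
        (h < r ^ 2 / 2 → 4 * η / (h + η) ^ 2 * e ≤ T₁ h * l + T₂ h * q) := by
  set σ : ℝ → ℝ := fun h => √(h + η) with hσdef
  have hσpos : ∀ h > -η, 0 < σ h := fun h hh => Real.sqrt_pos.2 (by linarith)
  have hσsq : ∀ h > -η, σ h ^ 2 = h + η := fun h hh => Real.sq_sqrt (by linarith)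
  set g : ℝ → ℝ := fun h => (1 + 2 * C * σ h) / σ h ^ 2 with hg
  set g' : ℝ → ℝ := fun h => -(1 / σ h ^ 4 + C / σ h ^ 3) with hg'
  set β : ℝ → ℝ := fun h => Real.smoothTransition (2 - 2 * h / r ^ 2) with hβ
  set β' : ℝ → ℝ := fun h => deriv Real.smoothTransition (2 - 2 * h / r ^ 2) * (-(2 / r ^ 2))
    with hβ'
  have hST : ContDiff ℝ 1 Real.smoothTransition := Real.smoothTransition.contDiff
  have hσd : ∀ h > -η, HasDerivAt σ (1 / (2 * σ h)) h := fun h hh => by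
    have := ((hasDerivAt_id h).add_const η).sqrt (by simp only [id]; linarith)
    simpa using this
  have hgd : ∀ h > -η, HasDerivAt g (g' h) h := fun h hh => by
    have h1 := (((hσd h hh).const_mul (2 * C)).const_add 1).fun_div ((hσd h hh).fun_pow 2)
      (pow_ne_zero 2 (hσpos h hh).ne')
    refine h1.congr_deriv ?_
    have := hσpos h hh
    simp only [hg']
    field_simp
    ring
  have hβd : ∀ h, HasDerivAt β (β' h) h := fun h => by
    have h1 : HasDerivAt (fun h : ℝ => 2 - 2 * h / r ^ 2) (-(2 / r ^ 2)) h := by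
      have := (((hasDerivAt_id h).const_mul 2).div_const (r ^ 2)).const_sub 2
      simpa using this
    exact ((hST.differentiable one_ne_zero _).hasDerivAt).comp h h1
  have hσc : ContDiffOn ℝ 1 σ (Ioi (-η)) := fun h hh =>
    ((contDiffAt_id.add contDiffAt_const).sqrt
      (by simp only [id]; have : -η < h := hh; linarith)).contDiffWithinAt
  have hgc : ContDiffOn ℝ 1 g (Ioi (-η)) :=
    (contDiffOn_const.add (contDiffOn_const.mul hσc)).div (hσc.pow 2)
      fun h hh => pow_ne_zero 2 (hσpos h hh).ne'
  have hβc : ContDiff ℝ 1 β := hST.comp (by fun_prop)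
  have hT₁c : ContDiffOn ℝ 1 (fun h => g h * β h) (Ioi (-η)) := hgc.mul hβc.contDiffOn
  have hr2 : 0 < r ^ 2 := by positivity
  have hTd : ∀ h > -η, HasDerivAt (fun h => ∫ x in (r ^ 2)..h, g x * β x) (g h * β h) h := by
    intro h hh
    have hcont := hT₁c.continuousOn
    refine intervalIntegral.integral_hasDerivAt_right ?_ ?_ ?_
    · refine (hcont.mono fun x hx => ?_).intervalIntegrable
      have := hx.1
      have h2 : min (r ^ 2) h ≤ x := this
      exact lt_of_lt_of_le (lt_min (by linarith) hh) h2
    · exact hcont.stronglyMeasurableAtFilter isOpen_Ioi h hh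
    · exact hcont.continuousAt (Ioi_mem_nhds hh)
  refine ⟨fun h => ∫ x in (r ^ 2)..h, g x * β x, fun h => g h * β h,
    fun h => g' h * β h + g h * β' h, ?_, hTd, fun h hh => (hgd h hh).mul (hβd h), ?_, ?_⟩
  · rw [show (2 : WithTop ℕ∞) = 1 + 1 from rfl, contDiffOn_succ_iff_deriv_of_isOpen isOpen_Ioi]
    refine ⟨fun h hh => (hTd h hh).differentiableAt.differentiableWithinAt, by simp,
      hT₁c.congr fun h hh => (hTd h hh).deriv⟩
  · intro h hh
    beta_reduce
    rw [intervalIntegral.integral_congr (g := fun _ => (0 : ℝ)) ?_]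
    · simp
    · intro x hx
      rw [uIcc_of_le hh] at hx
      have : β x = 0 := by
        apply Real.smoothTransition.zero_of_nonpos
        have : 1 ≤ x / r ^ 2 := (one_le_div hr2).2 hx.1
        rw [mul_div_assoc]; linarith
      simp [this]
  · intro h e l q hh hhr he hq0 hl hq
    have hhη : h > -η := by linarith
    have hσp := hσpos h hhη
    have hσs := hσsq h hhη
    have hσ2 : σ h ≤ 2 * r := by
      refine abs_le_of_sq_le_sq' ?_ (by positivity) |>.2
      rw [hσs]; nlinarith
    have hCσ : 3 * C * σ h ≤ 2 := by nlinarith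
    have key := log_laplacian_lower_bound hC hσp hη hh hσs hCσ he hl hq
    have hβ0 : 0 ≤ β h := Real.smoothTransition.nonneg _
    have hexp : g h * β h * l + (g' h * β h + g h * β' h) * q =
        β h * ((1 + 2 * C * σ h) / σ h ^ 2 * l - (1 / σ h ^ 4 + C / σ h ^ 3) * q) +
          g h * β' h * q := by
      simp only [hg, hg']; ring
    have hpos : 0 ≤ 4 * η / (h + η) ^ 2 * e := by positivity
    have hmain : 0 ≤ β h *
        ((1 + 2 * C * σ h) / σ h ^ 2 * l - (1 / σ h ^ 4 + C / σ h ^ 3) * q) :=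
      mul_nonneg hβ0 (hpos.trans key)
    refine ⟨?_, fun hlt => ?_⟩
    · rw [hexp]
      have hσh : √h ≤ σ h := Real.sqrt_le_sqrt (by linarith)
      have hg0 : 0 ≤ g h := by simp only [hg]; positivity
      have h1 : g h * q ≤ 12 * e := by
        have e1 : g h * q ≤ g h * ((4 + C * σ h) * (σ h ^ 2 * e)) := by
          gcongr
          refine hq.trans ?_
          have : h ≤ σ h ^ 2 := by linarith
          gcongr
        have e2 : g h * ((4 + C * σ h) * (σ h ^ 2 * e)) =
            (1 + 2 * (C * σ h)) * (4 + C * σ h) * e := by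
          simp only [hg]; field_simp
        rw [e2] at e1
        refine e1.trans ?_
        have h0 : 0 ≤ C * σ h := by positivity
        have h0' : C * σ h ≤ 2 / 3 := by linarith
        gcongr
        nlinarith
      have h2 : |β' h| ≤ 2 * b / r ^ 2 := by
        simp only [hβ']
        rw [abs_mul, abs_neg, abs_of_pos (a := 2 / r ^ 2) (by positivity)]
        calc _ ≤ b * (2 / r ^ 2) := by gcongr; exact hb' _
          _ = _ := by ring
      have h3 : -(24 * b / r ^ 2) * e ≤ g h * β' h * q := by
        have h4 : |g h * β' h * q| ≤ 24 * b / r ^ 2 * e := by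
          calc |g h * β' h * q| = (g h * q) * |β' h| := by
                rw [abs_mul, abs_mul, abs_of_nonneg hg0, abs_of_nonneg hq0]; ring
            _ ≤ (12 * e) * (2 * b / r ^ 2) := by gcongr
            _ = _ := by ring
        have := neg_abs_le (g h * β' h * q)
        linarith
      linarith
    · -- the cutoff is constant on `h < r² / 2`
      have hone : ∀ x, x ≤ r ^ 2 / 2 → β x = 1 := fun x hx => by
        apply Real.smoothTransition.one_of_one_le
        have : x / r ^ 2 ≤ 1 / 2 := by rw [div_le_iff₀ hr2]; linarith
        rw [mul_div_assoc]; linarith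
      have hβ'0 : β' h = 0 := by
        have : β =ᶠ[𝓝 h] fun _ => 1 := by
          filter_upwards [Iio_mem_nhds hlt] with y hy using hone y (le_of_lt hy)
        rw [← (hβd h).deriv, this.deriv_eq]; simp
      rw [hexp, hβ'0, hone h hlt.le]
      linarith

/-- The chain rule for the Laplacian: `Δ(T ∘ h) = T'(h) Δh + T''(h) |∇h|²`. -/
theorem lap_comp {T T₁ T₂ : ℝ → ℝ} {h : ℝ × ℝ → ℝ} {z : ℝ × ℝ} (hh : ContDiffAt ℝ 2 h z)
    (hT : ∀ᶠ x in 𝓝 (h z), HasDerivAt T (T₁ x) x) (hT₁ : HasDerivAt T₁ (T₂ (h z)) (h z)) :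
    lap (fun w => T (h w)) z = T₁ (h z) * lap h z +
      T₂ (h z) * (fderiv ℝ h z (1, 0) ^ 2 + fderiv ℝ h z (0, 1) ^ 2) := by
  have h1 : ∀ e : ℝ × ℝ, (fun w => fderiv ℝ (fun w => T (h w)) w e) =ᶠ[𝓝 z]
      fun w => T₁ (h w) * fderiv ℝ h w e := fun e => by
    filter_upwards [hh.continuousAt.eventually hT, eventually_differentiableAt hh] with w hw hd
    have := hw.comp_hasFDerivAt w hd.hasFDerivAt
    rw [show fderiv ℝ (fun w => T (h w)) w = T₁ (h w) • fderiv ℝ h w from this.fderiv]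
    simp
  have h2 : ∀ e : ℝ × ℝ, fderiv ℝ (fun w => T₁ (h w) * fderiv ℝ h w e) z e =
      T₁ (h z) * fderiv ℝ (fun w => fderiv ℝ h w e) z e + T₂ (h z) * fderiv ℝ h z e ^ 2 := by
    intro e
    have a := hT₁.comp_hasFDerivAt z (hh.differentiableAt two_ne_zero).hasFDerivAt
    have b := (differentiableAt_fderiv_apply hh e).hasFDerivAt
    have c := a.mul b
    rw [show fderiv ℝ (fun w => T₁ (h w) * fderiv ℝ h w e) z = _ from c.fderiv]
    simp only [add_apply, smul_apply, smul_eq_mul,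
      Function.comp]
    ring
  unfold lap
  rw [(h1 _).fderiv_eq, (h1 _).fderiv_eq, h2, h2]
  ring

/-- Cutoff functions on the line, constant on long intervals and with small second derivative. -/
theorem exists_long_cutoff : ∃ B : ℝ, 0 ≤ B ∧ ∀ k : ℝ, 0 < k → ∃ χ χ₁ χ₂ : ℝ → ℝ,
    (∀ s, HasDerivAt χ (χ₁ s) s) ∧ (∀ s, HasDerivAt χ₁ (χ₂ s) s) ∧ Continuous χ₂ ∧
    (∀ s, 3 * k ≤ |s| → χ s = 0) ∧ (∀ s, 3 * k ≤ |s| → χ₁ s = 0) ∧ (∀ s, 3 * k ≤ |s| → χ₂ s = 0) ∧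
    (∀ s, 0 ≤ χ s) ∧ (∀ s, χ s ≤ 1) ∧ (∀ s, |s| ≤ k → χ s = 1) ∧ ∀ s, |χ₂ s| ≤ B / k ^ 2 := by
  let f : ContDiffBump (0 : ℝ) := ⟨1, 2, one_pos, one_lt_two⟩
  have hf : ContDiff ℝ 2 f := f.contDiff
  have hf1 : ContDiff ℝ 1 (deriv f) := by
    rw [show (2 : WithTop ℕ∞) = 1 + 1 from rfl, contDiff_succ_iff_deriv] at hf
    exact hf.2.2
  have hz : ∀ s : ℝ, 3 ≤ |s| → (f : ℝ → ℝ) =ᶠ[𝓝 s] fun _ => 0 := fun s hs => by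
    filter_upwards [(continuous_abs.tendsto s).eventually (lt_mem_nhds (by linarith : 2 < |s|))]
      with y hy
    exact f.zero_of_le_dist (by rw [Real.dist_eq, sub_zero]; exact le_of_lt hy)
  have hz1 : ∀ s : ℝ, 3 ≤ |s| → deriv f =ᶠ[𝓝 s] fun _ => 0 := fun s hs => by
    simpa using (hz s hs).deriv
  have hz2 : ∀ s : ℝ, 3 ≤ |s| → deriv (deriv f) s = 0 := fun s hs => by
    rw [(hz1 s hs).deriv_eq]; simp
  have hc2 : Continuous (deriv (deriv f)) := hf1.continuous_deriv le_rfl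
  obtain ⟨B, hB⟩ := (isCompact_Icc (a := (-3 : ℝ)) (b := 3)).exists_bound_of_continuousOn
    hc2.continuousOn
  have hB0 : 0 ≤ B := (norm_nonneg _).trans (hB 0 (by simp))
  have hB' : ∀ s, |deriv (deriv f) s| ≤ B := fun s => by
    by_cases h : |s| ≤ 3
    · exact hB s (abs_le.1 h)
    · rw [hz2 s (not_le.1 h).le, abs_zero]; exact hB0
  have habs : ∀ k : ℝ, 0 < k → ∀ s : ℝ, 3 * k ≤ |s| → 3 ≤ |s / k| := fun k hk s hs => by
    rw [abs_div, abs_of_pos hk, le_div_iff₀ hk]; exact hs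
  refine ⟨B, hB0, fun k hk => ⟨fun s => f (s / k), fun s => deriv f (s / k) * (1 / k),
    fun s => deriv (deriv f) (s / k) * (1 / k) * (1 / k), ?_, ?_, ?_, ?_, ?_, ?_, ?_, ?_, ?_, ?_⟩⟩
  · intro s
    exact HasDerivAt.comp (h₂ := (f : ℝ → ℝ)) (h := fun s => s / k) s
      (hf.differentiable two_ne_zero (s / k)).hasDerivAt ((hasDerivAt_id s).div_const k)
  · intro s
    exact (HasDerivAt.comp (h₂ := deriv f) (h := fun s => s / k) s
      (hf1.differentiable one_ne_zero (s / k)).hasDerivAt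
      ((hasDerivAt_id s).div_const k)).mul_const (1 / k)
  · fun_prop
  · intro s hs; exact (hz _ (habs k hk s hs)).self_of_nhds
  · intro s hs; simp only [(hz1 _ (habs k hk s hs)).self_of_nhds, zero_mul]
  · intro s hs; simp only [hz2 _ (habs k hk s hs), zero_mul]
  · intro s; exact f.nonneg
  · intro s; exact f.le_one
  · intro s hs
    apply f.one_of_mem_closedBall
    rw [mem_closedBall_zero_iff, Real.norm_eq_abs, abs_div, abs_of_pos hk]
    exact (div_le_one hk).2 hs
  · intro s
    rw [abs_mul, abs_mul, abs_of_pos (a := 1 / k) (by positivity)]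
    calc _ ≤ B * (1 / k) * (1 / k) := by gcongr; exact hB' _
      _ = _ := by ring

/-! ### Monotonicity for a scalar test function -/

/-- A lower bound for the energy of a map from the strip near a point, in terms of a function `h`
which plays the role of the squared distance in the target from the image of `z₀`, and of an energy
density `e`. The total Laplacian of the logarithmic test function vanishes; its positive part near
`z₀` is bounded below independently of the scale `η`, and its negative part is at most `O(r⁻²)`
times the energy. The set `{h ≤ r²}` is closed but need not be compact: the cutoff in the first
variable, constant on `[-k, k]`, costs `O(1 / k)`. -/
theorem exists_energy_lower_bound : ∃ c : ℝ, 0 < c ∧ ∀ (C r : ℝ) (O : Set (ℝ × ℝ))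
    (h e : ℝ × ℝ → ℝ) (z₀ : ℝ × ℝ) (e₀ : ℝ), 0 ≤ C → 0 < r → 3 * C * r ≤ 1 → IsOpen O → O ⊆ strip →
    (∀ z ∈ O, ContDiffAt ℝ 2 h z) → (∀ z ∈ O, 0 ≤ h z) → (∀ z ∈ O, 0 ≤ e z) →
    (∀ z ∈ O, h z ≤ r ^ 2 → (4 - C * √(h z)) * e z ≤ lap h z) →
    (∀ z ∈ O, h z ≤ r ^ 2 → fderiv ℝ h z (1, 0) ^ 2 + fderiv ℝ h z (0, 1) ^ 2 ≤
      (4 + C * √(h z)) * (h z * e z)) →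
    IsClosed {z | z ∈ O ∧ h z ≤ r ^ 2} → z₀ ∈ O → 0 < e₀ →
    (∀ᶠ z in 𝓝 z₀, e₀ / 2 ≤ e z ∧ h z ≤ 9 * e₀ * ‖z - z₀‖ ^ 2) →
    ENNReal.ofReal (c * r ^ 2) ≤ ∫⁻ z in {z | z ∈ O ∧ h z ≤ r ^ 2}, ENNReal.ofReal (e z) := by
  obtain ⟨b, hb, hb'⟩ := exists_bound_deriv_smoothTransition
  obtain ⟨B, hB0, hcut⟩ := exists_long_cutoff
  refine ⟨1 / (25 * (24 * b)), by positivity, ?_⟩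
  intro C r O h e z₀ e₀ hC hr hCr hO hOs hh hh0 he0 hl hq hA hz₀ he₀ hnear
  set A := {z | z ∈ O ∧ h z ≤ r ^ 2} with hAdef
  have hr2 : 0 < r ^ 2 := by positivity
  -- a small square around `z₀` on which `h` is comparable to the scale `η`
  obtain ⟨s₁, hs₁, hball⟩ := Metric.eventually_nhds_iff_ball.1
    (hnear.and (hO.mem_nhds hz₀))
  set s : ℝ := min s₁ (r / (6 * √e₀)) with hsdef
  have hsq : 0 < √e₀ := Real.sqrt_pos.2 he₀
  have hspos : 0 < s := by positivity
  have hs2 : e₀ * s ^ 2 ≤ r ^ 2 / 36 := by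
    have h1 : s ≤ r / (6 * √e₀) := min_le_right _ _
    have h2 : s ^ 2 ≤ (r / (6 * √e₀)) ^ 2 := by gcongr
    rw [div_pow, mul_pow, Real.sq_sqrt he₀.le] at h2
    calc e₀ * s ^ 2 ≤ e₀ * (r ^ 2 / (6 ^ 2 * e₀)) := by gcongr
      _ = _ := by field_simp; norm_num
  set η : ℝ := e₀ * s ^ 2 with hηdef
  have hη : 0 < η := by positivity
  have hballO : ∀ z ∈ Metric.ball z₀ s, z ∈ O ∧ e₀ / 2 ≤ e z ∧ h z ≤ 9 * η := by
    intro z hz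
    have hz1 : z ∈ Metric.ball z₀ s₁ := Metric.ball_subset_ball (min_le_left _ _) hz
    obtain ⟨⟨h1, h2⟩, h3⟩ := hball z hz1
    refine ⟨h3, h1, h2.trans ?_⟩
    have : ‖z - z₀‖ < s := by rwa [← dist_eq_norm]
    have h4 : ‖z - z₀‖ ^ 2 ≤ s ^ 2 := by gcongr
    rw [hηdef]
    calc 9 * e₀ * ‖z - z₀‖ ^ 2 ≤ 9 * e₀ * s ^ 2 := by gcongr
      _ = _ := by ring
  obtain ⟨T, T₁, T₂, hTc, hT, hT₁, hT0, hTineq⟩ :=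
    exists_logarithmic_test_function hb' hC hr hη (by linarith) hCr
  -- the test function along the map, extended by zero
  classical
  set F : ℝ × ℝ → ℝ := fun z => if z ∈ O then T (h z) else 0 with hFdef
  have hF_out : ∀ z ∉ A, F z = 0 := fun z hz => by
    by_cases hzO : z ∈ O
    · simp only [hFdef, if_pos hzO]
      exact hT0 _ (le_of_lt (not_le.1 fun hle => hz ⟨hzO, hle⟩))
    · simp only [hFdef, if_neg hzO]
  have hF_in : ∀ z ∈ O, F =ᶠ[𝓝 z] fun w => T (h w) := fun z hz => by
    filter_upwards [hO.mem_nhds hz] with w hw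
    simp only [hFdef, if_pos hw]
  have hF_out' : ∀ z ∉ A, F =ᶠ[𝓝 z] fun _ => 0 := fun z hz => by
    filter_upwards [hA.isOpen_compl.mem_nhds hz] with w hw using hF_out w hw
  have hpos : ∀ z ∈ O, h z > -η := fun z hz => by have := hh0 z hz; linarith
  have hF : ContDiff ℝ 2 F := by
    rw [contDiff_iff_contDiffAt]
    intro z
    by_cases hz : z ∈ A
    · refine ContDiffAt.congr_of_eventuallyEq ?_ (hF_in z hz.1)
      exact (hTc.contDiffAt (Ioi_mem_nhds (hpos z hz.1))).comp z (hh z hz.1)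
    · exact contDiffAt_const.congr_of_eventuallyEq (hF_out' z hz)
  have hlap_out : ∀ z ∉ A, lap F z = 0 := fun z hz => by
    rw [lap_congr (hF_out' z hz)]
    simp [lap]
  have hlap_in : ∀ z ∈ A, -(24 * b / r ^ 2) * e z ≤ lap F z ∧
      (h z < r ^ 2 / 2 → 4 * η / (h z + η) ^ 2 * e z ≤ lap F z) := fun z hz => by
    have h1 : lap F z = T₁ (h z) * lap h z +
        T₂ (h z) * (fderiv ℝ h z (1, 0) ^ 2 + fderiv ℝ h z (0, 1) ^ 2) := by
      rw [lap_congr (hF_in z hz.1)]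
      refine lap_comp (hh z hz.1) ?_ (hT₁ _ (hpos z hz.1))
      filter_upwards [Ioi_mem_nhds (hpos z hz.1)] with x hx using hT x hx
    rw [h1]
    exact hTineq (h z) (e z) _ _ (hh0 z hz.1) hz.2 (he0 z hz.1) (by positivity)
      (hl z hz.1 hz.2) (hq z hz.1 hz.2)
  set κ : ℝ := 1 / (50 * s ^ 2) with hκ
  have hlap_ball : ∀ z ∈ Metric.ball z₀ s, z ∈ A ∧ κ ≤ lap F z := fun z hz => by
    obtain ⟨h1, h2, h3⟩ := hballO z hz
    have hzA : z ∈ A := ⟨h1, by linarith⟩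
    refine ⟨hzA, le_trans ?_ ((hlap_in z hzA).2 (by linarith))⟩
    have h4 := hh0 z h1
    have h5 : 4 * η / (10 * η) ^ 2 * (e₀ / 2) ≤ 4 * η / (h z + η) ^ 2 * e z := by
      gcongr
      linarith
    refine le_trans (le_of_eq ?_) h5
    rw [hκ, hηdef]
    field_simp
    norm_num
  have hFb : ∃ D, 0 ≤ D ∧ ∀ z, |F z| ≤ D := by
    have hcont : ContinuousOn T (Icc 0 (r ^ 2)) := hTc.continuousOn.mono fun x hx =>
      lt_of_lt_of_le (by linarith) hx.1
    obtain ⟨D, hD⟩ := isCompact_Icc.exists_bound_of_continuousOn hcont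
    have hD0 : 0 ≤ D := (norm_nonneg _).trans (hD 0 ⟨le_rfl, hr2.le⟩)
    refine ⟨D, hD0, fun z => ?_⟩
    by_cases hz : z ∈ A
    · simp only [hFdef, if_pos hz.1]
      exact hD _ ⟨hh0 z hz.1, hz.2⟩
    · rw [hF_out z hz, abs_zero]; exact hD0
  obtain ⟨D, hD0, hD⟩ := hFb
  set k : ℝ := max (|z₀.1| + s) (max 1 (6 * B * D * 25)) with hk
  have hk1 : 1 ≤ k := (le_max_left _ _).trans (le_max_right _ _)
  have hk2 : 6 * B * D * 25 ≤ k := (le_max_right _ _).trans (le_max_right _ _)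
  have hk0 : 0 < k := by linarith
  obtain ⟨χ, χ₁, χ₂, d1, d2, c2, s0, s1, s2, hχ0, hχ1, hχone, hχ₂⟩ := hcut k hk0
  have hFs : ∀ z ∉ strip, F z = 0 := fun z hz => hF_out z fun hzA => hz (hOs hzA.1)
  obtain ⟨hint, hparts⟩ := integral_mul_lap d1 d2 c2 s0 s1 s2 hF hFs
  -- the boundary terms are `O(1 / k)`
  have hsmall : ∫ z, χ₂ z.1 * F z ≤ 1 / 25 := by
    set S : Set (ℝ × ℝ) := Icc (-(3 * k)) (3 * k) ×ˢ Icc (0 : ℝ) 1 with hS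
    have hvol : volume S = ENNReal.ofReal (6 * k) := by
      rw [hS, Measure.volume_eq_prod, Measure.prod_prod, Real.volume_Icc, Real.volume_Icc,
        ← ENNReal.ofReal_mul (by linarith)]
      congr 1; ring
    have hz : ∀ z ∉ S, χ₂ z.1 * F z = 0 := fun z hz => by
      by_cases h1 : z ∈ strip
      · rw [s2, zero_mul]
        by_contra! hlt
        have := abs_lt.1 hlt
        exact hz ⟨⟨this.1.le, this.2.le⟩, h1.2⟩
      · rw [hFs z h1, mul_zero]
    rw [← setIntegral_eq_integral_of_forall_compl_eq_zero hz]
    have hle := norm_setIntegral_le_of_norm_le_const (μ := volume) (s := S)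
      (f := fun z => χ₂ z.1 * F z) (C := B / k ^ 2 * D)
      (by rw [hvol]; exact ENNReal.ofReal_lt_top) (fun z _ => by
        rw [Real.norm_eq_abs, abs_mul]
        gcongr
        · exact hχ₂ _
        · exact hD _)
    refine (le_abs_self _).trans (hle.trans ?_)
    rw [Measure.real, hvol, ENNReal.toReal_ofReal (by linarith)]
    have : B / k ^ 2 * D * (6 * k) = 6 * B * D / k := by field_simp
    rw [this, div_le_iff₀ hk0]
    linarith
  set f : ℝ × ℝ → ℝ := fun z => (Metric.ball z₀ s).indicator (fun _ => κ) z - χ z.1 * lap F z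
    with hf
  have hballvol : volume.real (Metric.ball z₀ s) = 4 * s ^ 2 := by
    rw [Measure.real, ← ball_prod_same, Measure.volume_eq_prod, Measure.prod_prod,
      Real.volume_ball, Real.volume_ball, ENNReal.toReal_mul,
      ENNReal.toReal_ofReal (by positivity)]
    ring
  have hintκ : Integrable ((Metric.ball z₀ s).indicator fun _ => κ) :=
    (integrableOn_const (by exact measure_ball_lt_top.ne)).integrable_indicator
      measurableSet_ball
  have hfint : Integrable f := hintκ.sub hint
  have hfval : 1 / 25 ≤ ∫ z, f z := by
    rw [hf, integral_sub hintκ hint, hparts, integral_indicator measurableSet_ball,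
      setIntegral_const, hballvol]
    have : (4 * s ^ 2) • κ = 2 / 25 := by
      rw [hκ, smul_eq_mul]; field_simp; norm_num
    rw [this]
    linarith
  have hfle : ∀ z, ENNReal.ofReal (f z) ≤
      A.indicator (fun z => ENNReal.ofReal (24 * b / r ^ 2) * ENNReal.ofReal (e z)) z := by
    intro z
    by_cases hzA : z ∈ A
    · rw [indicator_of_mem hzA, ← ENNReal.ofReal_mul (by positivity)]
      apply ENNReal.ofReal_le_ofReal
      have hpose : 0 ≤ 24 * b / r ^ 2 * e z := by
        have := he0 z hzA.1
        positivity
      by_cases hzb : z ∈ Metric.ball z₀ s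
      · have hone : χ z.1 = 1 := by
          apply hχone
          have h1 : |z.1 - z₀.1| < s := by
            have : Dist.dist z z₀ < s := Metric.mem_ball.1 hzb
            exact lt_of_le_of_lt (le_max_left _ _) this
          have h2 : |z.1| ≤ |z₀.1| + |z.1 - z₀.1| := by
            have := abs_add_le z₀.1 (z.1 - z₀.1)
            rwa [add_sub_cancel] at this
          exact (h2.trans (by linarith)).trans (le_max_left _ _)
        simp only [hf, indicator_of_mem hzb, hone, one_mul]
        linarith [(hlap_ball z hzb).2]
      · simp only [hf, indicator_of_notMem hzb, zero_sub]
        have h1 := (hlap_in z hzA).1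
        have h2 := hχ0 z.1
        have h3 := hχ1 z.1
        nlinarith
    · have hzb : z ∉ Metric.ball z₀ s := fun hzb => hzA (hlap_ball z hzb).1
      simp [hf, indicator_of_notMem hzb, hlap_out z hzA]
  have hfinal : ENNReal.ofReal (1 / 25) ≤
      ENNReal.ofReal (24 * b / r ^ 2) * ∫⁻ z in A, ENNReal.ofReal (e z) := by
    rw [← lintegral_const_mul' _ _ ENNReal.ofReal_ne_top,
      ← lintegral_indicator hA.measurableSet]
    refine le_trans ?_ (lintegral_mono hfle)
    refine (ENNReal.ofReal_le_ofReal hfval).trans ?_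
    have hmax : ∫ z, f z ≤ ∫ z, max (f z) 0 :=
      integral_mono hfint hfint.pos_part fun z => le_max_left _ _
    refine (ENNReal.ofReal_le_ofReal hmax).trans ?_
    rw [ofReal_integral_eq_lintegral_ofReal hfint.pos_part
      (Eventually.of_forall fun z => le_max_right _ _)]
    refine lintegral_mono fun z => ?_
    rcases le_total (f z) 0 with h0 | h0
    · simp [max_eq_right h0]
    · rw [max_eq_left h0]
  have h24 : ENNReal.ofReal (1 / (25 * (24 * b)) * r ^ 2) * ENNReal.ofReal (24 * b / r ^ 2) =
      ENNReal.ofReal (1 / 25) := by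
    rw [← ENNReal.ofReal_mul (by positivity)]
    congr 1; field_simp
  have hne : ENNReal.ofReal (24 * b / r ^ 2) ≠ 0 := by
    rw [Ne, ENNReal.ofReal_eq_zero, not_le]; positivity
  rw [← h24, mul_comm] at hfinal
  exact (ENNReal.mul_le_mul_iff_right hne ENNReal.ofReal_ne_top).1 hfinal

/-! ### Monotonicity for holomorphic curves in a coordinate domain -/

section Abstract

variable {G : Type*} [NormedAddCommGroup G] [InnerProductSpace ℝ G]

/-- Bessel's inequality for two orthogonal vectors of equal length, not necessarily nonzero. -/
theorem inner_sq_add_inner_sq_le {X A A' : G} (hn : ‖A'‖ = ‖A‖) (ho : ⟪A, A'⟫ = 0) :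
    ⟪X, A⟫ ^ 2 + ⟪X, A'⟫ ^ 2 ≤ ‖X‖ ^ 2 * ‖A‖ ^ 2 := by
  set p := ⟪X, A⟫
  set q := ⟪X, A'⟫
  have h1 : ⟪X, p • A + q • A'⟫ = p ^ 2 + q ^ 2 := by
    rw [inner_add_right, inner_smul_right, inner_smul_right]; ring
  have h2 : ‖p • A + q • A'‖ ^ 2 = (p ^ 2 + q ^ 2) * ‖A‖ ^ 2 := by
    rw [norm_add_sq_real, inner_smul_left, inner_smul_right, ho, norm_smul, norm_smul, hn,
      mul_pow, mul_pow, Real.norm_eq_abs, Real.norm_eq_abs, sq_abs, sq_abs]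
    simp; ring
  have h3 : p ^ 2 + q ^ 2 ≤ ‖X‖ * ‖p • A + q • A'‖ := h1 ▸ real_inner_le_norm _ _
  have h4 : (p ^ 2 + q ^ 2) ^ 2 ≤ ‖X‖ ^ 2 * ((p ^ 2 + q ^ 2) * ‖A‖ ^ 2) := by
    rw [← h2, ← mul_pow]; gcongr
  rcases (by positivity : 0 ≤ p ^ 2 + q ^ 2).eq_or_lt with h | h
  · rw [← h]; positivity
  · refine le_of_mul_le_mul_left ?_ h
    nlinarith

/-- The two differential inequalities satisfied by the squared distance along an almost holomorphic
map: `A` and `B` stand for the partial derivatives, `A'` for the rotated vector `J A`, `D` for the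
Laplacian of the map. -/
theorem almost_holomorphic_inequalities {X A A' B D : G} {C : ℝ} (hn : ‖A'‖ = ‖A‖)
    (ho : ⟪A, A'⟫ = 0) (hB : ‖B - A'‖ ≤ C * ‖X‖ * ‖A‖) (hD : ‖D‖ ≤ C * ‖A‖ ^ 2) (hC : 0 ≤ C)
    (hX : C * ‖X‖ ≤ 1) :
    (4 - 12 * C * ‖X‖) * ‖A‖ ^ 2 ≤ 2 * ‖A‖ ^ 2 + 2 * ‖B‖ ^ 2 + 2 * ⟪X, D⟫ ∧
      (2 * ⟪X, A⟫) ^ 2 + (2 * ⟪X, B⟫) ^ 2 ≤ (4 + 12 * C * ‖X‖) * (‖X‖ ^ 2 * ‖A‖ ^ 2) := by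
  have hX0 := norm_nonneg X
  have hA0 := norm_nonneg A
  constructor
  · have h1 : ‖A‖ - ‖B - A'‖ ≤ ‖B‖ := by
      have := norm_sub_norm_le A' (A' - B)
      rw [sub_sub_cancel, norm_sub_rev A' B, hn] at this
      exact this
    have h2 : ‖A‖ * (1 - C * ‖X‖) ≤ ‖B‖ := by nlinarith
    have h3 : (‖A‖ * (1 - C * ‖X‖)) ^ 2 ≤ ‖B‖ ^ 2 := by
      have : 0 ≤ 1 - C * ‖X‖ := by linarith
      gcongr
    have h4 : -(‖X‖ * (C * ‖A‖ ^ 2)) ≤ ⟪X, D⟫ := by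
      have := neg_abs_le ⟪X, D⟫
      have h5 := abs_real_inner_le_norm X D
      have h6 : ‖X‖ * ‖D‖ ≤ ‖X‖ * (C * ‖A‖ ^ 2) := by gcongr
      linarith
    have h7 : 0 ≤ (C * ‖X‖) ^ 2 * ‖A‖ ^ 2 := by positivity
    have h8 : 0 ≤ C * ‖X‖ * ‖A‖ ^ 2 := by positivity
    nlinarith
  · set d := ⟪X, B - A'⟫ with hd
    have h1 : ⟪X, B⟫ = ⟪X, A'⟫ + d := by rw [hd, inner_sub_right]; ring
    have h2 : |d| ≤ C * ‖X‖ ^ 2 * ‖A‖ := by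
      refine (abs_real_inner_le_norm _ _).trans ?_
      calc ‖X‖ * ‖B - A'‖ ≤ ‖X‖ * (C * ‖X‖ * ‖A‖) := by gcongr
        _ = _ := by ring
    have h3 : |⟪X, A'⟫| ≤ ‖X‖ * ‖A‖ := hn ▸ abs_real_inner_le_norm X A'
    have h4 := inner_sq_add_inner_sq_le (X := X) hn ho
    have h5 : ⟪X, A'⟫ * d ≤ (‖X‖ * ‖A‖) * (C * ‖X‖ ^ 2 * ‖A‖) := by
      refine (le_abs_self _).trans ?_
      rw [abs_mul]; gcongr
    have h6 : d ^ 2 ≤ (C * ‖X‖ ^ 2 * ‖A‖) ^ 2 := by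
      rw [← sq_abs]; gcongr
    have h7 : (C * ‖X‖ ^ 2 * ‖A‖) ^ 2 ≤ C * ‖X‖ * (‖X‖ ^ 2 * ‖A‖ ^ 2) := by
      have h8 : 0 ≤ C * ‖X‖ * (‖X‖ ^ 2 * ‖A‖ ^ 2) := by positivity
      nlinarith
    rw [h1]
    nlinarith

end Abstract

section Coordinates

variable {E : Type*} [NormedAddCommGroup E] [NormedSpace ℝ E]

/-- The Laplacian of a solution of the Cauchy-Riemann equation is quadratic in its derivative. -/
theorem lap_of_cauchyRiemann {J : E → E →L[ℝ] E} {v : ℝ × ℝ → E} {z : ℝ × ℝ}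
    (hv : ContDiffAt ℝ 2 v z) (hJ : DifferentiableAt ℝ J (v z))
    (h1 : ∀ᶠ w in 𝓝 z, fderiv ℝ v w (1, 0) = -J (v w) (fderiv ℝ v w (0, 1)))
    (h2 : ∀ᶠ w in 𝓝 z, fderiv ℝ v w (0, 1) = J (v w) (fderiv ℝ v w (1, 0))) :
    lap v z = fderiv ℝ J (v z) (fderiv ℝ v z (0, 1)) (fderiv ℝ v z (1, 0)) -
      fderiv ℝ J (v z) (fderiv ℝ v z (1, 0)) (fderiv ℝ v z (0, 1)) := by
  have hvd := hv.differentiableAt two_ne_zero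
  have hJv : HasFDerivAt (fun w => J (v w)) ((fderiv ℝ J (v z)).comp (fderiv ℝ v z)) z :=
    hJ.hasFDerivAt.comp z hvd.hasFDerivAt
  have hmul : ∀ e a : ℝ × ℝ, fderiv ℝ (fun w => J (v w) (fderiv ℝ v w e)) z a =
      J (v z) (fderiv ℝ (fun w => fderiv ℝ v w e) z a) +
        fderiv ℝ J (v z) (fderiv ℝ v z a) (fderiv ℝ v z e) := fun e a => by
    rw [(hJv.clm_apply (differentiableAt_fderiv_apply hv e).hasFDerivAt).fderiv]
    simp
  have hsymm : fderiv ℝ (fun w => fderiv ℝ v w (0, 1)) z (1, 0) =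
      fderiv ℝ (fun w => fderiv ℝ v w (1, 0)) z (0, 1) := by
    have hs : IsSymmSndFDerivAt ℝ v z := hv.isSymmSndFDerivAt (by simp)
    have hd : DifferentiableAt ℝ (fderiv ℝ v) z :=
      (hv.fderiv_right (m := 1) (by norm_num)).differentiableAt one_ne_zero
    rw [fderiv_clm_apply hd (differentiableAt_const _), fderiv_clm_apply hd
      (differentiableAt_const _)]
    simpa using hs (1, 0) (0, 1)
  unfold lap
  rw [Filter.EventuallyEq.fderiv_eq h1, Filter.EventuallyEq.fderiv_eq h2, hmul]
  have : fderiv ℝ (fun w => -J (v w) (fderiv ℝ v w (0, 1))) z (1, 0) =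
      -fderiv ℝ (fun w => J (v w) (fderiv ℝ v w (0, 1))) z (1, 0) := by
    rw [fderiv_fun_neg]; simp
  rw [this, hmul, hsymm]
  abel

/-- First and second derivatives of the squared norm of a linear image of `v - x`. -/
theorem normSq_derivatives {G : Type*} [NormedAddCommGroup G] [InnerProductSpace ℝ G]
    (S : E →L[ℝ] G) (x : E) {v : ℝ × ℝ → E} {z : ℝ × ℝ} (hv : ContDiffAt ℝ 2 v z) :
    ContDiffAt ℝ 2 (fun w => ‖S (v w - x)‖ ^ 2) z ∧
    (∀ e, fderiv ℝ (fun w => ‖S (v w - x)‖ ^ 2) z e =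
      2 * ⟪S (v z - x), S (fderiv ℝ v z e)⟫) ∧
    lap (fun w => ‖S (v w - x)‖ ^ 2) z = 2 * ‖S (fderiv ℝ v z (1, 0))‖ ^ 2 +
      2 * ‖S (fderiv ℝ v z (0, 1))‖ ^ 2 + 2 * ⟪S (v z - x), S (lap v z)⟫ := by
  have hX : ∀ w, DifferentiableAt ℝ v w →
      HasFDerivAt (fun w => S (v w - x)) (S.comp (fderiv ℝ v w)) w := fun w hw =>
    S.hasFDerivAt.comp w (hw.hasFDerivAt.sub_const x)
  have h1 : ∀ w, DifferentiableAt ℝ v w → ∀ e, fderiv ℝ (fun w => ‖S (v w - x)‖ ^ 2) w e =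
      2 * ⟪S (v w - x), S (fderiv ℝ v w e)⟫ := fun w hw e => by
    rw [(hX w hw).norm_sq.fderiv]
    simp [inner_sub_left]
  have hd : ∀ e a, fderiv ℝ (fun w => 2 * ⟪S (v w - x), S (fderiv ℝ v w e)⟫) z a =
      2 * (⟪S (v z - x), S (fderiv ℝ (fun w => fderiv ℝ v w e) z a)⟫ +
        ⟪S (fderiv ℝ v z a), S (fderiv ℝ v z e)⟫) := fun e a => by
    have hXz := hX z (hv.differentiableAt two_ne_zero)
    have hY : HasFDerivAt (fun w => S (fderiv ℝ v w e))
        (S.comp (fderiv ℝ (fun w => fderiv ℝ v w e) z)) z :=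
      S.hasFDerivAt.comp z (differentiableAt_fderiv_apply hv e).hasFDerivAt
    rw [((hXz.inner ℝ hY).const_mul 2).fderiv]
    simp
  have hE : ∀ e, (fun w => fderiv ℝ (fun w => ‖S (v w - x)‖ ^ 2) w e) =ᶠ[𝓝 z]
      fun w => 2 * ⟪S (v w - x), S (fderiv ℝ v w e)⟫ := fun e => by
    filter_upwards [eventually_differentiableAt hv] with w hw using h1 w hw e
  refine ⟨?_, fun e => h1 z (hv.differentiableAt two_ne_zero) e, ?_⟩
  · exact (S.contDiff.contDiffAt.comp z (hv.sub contDiffAt_const)).norm_sq ℝ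
  · unfold lap
    rw [(hE _).fderiv_eq, (hE _).fderiv_eq, hd, hd, map_add, inner_add_right,
      real_inner_self_eq_norm_sq, real_inner_self_eq_norm_sq]
    ring

/-- Near a point where the two partial derivatives of `S ∘ v` have the same nonzero length, the
squared distance from the image of this point grows at most quadratically. -/
theorem eventually_normSq_le {G : Type*} [NormedAddCommGroup G] [InnerProductSpace ℝ G]
    (S : E →L[ℝ] G) {v : ℝ × ℝ → E} {z₀ : ℝ × ℝ} (hv : ContDiffAt ℝ 2 v z₀)
    (hB : ‖S (fderiv ℝ v z₀ (0, 1))‖ = ‖S (fderiv ℝ v z₀ (1, 0))‖)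
    (hSne : 0 < ‖S (fderiv ℝ v z₀ (1, 0))‖) :
    ∀ᶠ z in 𝓝 z₀, ‖S (fderiv ℝ v z₀ (1, 0))‖ ^ 2 / 2 ≤ ‖S (fderiv ℝ v z (1, 0))‖ ^ 2 ∧
      ‖S (v z - v z₀)‖ ^ 2 ≤ 9 * ‖S (fderiv ℝ v z₀ (1, 0))‖ ^ 2 * ‖z - z₀‖ ^ 2 := by
  have hcont : ContinuousAt (fun z => ‖S (fderiv ℝ v z (1, 0))‖ ^ 2) z₀ := by
    have := (differentiableAt_fderiv_apply hv (1, 0)).continuousAt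
    fun_prop
  have h1 : ∀ᶠ z in 𝓝 z₀, ‖S (fderiv ℝ v z₀ (1, 0))‖ ^ 2 / 2 <
      ‖S (fderiv ℝ v z (1, 0))‖ ^ 2 := hcont.eventually (lt_mem_nhds (by
        have : 0 < ‖S (fderiv ℝ v z₀ (1, 0))‖ ^ 2 := by positivity
        linarith))
  have hder : HasFDerivAt (fun z => S (v z)) (S.comp (fderiv ℝ v z₀)) z₀ :=
    S.hasFDerivAt.comp z₀ (hv.differentiableAt two_ne_zero).hasFDerivAt
  have h2 := (Asymptotics.isLittleO_iff.1 hder.isLittleO) hSne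
  filter_upwards [h1, h2] with z hz1 hz2
  refine ⟨hz1.le, ?_⟩
  set m := ‖S (fderiv ℝ v z₀ (1, 0))‖ with hm
  have hL : ‖S (fderiv ℝ v z₀ (z - z₀))‖ ≤ 2 * m * ‖z - z₀‖ := by
    have hdec : z - z₀ = (z - z₀).1 • ((1 : ℝ), (0 : ℝ)) + (z - z₀).2 • ((0 : ℝ), (1 : ℝ)) := by
      ext <;> simp
    rw [hdec, map_add, map_add, map_smul, map_smul, map_smul, map_smul, ← hdec]
    refine (norm_add_le _ _).trans ?_
    rw [norm_smul, norm_smul, hB, ← hm]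
    have i1 := norm_fst_le (z - z₀)
    have i2 := norm_snd_le (z - z₀)
    nlinarith
  have hfin : ‖S (v z - v z₀)‖ ≤ 3 * m * ‖z - z₀‖ := by
    have : S (v z - v z₀) = (S (v z) - S (v z₀) - (S.comp (fderiv ℝ v z₀)) (z - z₀)) +
        S (fderiv ℝ v z₀ (z - z₀)) := by
      rw [map_sub]; simp
    rw [this]
    refine (norm_add_le _ _).trans ?_
    linarith
  calc ‖S (v z - v z₀)‖ ^ 2 ≤ (3 * m * ‖z - z₀‖) ^ 2 := by gcongr
    _ = _ := by ring

variable [FiniteDimensional ℝ E]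

/-- The graph map `u ↦ (u, J u)` into a Euclidean space: the pullback of the inner product is an
inner product for which `J` is orthogonal if `J² = -1`. -/
def graphMap (J : E →L[ℝ] E) : E →L[ℝ]
    WithLp 2 (EuclideanSpace ℝ (Fin (Module.finrank ℝ E)) ×
      EuclideanSpace ℝ (Fin (Module.finrank ℝ E))) :=
  (WithLp.prodContinuousLinearEquiv 2 ℝ _ _).symm.toContinuousLinearMap.comp
    (toEuclidean.toContinuousLinearMap.prod (toEuclidean.toContinuousLinearMap.comp J))

theorem inner_graphMap (J : E →L[ℝ] E) (u w : E) :
    ⟪graphMap J u, graphMap J w⟫ = ⟪toEuclidean u, toEuclidean w⟫ +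
      ⟪toEuclidean (J u), toEuclidean (J w)⟫ := by
  simp [graphMap, WithLp.prod_inner_apply]

theorem norm_graphMap_sq (J : E →L[ℝ] E) (u : E) :
    ‖graphMap J u‖ ^ 2 = ‖toEuclidean u‖ ^ 2 + ‖toEuclidean (J u)‖ ^ 2 := by
  rw [← real_inner_self_eq_norm_sq, inner_graphMap, real_inner_self_eq_norm_sq,
    real_inner_self_eq_norm_sq]

theorem norm_graphMap_rotate {J : E →L[ℝ] E} (hJ : ∀ u, J (J u) = -u) (u : E) :
    ‖graphMap J (J u)‖ = ‖graphMap J u‖ := by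
  rw [← sq_eq_sq₀ (norm_nonneg _) (norm_nonneg _), norm_graphMap_sq, norm_graphMap_sq, hJ, map_neg,
    norm_neg]
  ring

theorem inner_graphMap_rotate {J : E →L[ℝ] E} (hJ : ∀ u, J (J u) = -u) (u : E) :
    ⟪graphMap J u, graphMap J (J u)⟫ = 0 := by
  rw [inner_graphMap, hJ, map_neg, inner_neg_right, real_inner_comm]
  ring

attribute [local irreducible] graphMap

set_option maxHeartbeats 1000000 in
/-- Monotonicity: a holomorphic curve that is proper over the neighbourhood `W` of `y₀`, and passes
through a point near `y₀` with non-zero derivative, has a definite amount of energy. Distances from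
the image `x` of that point are measured in the inner product pulled back by `graphMap (J x)`, so
that the equation is an orthogonal Cauchy-Riemann equation up to an error proportional to the
distance. -/
theorem exists_energy_lower_bound_of_cauchyRiemann {W : Set E} (hW : IsOpen W)
    {J : E → E →L[ℝ] E} (hJ : ContDiffOn ℝ 1 J W) (hJJ : ∀ x ∈ W, ∀ u, J x (J x u) = -u)
    {y₀ : E} (hy₀ : y₀ ∈ W) :
    ∃ R : ℝ, 0 < R ∧ ∃ c : ℝ, 0 < c ∧ ∀ (O : Set (ℝ × ℝ)) (v : ℝ × ℝ → E) (z₀ : ℝ × ℝ),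
      IsOpen O → O ⊆ strip → (∀ z ∈ O, ContDiffAt ℝ 2 v z) → (∀ z ∈ O, v z ∈ W) →
      (∀ z ∈ O, fderiv ℝ v z (1, 0) + J (v z) (fderiv ℝ v z (0, 1)) = 0) →
      (∀ K ⊆ W, IsCompact K → IsClosed {z | z ∈ O ∧ v z ∈ K}) →
      z₀ ∈ O → v z₀ ∈ Metric.ball y₀ R → fderiv ℝ v z₀ (0, 1) ≠ 0 →
      ENNReal.ofReal c ≤ ∫⁻ z in O, ENNReal.ofReal (‖fderiv ℝ v z (1, 0)‖ ^ 2) := by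
  obtain ⟨c, hc, hmain⟩ := exists_energy_lower_bound
  obtain ⟨R₀, hR₀, hball⟩ := Metric.isOpen_iff.1 hW y₀ hy₀
  set R : ℝ := R₀ / 4 with hR
  have hRpos : 0 < R := by positivity
  have hcb : Metric.closedBall y₀ (2 * R) ⊆ W :=
    (Metric.closedBall_subset_ball (by linarith)).trans hball
  have hcomp : IsCompact (Metric.closedBall y₀ (2 * R)) := isCompact_closedBall _ _
  have hJd : ∀ x ∈ W, DifferentiableAt ℝ J x := fun x hx =>
    (hJ.contDiffAt (hW.mem_nhds hx)).differentiableAt one_ne_zero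
  obtain ⟨Λ₁, hΛ₁⟩ := hcomp.exists_bound_of_continuousOn (hJ.continuousOn.mono hcb)
  obtain ⟨Λ₂, hΛ₂⟩ := hcomp.exists_bound_of_continuousOn
    ((hJ.continuousOn_fderiv_of_isOpen hW le_rfl).mono hcb)
  set Λ : ℝ := max (max Λ₁ Λ₂) 1 with hΛ
  have hΛ0 : 0 < Λ := by positivity
  have hJb : ∀ x ∈ Metric.closedBall y₀ (2 * R), ‖J x‖ ≤ Λ := fun x hx =>
    (hΛ₁ x hx).trans ((le_max_left _ _).trans (le_max_left _ _))
  have hDJb : ∀ x ∈ Metric.closedBall y₀ (2 * R), ‖fderiv ℝ J x‖ ≤ Λ := fun x hx =>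
    (hΛ₂ x hx).trans ((le_max_right _ _).trans (le_max_left _ _))
  set κ : E ≃L[ℝ] EuclideanSpace ℝ (Fin (Module.finrank ℝ E)) := toEuclidean
  set k₁ : ℝ := ‖κ.symm.toContinuousLinearMap‖ + 1 with hk₁
  have hk₁pos : 0 < k₁ := by positivity
  set k₂ : ℝ := (‖κ.toContinuousLinearMap‖ + 1) * (1 + Λ) with hk₂
  have hk₂pos : 0 < k₂ := by positivity
  have hlow : ∀ (A : E →L[ℝ] E) (u : E), ‖u‖ ≤ k₁ * ‖graphMap A u‖ := fun A u => by
    have h1 : ‖u‖ ≤ ‖κ.symm.toContinuousLinearMap‖ * ‖κ u‖ := by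
      simpa using κ.symm.toContinuousLinearMap.le_opNorm (κ u)
    have h2 : ‖κ u‖ ≤ ‖graphMap A u‖ := by
      refine (sq_le_sq₀ (norm_nonneg _) (norm_nonneg _)).1 ?_
      rw [norm_graphMap_sq]
      exact le_add_of_nonneg_right (by positivity)
    calc ‖u‖ ≤ ‖κ.symm.toContinuousLinearMap‖ * ‖κ u‖ := h1
      _ ≤ k₁ * ‖graphMap A u‖ := by gcongr; linarith
  have hup : ∀ (A : E →L[ℝ] E) (u : E), ‖A‖ ≤ Λ → ‖graphMap A u‖ ≤ k₂ * ‖u‖ := fun A u hA => by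
    have h0 : ∀ w, ‖κ w‖ ≤ (‖κ.toContinuousLinearMap‖ + 1) * ‖w‖ := fun w =>
      (κ.toContinuousLinearMap.le_opNorm w).trans (by gcongr; linarith)
    have h1 : ‖A u‖ ≤ Λ * ‖u‖ := (A.le_opNorm u).trans (by gcongr)
    have h2 : ‖κ (A u)‖ ≤ (‖κ.toContinuousLinearMap‖ + 1) * (Λ * ‖u‖) := (h0 _).trans (by gcongr)
    refine (sq_le_sq₀ (norm_nonneg _) (by positivity)).1 ?_
    rw [norm_graphMap_sq]
    have h3 : ‖κ u‖ ^ 2 ≤ ((‖κ.toContinuousLinearMap‖ + 1) * ‖u‖) ^ 2 := by gcongr; exact h0 u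
    have h4 : ‖κ (A u)‖ ^ 2 ≤ ((‖κ.toContinuousLinearMap‖ + 1) * (Λ * ‖u‖)) ^ 2 := by gcongr
    have h5 : 0 ≤ ((‖κ.toContinuousLinearMap‖ + 1) * ‖u‖) ^ 2 * (2 * Λ) := by positivity
    rw [hk₂]
    nlinarith
  -- `C₀` bounds both the variation of `J` and the second-order term of the equation
  set C₀ : ℝ := k₂ * (2 * Λ * Λ) * k₁ ^ 2 + k₂ * Λ * k₁ ^ 2 with hC₀
  have hC₀pos : 0 < C₀ := by positivity
  set r : ℝ := min (R / k₁) (1 / (36 * C₀)) with hr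
  have hrpos : 0 < r := by positivity
  have hr1 : k₁ * r ≤ R := by
    have : r ≤ R / k₁ := min_le_left _ _
    rw [le_div_iff₀ hk₁pos] at this
    linarith
  have hr2 : 36 * C₀ * r ≤ 1 := by
    have : r ≤ 1 / (36 * C₀) := min_le_right _ _
    rw [le_div_iff₀ (by positivity)] at this
    linarith
  refine ⟨R, hRpos, c * r ^ 2 / k₂ ^ 2, by positivity, ?_⟩
  intro O v z₀ hO hOs hv hvW hCR hprop hz₀ hvz₀ hne
  set x := v z₀ with hx
  have hxcb : x ∈ Metric.closedBall y₀ (2 * R) :=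
    Metric.ball_subset_closedBall (Metric.ball_subset_ball (by linarith) hvz₀)
  set S := graphMap (J x) with hS
  have hJx : ∀ u, J x (J x u) = -u := hJJ x (hcb hxcb)
  have hCR1 : ∀ z ∈ O, fderiv ℝ v z (1, 0) = -J (v z) (fderiv ℝ v z (0, 1)) := fun z hz =>
    eq_neg_of_add_eq_zero_left (hCR z hz)
  have hCR2 : ∀ z ∈ O, fderiv ℝ v z (0, 1) = J (v z) (fderiv ℝ v z (1, 0)) := fun z hz => by
    rw [hCR1 z hz, map_neg, hJJ _ (hvW z hz), neg_neg]
  have hnear : ∀ y, ‖S (y - x)‖ ^ 2 ≤ r ^ 2 → ‖y - x‖ ≤ k₁ * ‖S (y - x)‖ ∧ ‖S (y - x)‖ ≤ r ∧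
      y ∈ Metric.closedBall y₀ (2 * R) := fun y hy => by
    have h1 : ‖S (y - x)‖ ≤ r := (sq_le_sq₀ (norm_nonneg _) hrpos.le).1 hy
    have h2 := hlow (J x) (y - x)
    refine ⟨h2, h1, ?_⟩
    have h3 : ‖y - x‖ ≤ R := h2.trans ((by gcongr : k₁ * ‖S (y - x)‖ ≤ k₁ * r).trans hr1)
    rw [Metric.mem_closedBall]
    have h4 : Dist.dist x y₀ < R := hvz₀
    have := dist_triangle y x y₀
    rw [dist_eq_norm y x] at this
    linarith
  have hineq : ∀ z ∈ O, ‖S (v z - x)‖ ^ 2 ≤ r ^ 2 →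
      (4 - 12 * C₀ * ‖S (v z - x)‖) * ‖S (fderiv ℝ v z (1, 0))‖ ^ 2 ≤
        2 * ‖S (fderiv ℝ v z (1, 0))‖ ^ 2 + 2 * ‖S (fderiv ℝ v z (0, 1))‖ ^ 2 +
          2 * ⟪S (v z - x), S (lap v z)⟫ ∧
      (2 * ⟪S (v z - x), S (fderiv ℝ v z (1, 0))⟫) ^ 2 +
        (2 * ⟪S (v z - x), S (fderiv ℝ v z (0, 1))⟫) ^ 2 ≤
        (4 + 12 * C₀ * ‖S (v z - x)‖) *
          (‖S (v z - x)‖ ^ 2 * ‖S (fderiv ℝ v z (1, 0))‖ ^ 2) := by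
    intro z hz hzr
    obtain ⟨h1, h2, h3⟩ := hnear (v z) hzr
    set a := fderiv ℝ v z (1, 0) with ha
    set b := fderiv ℝ v z (0, 1) with hb
    have hab : b = J (v z) a := hCR2 z hz
    have hbn : ‖b‖ ≤ Λ * ‖a‖ := by
      rw [hab]; exact ((J (v z)).le_opNorm a).trans (by gcongr; exact hJb _ h3)
    have han := hlow (J x) a
    have hlap := lap_of_cauchyRiemann (hv z hz) (hJd _ (hvW z hz))
      (by filter_upwards [hO.mem_nhds hz] with w hw using hCR1 w hw)
      (by filter_upwards [hO.mem_nhds hz] with w hw using hCR2 w hw)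
    refine almost_holomorphic_inequalities (A' := S (J x a)) (norm_graphMap_rotate hJx a)
      (inner_graphMap_rotate hJx a) ?_ ?_ hC₀pos.le ?_
    · have hLip : ‖J (v z) - J x‖ ≤ Λ * ‖v z - x‖ :=
        (convex_closedBall y₀ (2 * R)).norm_image_sub_le_of_norm_fderiv_le
          (fun y hy => hJd y (hcb hy)) hDJb hxcb h3
      rw [hab, ← map_sub, ← sub_apply]
      calc ‖S ((J (v z) - J x) a)‖ ≤ k₂ * ‖(J (v z) - J x) a‖ := hup _ _ (hJb x hxcb)
        _ ≤ k₂ * (‖J (v z) - J x‖ * ‖a‖) := by gcongr; exact ContinuousLinearMap.le_opNorm _ _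
        _ ≤ k₂ * (Λ * (k₁ * ‖S (v z - x)‖) * (k₁ * ‖S a‖)) := by
            gcongr; exact hLip.trans (by gcongr)
        _ = (k₂ * Λ * k₁ ^ 2) * ‖S (v z - x)‖ * ‖S a‖ := by ring
        _ ≤ C₀ * ‖S (v z - x)‖ * ‖S a‖ := by
            gcongr; rw [hC₀]; exact le_add_of_nonneg_left (by positivity)
    · have hd : ∀ p q : E, ‖fderiv ℝ J (v z) p q‖ ≤ Λ * ‖p‖ * ‖q‖ := fun p q =>
        (((fderiv ℝ J (v z)) p).le_opNorm q).trans (by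
          gcongr; exact ((fderiv ℝ J (v z)).le_opNorm p).trans (by gcongr; exact hDJb _ h3))
      have hl : ‖lap v z‖ ≤ 2 * Λ * Λ * ‖a‖ ^ 2 := by
        rw [hlap]
        refine (norm_sub_le _ _).trans ?_
        calc _ ≤ Λ * ‖b‖ * ‖a‖ + Λ * ‖a‖ * ‖b‖ := add_le_add (hd _ _) (hd _ _)
          _ = 2 * Λ * ‖b‖ * ‖a‖ := by ring
          _ ≤ 2 * Λ * (Λ * ‖a‖) * ‖a‖ := by gcongr
          _ = _ := by ring
      calc ‖S (lap v z)‖ ≤ k₂ * ‖lap v z‖ := hup _ _ (hJb x hxcb)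
        _ ≤ k₂ * (2 * Λ * Λ * (k₁ * ‖S a‖) ^ 2) := by
            gcongr; exact hl.trans (by gcongr)
        _ = k₂ * (2 * Λ * Λ) * k₁ ^ 2 * ‖S a‖ ^ 2 := by ring
        _ ≤ C₀ * ‖S a‖ ^ 2 := by
            gcongr; rw [hC₀]; exact le_add_of_nonneg_right (by positivity)
    · nlinarith [norm_nonneg (S (v z - x))]
  have hsqrt : ∀ z, √(‖S (v z - x)‖ ^ 2) = ‖S (v z - x)‖ := fun z => Real.sqrt_sq (norm_nonneg _)
  have hne' : fderiv ℝ v z₀ (1, 0) ≠ 0 := fun h => hne (by rw [hCR2 z₀ hz₀, h, map_zero])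
  have hSne : 0 < ‖S (fderiv ℝ v z₀ (1, 0))‖ := by
    have h1 := hlow (J x) (fderiv ℝ v z₀ (1, 0))
    have h2 := norm_pos_iff.2 hne'
    by_contra! h
    nlinarith
  have hres := hmain (12 * C₀) r O (fun z => ‖S (v z - x)‖ ^ 2)
    (fun z => ‖S (fderiv ℝ v z (1, 0))‖ ^ 2) z₀ (‖S (fderiv ℝ v z₀ (1, 0))‖ ^ 2)
    (by positivity) hrpos (by linarith) hO hOs (fun z hz => (normSq_derivatives S x (hv z hz)).1)
    (fun z _ => by positivity) (fun z _ => by positivity)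
    (fun z hz hzr => by
      rw [(normSq_derivatives S x (hv z hz)).2.2, hsqrt]; exact (hineq z hz hzr).1)
    (fun z hz hzr => by
      rw [(normSq_derivatives S x (hv z hz)).2.1, (normSq_derivatives S x (hv z hz)).2.1, hsqrt]
      exact (hineq z hz hzr).2)
    (by
      have hsub : {y | ‖S (y - x)‖ ^ 2 ≤ r ^ 2} ⊆ Metric.closedBall y₀ (2 * R) :=
        fun y hy => (hnear y hy).2.2
      exact hprop _ (hsub.trans hcb)
        (hcomp.of_isClosed_subset (isClosed_le (by fun_prop) continuous_const) hsub))
    hz₀ (by positivity)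
    (eventually_normSq_le S (hv z₀ hz₀) (by
      rw [hCR2 z₀ hz₀]; exact norm_graphMap_rotate hJx _) hSne)
  have hle : ∫⁻ z in {z | z ∈ O ∧ ‖S (v z - x)‖ ^ 2 ≤ r ^ 2},
      ENNReal.ofReal (‖S (fderiv ℝ v z (1, 0))‖ ^ 2) ≤
      ENNReal.ofReal (k₂ ^ 2) * ∫⁻ z in O, ENNReal.ofReal (‖fderiv ℝ v z (1, 0)‖ ^ 2) := by
    rw [← lintegral_const_mul' _ _ ENNReal.ofReal_ne_top]
    refine (lintegral_mono_set fun z hz => hz.1).trans (lintegral_mono fun z => ?_)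
    rw [← ENNReal.ofReal_mul (by positivity), ← mul_pow]
    apply ENNReal.ofReal_le_ofReal
    gcongr
    exact hup _ _ (hJb x hxcb)
  have hfinal := hres.trans hle
  have h24 : ENNReal.ofReal (k₂ ^ 2) * ENNReal.ofReal (c * r ^ 2 / k₂ ^ 2) =
      ENNReal.ofReal (c * r ^ 2) := by
    rw [← ENNReal.ofReal_mul (by positivity)]
    congr 1; field_simp
  have hne : ENNReal.ofReal (k₂ ^ 2) ≠ 0 := by
    rw [Ne, ENNReal.ofReal_eq_zero, not_le]; positivity
  rw [← h24] at hfinal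
  exact (ENNReal.mul_le_mul_iff_right hne ENNReal.ofReal_ne_top).1 hfinal

end Coordinates

/-! ### The cotangent bundle in coordinates -/

section CotangentChart

variable {F : Type*} [NormedAddCommGroup F] [NormedSpace ℝ F]
  {L : Type*} [TopologicalSpace L] [ChartedSpace F L] [IsManifold 𝓘(ℝ, F) ∞ L]

/-- The derivative of the inverse of the preferred chart around `q`. -/
def chartFrame (q : L) (y : F) : F →L[ℝ] F :=
  mfderiv 𝓘(ℝ, F) 𝓘(ℝ, F) (extChartAt 𝓘(ℝ, F) q).symm y

theorem symmL_trivializationAt_eq_chartFrame {q x : L} (hx : x ∈ (chartAt F q).source) (u : F) :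
    (trivializationAt F (TangentSpace 𝓘(ℝ, F)) q).symmL ℝ x u =
      chartFrame q (extChartAt 𝓘(ℝ, F) q x) u := by
  have : IsManifold 𝓘(ℝ, F) 1 L := IsManifold.of_le (n := ∞) (by simp)
  rw [TangentBundle.symmL_trivializationAt hx]
  simp only [chartFrame, modelWithCornersSelf_coe, range_id, mfderivWithin_univ]
  rfl

/-- The covector of a point of `T*L`, as a functional on the model space. As for the other
definitions below whose names start with `model`, the tangent space is definitionally the model
space, and the definition fixes the type of the value. -/
def modelCovector (ξ : Cotangent F L) : F →L[ℝ] ℝ := covector ξ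

theorem extChartAt_cotangent (ξ₀ ξ : Cotangent F L) (h : ξ.proj ∈ (chartAt F ξ₀.proj).source) :
    extChartAt (cotangentModel F) ξ₀ ξ = (extChartAt 𝓘(ℝ, F) ξ₀.proj ξ.proj,
      (modelCovector ξ).comp
        (chartFrame ξ₀.proj (extChartAt 𝓘(ℝ, F) ξ₀.proj ξ.proj))) := by
  rw [FiberBundle.extChartAt]
  simp only [PartialEquiv.coe_trans, Function.comp, PartialEquiv.prod_coe, PartialEquiv.refl_coe, id]
  refine Prod.ext rfl ?_
  ext u
  change (ContinuousLinearMap.inCoordinates F (TangentSpace 𝓘(ℝ, F)) ℝ (Trivial L ℝ) ξ₀.proj ξ.proj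
    ξ₀.proj ξ.proj ξ.2) u = _
  rw [ContinuousLinearMap.inCoordinates]
  simp only [ContinuousLinearMap.comp_apply]
  rw [symmL_trivializationAt_eq_chartFrame h]
  simp
  rfl

theorem mem_extChartAt_cotangent_source {ξ₀ ξ : Cotangent F L} :
    ξ ∈ (extChartAt (cotangentModel F) ξ₀).source ↔ ξ.proj ∈ (chartAt F ξ₀.proj).source := by
  rw [FiberBundle.extChartAt]
  simp
  exact fun h => h

theorem extChartAt_cotangent_target (ξ₀ : Cotangent F L) :
    (extChartAt (cotangentModel F) ξ₀).target = (extChartAt 𝓘(ℝ, F) ξ₀.proj).target ×ˢ univ := by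
  rw [FiberBundle.extChartAt_target]
  congr 1
  refine inter_eq_left.2 fun y hy => ?_
  have := (extChartAt 𝓘(ℝ, F) ξ₀.proj).map_target hy
  rw [extChartAt_source] at this
  simpa using this

theorem exists_chartFrame_inverse {q x : L} (hx : x ∈ (chartAt F q).source) :
    ∃ B : F →L[ℝ] F, (∀ u, chartFrame q (extChartAt 𝓘(ℝ, F) q x) (B u) = u) ∧
      ∀ u, B (chartFrame q (extChartAt 𝓘(ℝ, F) q x) u) = u := by
  have : IsManifold 𝓘(ℝ, F) 1 L := IsManifold.of_le (n := ∞) (by simp)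
  have hb : x ∈ (trivializationAt F (TangentSpace 𝓘(ℝ, F)) q).baseSet := by simpa using hx
  refine ⟨(trivializationAt F (TangentSpace 𝓘(ℝ, F)) q).continuousLinearMapAt ℝ x, fun u => ?_,
    fun u => ?_⟩
  · exact (symmL_trivializationAt_eq_chartFrame hx _).symm.trans
      (Trivialization.symmL_continuousLinearMapAt _ hb u)
  · have := Trivialization.continuousLinearMapAt_symmL (R := ℝ)
      (trivializationAt F (TangentSpace 𝓘(ℝ, F)) q) hb u
    rwa [symmL_trivializationAt_eq_chartFrame hx] at this

theorem chartFrame_self (q : L) (u : F) : chartFrame q (extChartAt 𝓘(ℝ, F) q q) u = u := by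
  have : IsManifold 𝓘(ℝ, F) 1 L := IsManifold.of_le (n := ∞) (by simp)
  rw [← symmL_trivializationAt_eq_chartFrame (mem_chart_source F q),
    TangentBundle.symmL_trivializationAt_eq_core (mem_chart_source F q)]
  exact (tangentBundleCore 𝓘(ℝ, F) L).coordChange_self (achart F q) q (mem_chart_source F q) u

/-- The preferred chart of `T*L` around `ξ` maps `ξ` to its own covector. -/
theorem extChartAt_cotangent_self (ξ : Cotangent F L) :
    extChartAt (cotangentModel F) ξ ξ = (extChartAt 𝓘(ℝ, F) ξ.proj ξ.proj, modelCovector ξ) := by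
  rw [extChartAt_cotangent ξ ξ (mem_chart_source F ξ.proj)]
  refine Prod.ext rfl ?_
  ext u
  exact congrArg (covector ξ) (chartFrame_self ξ.proj u)

/-- The derivative of a map into `L`, computed in the preferred chart around `q`. -/
theorem mfderiv_eq_chartFrame {D : Type*} [NormedAddCommGroup D] [NormedSpace ℝ D] (q : L)
    {w : D → L} {z : D} (hw : MDifferentiableAt 𝓘(ℝ, D) 𝓘(ℝ, F) w z)
    (hz : w z ∈ (chartAt F q).source) (e : D) :
    mfderiv 𝓘(ℝ, D) 𝓘(ℝ, F) w z e = chartFrame q (extChartAt 𝓘(ℝ, F) q (w z))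
      (fderiv ℝ (fun x => extChartAt 𝓘(ℝ, F) q (w x)) z e) := by
  have : IsManifold 𝓘(ℝ, F) 1 L := IsManifold.of_le (n := ∞) (by simp)
  set y : D → F := fun x => extChartAt 𝓘(ℝ, F) q (w x) with hy
  have hyd : DifferentiableAt ℝ y z := by
    rw [← mdifferentiableAt_iff_differentiableAt]
    exact (mdifferentiableAt_extChartAt hz).comp z hw
  have hsymm : MDifferentiableAt 𝓘(ℝ, F) 𝓘(ℝ, F) (extChartAt 𝓘(ℝ, F) q).symm (y z) := by
    have h1 : y z ∈ (extChartAt 𝓘(ℝ, F) q).target :=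
      (extChartAt 𝓘(ℝ, F) q).map_source (by rwa [extChartAt_source])
    exact ((contMDiffOn_extChartAt_symm (n := 1) (I := 𝓘(ℝ, F)) q).contMDiffAt
      ((isOpen_extChartAt_target q).mem_nhds h1)).mdifferentiableAt one_ne_zero
  have hcomp : w =ᶠ[𝓝 z] (extChartAt 𝓘(ℝ, F) q).symm ∘ y := by
    filter_upwards [hw.continuousAt.eventually ((chartAt F q).open_source.mem_nhds hz)] with x hx
    exact ((extChartAt 𝓘(ℝ, F) q).left_inv (by rwa [extChartAt_source])).symm
  have h2 := hcomp.mfderiv_eq (I := 𝓘(ℝ, D)) (I' := 𝓘(ℝ, F))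
  have h3 := mfderiv_comp z hsymm hyd.mdifferentiableAt
  rw [mfderiv_eq_fderiv] at h3
  exact (DFunLike.congr_fun h2 e).trans (DFunLike.congr_fun h3 e)

/-- The Liouville form along a map into `T*L`, in coordinates: `Θ(dW) = P(dy)`. -/
theorem covector_mfderiv_proj {D : Type*} [NormedAddCommGroup D] [NormedSpace ℝ D]
    (ξ₀ : Cotangent F L) {W : D → Cotangent F L} {z : D}
    (hW : MDifferentiableAt 𝓘(ℝ, D) (cotangentModel F) W z)
    (hz : (W z).proj ∈ (chartAt F ξ₀.proj).source) (e : D) :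
    covector (W z) (mfderiv 𝓘(ℝ, D) 𝓘(ℝ, F) (fun w => (W w).proj) z e) =
      (extChartAt (cotangentModel F) ξ₀ (W z)).2
        (fderiv ℝ (fun w => (extChartAt (cotangentModel F) ξ₀ (W w)).1) z e) := by
  have : IsManifold 𝓘(ℝ, F) 1 L := IsManifold.of_le (n := ∞) (by simp)
  have hproj : MDifferentiableAt 𝓘(ℝ, D) 𝓘(ℝ, F) (fun w => (W w).proj) z :=
    ((contMDiff_proj (n := 1) (IB := 𝓘(ℝ, F))
      (fun q : L => TangentSpace 𝓘(ℝ, F) q →L[ℝ] Trivial L ℝ q)).mdifferentiable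
      one_ne_zero (W z)).comp z hW
  have hev : ∀ᶠ w in 𝓝 z, (W w).proj ∈ (chartAt F ξ₀.proj).source :=
    hproj.continuousAt.eventually ((chartAt F ξ₀.proj).open_source.mem_nhds hz)
  set y : D → F := fun w => extChartAt 𝓘(ℝ, F) ξ₀.proj (W w).proj with hy
  have h4 : (fun w => (extChartAt (cotangentModel F) ξ₀ (W w)).1) =ᶠ[𝓝 z] y := by
    filter_upwards [hev] with w hw
    rw [extChartAt_cotangent ξ₀ _ hw]
  rw [h4.fderiv_eq, extChartAt_cotangent ξ₀ _ hz]
  exact congrArg (covector (W z)) (mfderiv_eq_chartFrame ξ₀.proj hproj hz e)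

/-- The exterior derivative of the Liouville form, in the coordinates of the preferred chart:
`dΘ = dp ∧ dq`. -/
theorem extDeriv_liouville (ξ : Cotangent F L) (η ζ : F × (F →L[ℝ] ℝ)) :
    DiffForm.extDeriv (cotangentModel F) (liouville F L) ξ ![η, ζ] = η.2 ζ.1 - ζ.2 η.1 := by
  set e := extChartAt (cotangentModel F) ξ with he
  have hc : e ξ ∈ e.target := mem_extChartAt_target ξ
  have htop : IsOpen e.target := isOpen_extChartAt_target ξ
  -- in the chart, `Θ` is the form `(y, p) ↦ p dy`, which is linear in `(y, p)`
  let Λ : F × (F →L[ℝ] ℝ) →L[ℝ] (F × (F →L[ℝ] ℝ)) [⋀^Fin 1]→L[ℝ] ℝ :=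
    (ContinuousAlternatingMap.ofSubsingletonLIE (𝕜 := ℝ) (E := F × (F →L[ℝ] ℝ)) (F := ℝ) (0 : Fin 1) :
      _ →L[ℝ] _).comp
      (((ContinuousLinearMap.compL ℝ (F × (F →L[ℝ] ℝ)) F ℝ).flip
        (ContinuousLinearMap.fst ℝ F (F →L[ℝ] ℝ))).comp (ContinuousLinearMap.snd ℝ F (F →L[ℝ] ℝ)))
  have hΛ : ∀ y u, Λ y u = y.2 (u 0).1 := fun y u => by simp [Λ]
  have hchart : (liouville F L).inChart (cotangentModel F) ξ =ᶠ[𝓝 (e ξ)] Λ := by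
    filter_upwards [htop.mem_nhds hc] with y hy
    ext u
    have hs : MDifferentiableAt 𝓘(ℝ, F × (F →L[ℝ] ℝ)) (cotangentModel F) e.symm y :=
      ((contMDiffOn_extChartAt_symm (n := 1) (I := cotangentModel F) ξ).contMDiffAt
        (htop.mem_nhds hy)).mdifferentiableAt one_ne_zero
    have hsrc : (e.symm y).proj ∈ (chartAt F ξ.proj).source :=
      mem_extChartAt_cotangent_source.1 (e.map_target hy)
    have h1 := covector_mfderiv_proj ξ hs hsrc (u 0)
    have h2 : mfderiv 𝓘(ℝ, F × (F →L[ℝ] ℝ)) 𝓘(ℝ, F) (fun w => (e.symm w).proj) y (u 0) =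
        mfderiv (cotangentModel F) 𝓘(ℝ, F) (fun ζ : Cotangent F L => ζ.proj) (e.symm y)
          (mfderiv 𝓘(ℝ, F × (F →L[ℝ] ℝ)) (cotangentModel F) e.symm y (u 0)) :=
      DFunLike.congr_fun (mfderiv_comp y
        ((contMDiff_proj (n := 1) (IB := 𝓘(ℝ, F))
          (fun q : L => TangentSpace 𝓘(ℝ, F) q →L[ℝ] Trivial L ℝ q)).mdifferentiable
          one_ne_zero (e.symm y)) hs) (u 0)
    have h3 : (fun w => (extChartAt (cotangentModel F) ξ (e.symm w)).1) =ᶠ[𝓝 y] Prod.fst := by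
      filter_upwards [htop.mem_nhds hy] with w hw
      rw [← he, e.right_inv hw]
    rw [h3.fderiv_eq, fderiv_fst, ← he, e.right_inv hy, h2] at h1
    rw [hΛ]
    exact h1
  have h4 : DiffForm.extDeriv (cotangentModel F) (liouville F L) ξ ![η, ζ] =
      _root_.extDeriv (⇑Λ) (e ξ) ![η, ζ] := by
    rw [← hchart.extDeriv_eq]
    rfl
  rw [h4, extDeriv_apply Λ.differentiableAt, Fin.sum_univ_two]
  have h5 : ∀ (u : Fin 1 → F × (F →L[ℝ] ℝ)) (w : F × (F →L[ℝ] ℝ)),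
      fderiv ℝ (fun y => Λ y u) (e ξ) w = w.2 (u 0).1 := fun u w => by
    rw [fderiv_continuousAlternatingMap_apply_const_apply Λ.differentiableAt]
    have h6 : fderiv ℝ Λ (e ξ) = Λ := ContinuousLinearMap.fderiv (𝕜 := ℝ)
      (E := F × (F →L[ℝ] ℝ)) (F := (F × (F →L[ℝ] ℝ)) [⋀^Fin 1]→L[ℝ] ℝ) Λ
    exact (DFunLike.congr_fun (DFunLike.congr_fun h6 w) u).trans (hΛ w u)
  rw [h5, h5]
  simp [Fin.removeNth, sub_eq_add_neg]

end CotangentChart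

/-! ### The Sasaki metric and the function `|p|²` -/

section Sasaki

variable {F : Type*} [NormedAddCommGroup F] [NormedSpace ℝ F]
  {L : Type*} [TopologicalSpace L] [ChartedSpace F L] [IsManifold 𝓘(ℝ, F) ∞ L]
  (g : Metric F L)

/-- The metric at `q`, as a bilinear form on the model space. -/
def modelInner (q : L) : F →L[ℝ] F →L[ℝ] ℝ := g.inner q

theorem modelInner_symm (q : L) (u w : F) : modelInner g q u w = modelInner g q w u :=
  g.symm q u w

theorem modelInner_self_nonneg (q : L) (u : F) : 0 ≤ modelInner g q u u := by
  by_cases h : u = 0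
  · simp [h]
  · exact (g.pos q u h).le

theorem metricInChart_apply (q : L) (y u w : F) : metricInChart g q y u w =
    modelInner g ((extChartAt 𝓘(ℝ, F) q).symm y) (chartFrame q y u) (chartFrame q y w) := rfl

theorem metricInChart_symm (q : L) (y u w : F) :
    metricInChart g q y u w = metricInChart g q y w u := by
  exact g.symm _ _ _

theorem metricInChart_self (q : L) (u w : F) :
    metricInChart g q (extChartAt 𝓘(ℝ, F) q q) u w = modelInner g q u w := by
  rw [metricInChart_apply, chartFrame_self, chartFrame_self, extChartAt_to_inv]

theorem contDiffAt_metricInChart (q : L) :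
    ContDiffAt ℝ ∞ (metricInChart g q) (extChartAt 𝓘(ℝ, F) q q) := by
  have h1 := (contMDiffAt_hom_bundle _).1 (g.contMDiff q)
  have h2 := h1.2
  have hc : extChartAt 𝓘(ℝ, F) q q ∈ (extChartAt 𝓘(ℝ, F) q).target := mem_extChartAt_target q
  have hto : IsOpen (extChartAt 𝓘(ℝ, F) q).target := isOpen_extChartAt_target q
  have h3 : ContMDiffAt 𝓘(ℝ, F) 𝓘(ℝ, F) ∞ (extChartAt 𝓘(ℝ, F) q).symm (extChartAt 𝓘(ℝ, F) q q) :=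
    (contMDiffOn_extChartAt_symm q).contMDiffAt (hto.mem_nhds hc)
  have h4 := ContMDiffAt.comp_of_eq h2 h3 (extChartAt_to_inv q)
  refine (contMDiffAt_iff_contDiffAt.1 h4).congr_of_eventuallyEq ?_
  filter_upwards [hto.mem_nhds hc] with y hy
  have hx : (extChartAt 𝓘(ℝ, F) q).symm y ∈ (chartAt F q).source := by
    have := (extChartAt 𝓘(ℝ, F) q).map_target hy
    rwa [extChartAt_source] at this
  have hb : (extChartAt 𝓘(ℝ, F) q).symm y ∈
      (trivializationAt F (TangentSpace 𝓘(ℝ, F)) q).baseSet := by simpa using hx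
  ext u w
  have h5 := inCoordinates_apply_eq₂ (𝕜 := ℝ) (F₁ := F)
    (E₁ := fun q : L => TangentSpace 𝓘(ℝ, F) q) (F₂ := F)
    (E₂ := fun q : L => TangentSpace 𝓘(ℝ, F) q) (F₃ := ℝ) (E₃ := Trivial L ℝ)
    (ϕ := g.inner ((extChartAt 𝓘(ℝ, F) q).symm y)) (v := u) (w := w) hb hb (by simp)
  refine Eq.trans ?_ h5.symm
  have h6 : ∀ u : F, (trivializationAt F (TangentSpace 𝓘(ℝ, F)) q).symm
      ((extChartAt 𝓘(ℝ, F) q).symm y) u = chartFrame q y u := fun u => by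
    have := symmL_trivializationAt_eq_chartFrame hx u
    rw [(extChartAt 𝓘(ℝ, F) q).right_inv hy] at this
    rwa [Trivialization.symmL_apply _ hb] at this
  rw [metricInChart_apply]
  erw [h6 u, h6 w]
  simp
  rfl

theorem christoffel_apply (q : L) (a w c : F) : christoffel g q a w c = 1 / 2 *
    (fderiv ℝ (metricInChart g q) (extChartAt 𝓘(ℝ, F) q q) a c w +
      fderiv ℝ (metricInChart g q) (extChartAt 𝓘(ℝ, F) q q) c a w -
      fderiv ℝ (metricInChart g q) (extChartAt 𝓘(ℝ, F) q q) w a c) := by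
  simp [christoffel]

theorem fderiv_metricInChart_symm (q : L) (a u w : F) :
    fderiv ℝ (metricInChart g q) (extChartAt 𝓘(ℝ, F) q q) a u w =
      fderiv ℝ (metricInChart g q) (extChartAt 𝓘(ℝ, F) q q) a w u := by
  have hd : HasFDerivAt (metricInChart g q) _ (extChartAt 𝓘(ℝ, F) q q) :=
    ((contDiffAt_metricInChart g q).differentiableAt (by simp)).hasFDerivAt
  have h : ∀ u w : F, fderiv ℝ (fun y => metricInChart g q y u w) (extChartAt 𝓘(ℝ, F) q q) a =
      fderiv ℝ (metricInChart g q) (extChartAt 𝓘(ℝ, F) q q) a u w := fun u w => by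
    have := (hd.clm_apply (hasFDerivAt_const u _)).clm_apply (hasFDerivAt_const w _)
    rw [this.fderiv]
    simp
  rw [← h, ← h]
  congr 2
  ext y
  exact metricInChart_symm g q y u w

theorem christoffel_symm (q : L) (a w c : F) : christoffel g q a w c = christoffel g q c w a := by
  rw [christoffel_apply, christoffel_apply, fderiv_metricInChart_symm g q w a c]
  ring

theorem christoffel_diag (q : L) (a w : F) : christoffel g q a w w =
    1 / 2 * fderiv ℝ (metricInChart g q) (extChartAt 𝓘(ℝ, F) q q) a w w := by
  rw [christoffel_apply]
  ring

set_option synthInstance.maxHeartbeats 200000 in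
theorem christoffel_zero (q : L) (w : F) : christoffel g q 0 w = 0 := by
  ext c
  simp [christoffel_apply]

theorem modelInner_injective (q : L) : Function.Injective (modelInner g q) :=
  flat_injective g q

variable [FiniteDimensional ℝ F]

/-- The vector `p♯`, in the model space. -/
def modelSharp (q : L) (p : F →L[ℝ] ℝ) : F := sharp g q p

theorem modelInner_sharp (q : L) (p : F →L[ℝ] ℝ) : modelInner g q (modelSharp g q p) = p :=
  (LinearEquiv.ofBijective (g.inner q).toLinearMap (flat_bijective g q)).apply_symm_apply p

/-- The square `|p|²` of the norm of a covector. -/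
def conormSq (ξ : Cotangent F L) : ℝ := modelCovector ξ (modelSharp g ξ.proj (modelCovector ξ))

theorem apply_modelSharp_self_nonneg (q : L) (p : F →L[ℝ] ℝ) : 0 ≤ p (modelSharp g q p) := by
  have := modelInner_self_nonneg g q (modelSharp g q p)
  rwa [modelInner_sharp] at this

theorem conormSq_nonneg (ξ : Cotangent F L) : 0 ≤ conormSq g ξ :=
  apply_modelSharp_self_nonneg g _ _

theorem conorm_eq_sqrt (ξ : Cotangent F L) : conorm g ξ = √(conormSq g ξ) := rfl

/-- The Cauchy-Schwarz inequality for covectors. -/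
theorem apply_modelSharp_sq_le (q : L) (κ p : F →L[ℝ] ℝ) :
    κ (modelSharp g q p) ^ 2 ≤ κ (modelSharp g q κ) * p (modelSharp g q p) := by
  have hab : modelInner g q (modelSharp g q κ) (modelSharp g q p) = κ (modelSharp g q p) := by
    rw [modelInner_sharp]
  have haa : modelInner g q (modelSharp g q κ) (modelSharp g q κ) = κ (modelSharp g q κ) := by
    rw [modelInner_sharp]
  have hbb : modelInner g q (modelSharp g q p) (modelSharp g q p) = p (modelSharp g q p) := by
    rw [modelInner_sharp]
  rw [← hab, ← haa, ← hbb]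
  set a := modelSharp g q κ
  set b := modelSharp g q p
  have hq : ∀ t : ℝ, 0 ≤ modelInner g q b b * (t * t) + 2 * modelInner g q a b * t +
      modelInner g q a a := by
    intro t
    have := modelInner_self_nonneg g q (a + t • b)
    have hs := modelInner_symm g q b a
    simp only [map_add, map_smul, add_apply, smul_apply, smul_eq_mul] at this
    rw [hs] at this
    linarith
  have := discrim_le_zero hq
  rw [discrim] at this
  nlinarith

/-- The function `|p|²` in the coordinates `(y, P)` of a chart of `T*L`: it is `P (G(y)⁻¹ P)`. -/
theorem conormSq_in_chart (ξ₀ ξ : Cotangent F L) (h : ξ.proj ∈ (chartAt F ξ₀.proj).source) :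
    ∃ σ : F, metricInChart g ξ₀.proj (extChartAt (cotangentModel F) ξ₀ ξ).1 σ =
      (extChartAt (cotangentModel F) ξ₀ ξ).2 ∧
      conormSq g ξ = (extChartAt (cotangentModel F) ξ₀ ξ).2 σ := by
  obtain ⟨B, hB, -⟩ := exists_chartFrame_inverse h
  rw [extChartAt_cotangent ξ₀ ξ h]
  have hx : (extChartAt 𝓘(ℝ, F) ξ₀.proj).symm (extChartAt 𝓘(ℝ, F) ξ₀.proj ξ.proj) = ξ.proj :=
    (extChartAt 𝓘(ℝ, F) ξ₀.proj).left_inv (by rwa [extChartAt_source])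
  refine ⟨B (modelSharp g ξ.proj (modelCovector ξ)), ?_, ?_⟩
  · ext u
    rw [metricInChart_apply, hB, hx, modelInner_sharp]
    rfl
  · exact (congrArg (modelCovector ξ) (hB _)).symm

theorem connectionMap_eq (ξ : Cotangent F L) (η : F × (F →L[ℝ] ℝ)) :
    connectionMap (F := F) g ξ η =
      η.2 - christoffel g ξ.proj η.1 (modelSharp g ξ.proj (modelCovector ξ)) := rfl

/-- The almost complex structure `J_g` at `ξ`, on the model space. -/
def modelSasakiJ (ξ : Cotangent F L) (η : F × (F →L[ℝ] ℝ)) : F × (F →L[ℝ] ℝ) := sasakiJ g ξ η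

theorem modelSasakiJ_eq (ξ : Cotangent F L) (η : F × (F →L[ℝ] ℝ)) : modelSasakiJ g ξ η =
      (-modelSharp g ξ.proj (connectionMap (F := F) g ξ η), modelInner g ξ.proj η.1 +
        christoffel g ξ.proj (-modelSharp g ξ.proj (connectionMap (F := F) g ξ η))
          (modelSharp g ξ.proj (modelCovector ξ))) := rfl

/-- The Sasaki metric: `-dΘ(η, J_g η)` is the sum of the squares of the horizontal and of the
vertical part of `η`. -/
theorem liouville_sasakiJ (ξ : Cotangent F L) (η : F × (F →L[ℝ] ℝ)) :
    -(DiffForm.extDeriv (cotangentModel F) (liouville F L) ξ ![η, modelSasakiJ g ξ η]) =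
      modelInner g ξ.proj η.1 η.1 + connectionMap (F := F) g ξ η
        (modelSharp g ξ.proj (connectionMap (F := F) g ξ η)) := by
  refine (congrArg Neg.neg (extDeriv_liouville ξ η (modelSasakiJ g ξ η))).trans ?_
  rw [modelSasakiJ_eq]
  set κ := connectionMap (F := F) g ξ η with hκ
  set s := modelSharp g ξ.proj (modelCovector ξ) with hs
  have h1 : η.2 = κ + christoffel g ξ.proj η.1 s := by rw [hκ, connectionMap_eq, sub_add_cancel]
  have h2 := christoffel_symm g ξ.proj (-modelSharp g ξ.proj κ) s η.1
  simp only [add_apply]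
  rw [h2, h1]
  simp only [add_apply, map_neg]
  ring

/-- The structure `J_g` maps the horizontal part `a` of a vector to the vertical vector
`g(a, ·)`. -/
theorem connectionMap_sasakiJ (ξ : Cotangent F L) (η : F × (F →L[ℝ] ℝ)) :
    connectionMap (F := F) g ξ (modelSasakiJ g ξ η) = modelInner g ξ.proj η.1 := by
  refine (connectionMap_eq g ξ (modelSasakiJ g ξ η)).trans ?_
  rw [modelSasakiJ_eq, add_sub_cancel_right]

theorem hasFDerivAt_comp_fst {X Y Z : Type*} [NormedAddCommGroup X] [NormedSpace ℝ X]
    [NormedAddCommGroup Y] [NormedSpace ℝ Y] [NormedAddCommGroup Z] [NormedSpace ℝ Z] {f : X → Z}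
    {f' : X →L[ℝ] Z} {z : X × Y} (h : HasFDerivAt f f' z.1) :
    HasFDerivAt (fun y : X × Y => f y.1) (f'.comp (ContinuousLinearMap.fst ℝ X Y)) z :=
  h.comp z hasFDerivAt_fst

set_option synthInstance.maxHeartbeats 200000 in
/-- The differential of `|p|²` is `2 ⟨K(η), p⟩`, with `K` the connection map. -/
theorem hasMFDerivAt_conormSq (ξ : Cotangent F L) :
    ContMDiffAt (cotangentModel F) 𝓘(ℝ, ℝ) ∞ (conormSq g) ξ ∧
    ∀ η : F × (F →L[ℝ] ℝ), mfderiv (cotangentModel F) 𝓘(ℝ, ℝ) (conormSq g) ξ η =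
      2 * connectionMap (F := F) g ξ η (modelSharp g ξ.proj (modelCovector ξ)) := by
  set e := extChartAt (cotangentModel F) ξ with he
  set q := ξ.proj with hq
  set c := extChartAt 𝓘(ℝ, F) q q with hcdef
  have hc : e ξ ∈ e.target := mem_extChartAt_target ξ
  have htop : IsOpen e.target := isOpen_extChartAt_target ξ
  have heξ : e ξ = (c, modelCovector ξ) := extChartAt_cotangent_self ξ
  set G := metricInChart g q with hG
  -- the bilinear form `G` is invertible at the centre of the chart
  have hbij : Function.Bijective (G c).toLinearMap := by
    have h1 : (G c) = modelInner g q := by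
      ext u w; exact metricInChart_self g q u w
    rw [h1]
    exact flat_bijective g q
  let G₀ : F ≃L[ℝ] (F →L[ℝ] ℝ) :=
    (LinearEquiv.ofBijective (G c).toLinearMap hbij).toContinuousLinearEquiv
  have hG₀ : (G₀ : F →L[ℝ] (F →L[ℝ] ℝ)) = G c := by ext; rfl
  have hGs : ContDiffAt ℝ ∞ G c := contDiffAt_metricInChart g q
  have hGi : ContDiffAt ℝ ∞ (fun y => ContinuousLinearMap.inverse (G y)) c :=
    ContDiffAt.comp (g := ContinuousLinearMap.inverse) c
      (by rw [← hG₀]; exact contDiffAt_map_inverse G₀) hGs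
  let σ : F × (F →L[ℝ] ℝ) → F := fun y => ContinuousLinearMap.inverse (G y.1) y.2
  have hσ : ContDiffAt ℝ ∞ σ (e ξ) := by
    rw [heξ]
    exact (ContDiffAt.comp (c, modelCovector ξ) (f := Prod.fst) hGi contDiffAt_fst).clm_apply
      contDiffAt_snd
  have hinv : ∀ᶠ y in 𝓝 c, (G y).IsInvertible := by
    have h1 : range (fun e : F ≃L[ℝ] (F →L[ℝ] ℝ) => (e : F →L[ℝ] (F →L[ℝ] ℝ))) ∈ 𝓝 (G c) := by
      rw [← hG₀]; exact ContinuousLinearEquiv.nhds G₀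
    exact hGs.continuousAt.eventually h1
  have hGσ : ∀ᶠ y in 𝓝 (e ξ), G y.1 (σ y) = y.2 := by
    have : Tendsto (Prod.fst : F × (F →L[ℝ] ℝ) → F) (𝓝 (e ξ)) (𝓝 c) := by
      rw [heξ]; exact continuousAt_fst
    filter_upwards [this.eventually hinv] with y hy
    exact hy.self_apply_inverse y.2
  have hN : ∀ᶠ y in 𝓝 (e ξ), conormSq g (e.symm y) = y.2 (σ y) := by
    have : Tendsto (Prod.fst : F × (F →L[ℝ] ℝ) → F) (𝓝 (e ξ)) (𝓝 c) := by
      rw [heξ]; exact continuousAt_fst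
    filter_upwards [htop.mem_nhds hc, hGσ, this.eventually hinv] with y hy hy' hi
    obtain ⟨s, hs1, hs2⟩ := conormSq_in_chart g ξ (e.symm y)
      (mem_extChartAt_cotangent_source.1 (e.map_target hy))
    rw [← he, e.right_inv hy] at hs1 hs2
    have : s = σ y := hi.injective (hs1.trans hy'.symm)
    rw [hs2, this]
  have hNs : ContDiffAt ℝ ∞ (fun y => conormSq g (e.symm y)) (e ξ) :=
    (contDiffAt_snd.clm_apply hσ).congr_of_eventuallyEq hN
  have hsm : ContMDiffAt (cotangentModel F) 𝓘(ℝ, ℝ) ∞ (conormSq g) ξ := by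
    have h1 : ContMDiffAt (cotangentModel F) 𝓘(ℝ, F × (F →L[ℝ] ℝ)) ∞ e ξ := contMDiffAt_extChartAt
    have h2 := hNs.contMDiffAt.comp ξ h1
    refine h2.congr_of_eventuallyEq ?_
    filter_upwards [extChartAt_source_mem_nhds (I := cotangentModel F) ξ] with ζ hζ
    simp only [Function.comp]
    rw [e.left_inv hζ]
  refine ⟨hsm, fun η => ?_⟩
  have hσc : σ (e ξ) = modelSharp g q (modelCovector ξ) := by
    have h1 := hGσ.self_of_nhds
    rw [heξ] at h1 ⊢
    apply modelInner_injective g q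
    rw [modelInner_sharp]
    refine Eq.trans ?_ h1
    ext w
    exact (metricInChart_self g q _ w).symm
  have h1 : mfderiv (cotangentModel F) 𝓘(ℝ, ℝ) (conormSq g) ξ η =
      fderiv ℝ (fun y => conormSq g (e.symm y)) (e ξ) η := by
    have h2 := (hsm.mdifferentiableAt (by simp)).mfderiv
    have h3 : range (cotangentModel F) = univ := ModelWithCorners.range_eq_univ _
    rw [h2, h3, fderivWithin_univ]
    rfl
  have hσd : HasFDerivAt σ (fderiv ℝ σ (e ξ)) (e ξ) :=
    (hσ.differentiableAt (by simp)).hasFDerivAt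
  have hGd : HasFDerivAt (fun y : F × (F →L[ℝ] ℝ) => G y.1)
      ((fderiv ℝ G c).comp (ContinuousLinearMap.fst ℝ F (F →L[ℝ] ℝ))) (e ξ) := by
    refine hasFDerivAt_comp_fst (X := F) (Y := F →L[ℝ] ℝ) (Z := F →L[ℝ] F →L[ℝ] ℝ) (f := G) (z := e ξ) ?_
    rw [heξ]
    exact (hGs.differentiableAt (by simp)).hasFDerivAt
  set s := modelSharp g q (modelCovector ξ) with hs
  -- differentiating `G σ = P` gives the derivative of `σ`
  have hrel : G c (fderiv ℝ σ (e ξ) η) + fderiv ℝ G c η.1 s = η.2 := by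
    have h2 := (hGd.clm_apply hσd).fderiv
    have h3 : fderiv ℝ (fun y => G y.1 (σ y)) (e ξ) =
        ContinuousLinearMap.snd ℝ F (F →L[ℝ] ℝ) := by
      rw [Filter.EventuallyEq.fderiv_eq hGσ]; exact fderiv_snd
    rw [h2] at h3
    have h4 := DFunLike.congr_fun h3 η
    simp only [add_apply, ContinuousLinearMap.comp_apply, ContinuousLinearMap.flip_apply,
      ContinuousLinearMap.coe_fst', ContinuousLinearMap.coe_snd', hσc] at h4
    rw [← h4, heξ]
  have hcov : ∀ w, modelCovector ξ w = G c s w := fun w => by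
    rw [hG, metricInChart_self, hs, modelInner_sharp]
  have hder : fderiv ℝ (fun y => conormSq g (e.symm y)) (e ξ) η =
      modelCovector ξ (fderiv ℝ σ (e ξ) η) + η.2 s := by
    rw [Filter.EventuallyEq.fderiv_eq hN]
    have h2 := (hasFDerivAt_snd (𝕜 := ℝ) (p := e ξ)).clm_apply hσd
    rw [h2.fderiv]
    simp only [add_apply, ContinuousLinearMap.comp_apply, ContinuousLinearMap.flip_apply,
      ContinuousLinearMap.coe_snd', hσc]
    rw [heξ]
  have h6 : G c s (fderiv ℝ σ (e ξ) η) = G c (fderiv ℝ σ (e ξ) η) s := metricInChart_symm g q c _ _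
  rw [h1, hder, connectionMap_eq, sub_apply, hcov, h6, ← hq, ← hs, christoffel_diag, ← hG, ← hcdef]
  have h5 := DFunLike.congr_fun hrel s
  rw [add_apply] at h5
  have h7 : ∀ a b d : ℝ, a + d = b → a + b = 2 * (b - 1 / 2 * d) := fun a b d h => by linarith
  exact h7 _ _ _ h5

end Sasaki

/-! ### Subharmonicity of `|p|²` along holomorphic maps -/

section Subharmonic

variable {F : Type*} [NormedAddCommGroup F] [NormedSpace ℝ F]
  {L : Type*} [TopologicalSpace L] [ChartedSpace F L] [IsManifold 𝓘(ℝ, F) ∞ L]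

/-- The derivative of a map into `T*L`, as a vector of the model space. -/
def cotangentDeriv {D : Type*} [NormedAddCommGroup D] [NormedSpace ℝ D] (W : D → Cotangent F L)
    (z e : D) : F × (F →L[ℝ] ℝ) :=
  mfderiv 𝓘(ℝ, D) (cotangentModel F) W z e

theorem cotangentDeriv_eq_fderiv {D : Type*} [NormedAddCommGroup D] [NormedSpace ℝ D]
    {W : D → Cotangent F L} {z : D} (hW : MDifferentiableAt 𝓘(ℝ, D) (cotangentModel F) W z) (e : D) :
    cotangentDeriv W z e = fderiv ℝ (fun w => extChartAt (cotangentModel F) (W z) (W w)) z e := by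
  have h := hW.mfderiv
  have h3 : range 𝓘(ℝ, D) = univ := ModelWithCorners.range_eq_univ _
  rw [h3, fderivWithin_univ] at h
  exact DFunLike.congr_fun h e

theorem contDiffAt_extChartAt_comp {D : Type*} [NormedAddCommGroup D] [NormedSpace ℝ D]
    {n : ℕ∞} (ξ₀ : Cotangent F L)
    {W : D → Cotangent F L} {z : D} (hW : ContMDiffAt 𝓘(ℝ, D) (cotangentModel F) n W z)
    (hz : (W z).proj ∈ (chartAt F ξ₀.proj).source) :
    ContDiffAt ℝ n (fun w => (extChartAt (cotangentModel F) ξ₀ (W w) : F × (F →L[ℝ] ℝ))) z := by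
  rw [← contMDiffAt_iff_contDiffAt]
  have h1 : W z ∈ (chartAt (ModelProd F (F →L[ℝ] ℝ)) ξ₀).source := by
    rw [← extChartAt_source (I := cotangentModel F)]
    exact mem_extChartAt_cotangent_source.2 hz
  exact ((contMDiffAt_extChartAt' (n := ∞) h1).of_le (m := n) (by exact_mod_cast le_top)).comp z hW

/-- The Liouville form along a map `W` into `T*L`, evaluated with the chart around `W z` itself or
with a fixed chart: the derivative `cotangentDeriv W` is taken in a chart that moves with the point,
and this equality is what allows to differentiate `Θ(dW)` once more. -/
theorem modelCovector_cotangentDeriv {D : Type*} [NormedAddCommGroup D] [NormedSpace ℝ D]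
    (ξ₀ : Cotangent F L) {W : D → Cotangent F L} {z : D}
    (hW : ContMDiffAt 𝓘(ℝ, D) (cotangentModel F) 1 W z)
    (hz : (W z).proj ∈ (chartAt F ξ₀.proj).source) (e : D) :
    modelCovector (W z) (cotangentDeriv W z e).1 =
      (extChartAt (cotangentModel F) ξ₀ (W z)).2
        (fderiv ℝ (fun w => extChartAt (cotangentModel F) ξ₀ (W w)) z e).1 := by
  have hWd := hW.mdifferentiableAt one_ne_zero
  have key : ∀ ξ₁ : Cotangent F L, (W z).proj ∈ (chartAt F ξ₁.proj).source →
      fderiv ℝ (fun w => (extChartAt (cotangentModel F) ξ₁ (W w)).1) z e =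
      (fderiv ℝ (fun w => extChartAt (cotangentModel F) ξ₁ (W w)) z e).1 := fun ξ₁ h => by
    have h1 := (contDiffAt_extChartAt_comp (n := 1) ξ₁ hW h).differentiableAt one_ne_zero
    exact DFunLike.congr_fun (fderiv.fst (𝕜 := ℝ) (E := D) (F := F) (G := F →L[ℝ] ℝ) h1) e
  have hs := mem_chart_source F (W z).proj
  have h1 := covector_mfderiv_proj ξ₀ hWd hz e
  have h2 := covector_mfderiv_proj (W z) hWd hs e
  rw [h1, key _ hz, key _ hs, ← cotangentDeriv_eq_fderiv hWd, extChartAt_cotangent_self] at h2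
  exact h2.symm

variable (g : Metric F L) [FiniteDimensional ℝ F]

theorem fderiv_conormSq_comp {D : Type*} [NormedAddCommGroup D] [NormedSpace ℝ D]
    {W : D → Cotangent F L} {z : D} (hW : MDifferentiableAt 𝓘(ℝ, D) (cotangentModel F) W z) (e : D) :
    fderiv ℝ (fun w => conormSq g (W w)) z e =
      2 * connectionMap (F := F) g (W z) (cotangentDeriv W z e)
        (modelSharp g (W z).proj (modelCovector (W z))) := by
  obtain ⟨h1, h2⟩ := hasMFDerivAt_conormSq g (W z)
  refine Eq.trans ?_ (h2 (cotangentDeriv W z e))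
  rw [← mfderiv_eq_fderiv]
  exact DFunLike.congr_fun (mfderiv_comp z (h1.mdifferentiableAt (by simp)) hW) e

theorem contDiffAt_conormSq_comp {D : Type*} [NormedAddCommGroup D] [NormedSpace ℝ D] {n : ℕ∞}
    {W : D → Cotangent F L} {z : D} (hW : ContMDiffAt 𝓘(ℝ, D) (cotangentModel F) n W z) :
    ContDiffAt ℝ n (fun w => conormSq g (W w)) z := by
  rw [← contMDiffAt_iff_contDiffAt]
  exact ((hasMFDerivAt_conormSq g (W z)).1.of_le (m := n) (by exact_mod_cast le_top)).comp z hW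

/-- `d(|p|²)(J_g η) = 2 Θ(η)`. -/
theorem connectionMap_sasakiJ_modelSharp (ξ : Cotangent F L) (η : F × (F →L[ℝ] ℝ)) :
    connectionMap (F := F) g ξ (modelSasakiJ g ξ η) (modelSharp g ξ.proj (modelCovector ξ)) =
      modelCovector ξ η.1 := by
  rw [connectionMap_sasakiJ, modelInner_symm, modelInner_sharp]

set_option synthInstance.maxHeartbeats 200000 in
/-- Along a `J_g`-holomorphic map, `Δ|p|² = -2 dΘ(W_τ, J_g W_τ) ≥ 0`: the partial derivatives of
`|p|²` are `-2 Θ(W_t)` and `2 Θ(W_τ)`. -/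
theorem lap_conormSq_nonneg {W : ℝ × ℝ → Cotangent F L} {z : ℝ × ℝ}
    (hW : ContMDiffAt 𝓘(ℝ, ℝ × ℝ) (cotangentModel F) 2 W z)
    (h1 : ∀ᶠ w in 𝓝 z, cotangentDeriv W w (1, 0) =
      -modelSasakiJ g (W w) (cotangentDeriv W w (0, 1)))
    (h2 : ∀ᶠ w in 𝓝 z, cotangentDeriv W w (0, 1) =
      modelSasakiJ g (W w) (cotangentDeriv W w (1, 0))) :
    0 ≤ lap (fun w => conormSq g (W w)) z := by
  set ξ₀ := W z with hξ₀
  set X : ℝ × ℝ → F × (F →L[ℝ] ℝ) := fun w => extChartAt (cotangentModel F) ξ₀ (W w) with hXdef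
  have hX : ContDiffAt ℝ 2 X z :=
    contDiffAt_extChartAt_comp (n := 2) ξ₀ hW (mem_chart_source F _)
  have hsrc : ∀ᶠ w in 𝓝 z, (W w).proj ∈ (chartAt F ξ₀.proj).source := by
    have h := hW.continuousAt.preimage_mem_nhds (extChartAt_source_mem_nhds (I := cotangentModel F) ξ₀)
    filter_upwards [h] with w hw
    exact mem_extChartAt_cotangent_source.1 hw
  have hWe : ∀ᶠ w in 𝓝 z, ContMDiffAt 𝓘(ℝ, ℝ × ℝ) (cotangentModel F) 1 W w := by
    have h : IsManifold (cotangentModel F) 2 (Cotangent F L) :=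
      IsManifold.of_le (n := ∞) (WithTop.coe_le_coe.2 (le_top : (2 : ℕ∞) ≤ ⊤))
    have h' := (contMDiffAt_iff_contMDiffAt_nhds (by norm_num)).1 hW
    filter_upwards [h'] with w hw using hw.of_le (by norm_num)
  have hΘ : ∀ᶠ w in 𝓝 z, ∀ e, modelCovector (W w) (cotangentDeriv W w e).1 =
      (X w).2 (fderiv ℝ X w e).1 := by
    filter_upwards [hsrc, hWe] with w hw hd e
    exact modelCovector_cotangentDeriv ξ₀ hd hw e
  have hneg : ∀ (ξ : Cotangent F L) (η : F × (F →L[ℝ] ℝ)) (c : F),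
      connectionMap (F := F) g ξ (-η) c = -connectionMap (F := F) g ξ η c := fun ξ η c => by
    have hch : christoffel g ξ.proj (-η.1) (modelSharp g ξ.proj (modelCovector ξ)) c =
        -christoffel g ξ.proj η.1 (modelSharp g ξ.proj (modelCovector ξ)) c := by
      rw [christoffel_apply, christoffel_apply]
      simp only [map_neg, neg_apply]
      ring
    rw [connectionMap_eq, connectionMap_eq]
    simp only [sub_apply, Prod.fst_neg, Prod.snd_neg, neg_apply, hch]
    ring
  -- the first derivatives of `|p|²`, by the Cauchy-Riemann equation
  have hu1 : (fun w => fderiv ℝ (fun w => conormSq g (W w)) w (1, 0)) =ᶠ[𝓝 z]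
      fun w => -(2 * (X w).2 (fderiv ℝ X w (0, 1)).1) := by
    filter_upwards [h1, hWe, hΘ] with w hw hd ht
    rw [fderiv_conormSq_comp g (hd.mdifferentiableAt one_ne_zero), hw, hneg,
      connectionMap_sasakiJ_modelSharp, ht]
    ring
  have hu2 : (fun w => fderiv ℝ (fun w => conormSq g (W w)) w (0, 1)) =ᶠ[𝓝 z]
      fun w => 2 * (X w).2 (fderiv ℝ X w (1, 0)).1 := by
    filter_upwards [h2, hWe, hΘ] with w hw hd ht
    rw [fderiv_conormSq_comp g (hd.mdifferentiableAt one_ne_zero), hw,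
      connectionMap_sasakiJ_modelSharp, ht]
  have hXd : DifferentiableAt ℝ X z := hX.differentiableAt two_ne_zero
  have hder : ∀ e : ℝ × ℝ, HasFDerivAt (fun w => (X w).2 (fderiv ℝ X w e).1)
      (((X z).2.comp ((ContinuousLinearMap.fst ℝ F (F →L[ℝ] ℝ)).comp
        (fderiv ℝ (fun w => fderiv ℝ X w e) z))) +
        (((ContinuousLinearMap.snd ℝ F (F →L[ℝ] ℝ)).comp (fderiv ℝ X z)).flip
          (fderiv ℝ X z e).1)) z := fun e => by
    have ha : HasFDerivAt (fun w => (X w).2)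
        ((ContinuousLinearMap.snd ℝ F (F →L[ℝ] ℝ)).comp (fderiv ℝ X z)) z :=
      hXd.hasFDerivAt.snd
    have hb : HasFDerivAt (fun w => (fderiv ℝ X w e).1)
        ((ContinuousLinearMap.fst ℝ F (F →L[ℝ] ℝ)).comp
        (fderiv ℝ (fun w => fderiv ℝ X w e) z)) z :=
      (differentiableAt_fderiv_apply hX e).hasFDerivAt.fst
    exact ha.clm_apply hb
  -- the mixed second derivatives of `W` cancel in the Laplacian
  have hsymm : fderiv ℝ (fun w => fderiv ℝ X w (0, 1)) z (1, 0) =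
      fderiv ℝ (fun w => fderiv ℝ X w (1, 0)) z (0, 1) := by
    have hs : IsSymmSndFDerivAt ℝ X z := hX.isSymmSndFDerivAt (by simp)
    have hd : DifferentiableAt ℝ (fderiv ℝ X) z :=
      (hX.fderiv_right (m := 1) (by norm_num)).differentiableAt one_ne_zero
    rw [fderiv_clm_apply hd (differentiableAt_const _), fderiv_clm_apply hd
      (differentiableAt_const _)]
    simpa using hs (1, 0) (0, 1)
  have hlap : lap (fun w => conormSq g (W w)) z = 2 * ((fderiv ℝ X z (0, 1)).2 (fderiv ℝ X z (1, 0)).1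
      - (fderiv ℝ X z (1, 0)).2 (fderiv ℝ X z (0, 1)).1) := by
    unfold lap
    rw [hu1.fderiv_eq, hu2.fderiv_eq]
    have e1 : fderiv ℝ (fun w => -(2 * (X w).2 (fderiv ℝ X w (0, 1)).1)) z = _ :=
      (((hder (0, 1)).const_mul 2).neg).fderiv
    rw [e1, ((hder (1, 0)).const_mul 2).fderiv]
    simp [hsymm]
    ring
  have hWd := (hWe.self_of_nhds).mdifferentiableAt one_ne_zero
  have hJ := liouville_sasakiJ g ξ₀ (cotangentDeriv W z (1, 0))
  have hJ2 : DiffForm.extDeriv (cotangentModel F) (liouville F L) ξ₀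
      ![cotangentDeriv W z (1, 0), modelSasakiJ g ξ₀ (cotangentDeriv W z (1, 0))] =
      (fderiv ℝ X z (1, 0)).2 (fderiv ℝ X z (0, 1)).1
      - (fderiv ℝ X z (0, 1)).2 (fderiv ℝ X z (1, 0)).1 := by
    have h := h2.self_of_nhds
    rw [← hξ₀] at h
    refine (extDeriv_liouville ξ₀ _ _).trans ?_
    rw [← h, cotangentDeriv_eq_fderiv hWd, cotangentDeriv_eq_fderiv hWd]
  rw [hJ2] at hJ
  have hn1 := modelInner_self_nonneg g ξ₀.proj (cotangentDeriv W z (1, 0)).1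
  have hn2 := apply_modelSharp_self_nonneg g ξ₀.proj
    (connectionMap (F := F) g ξ₀ (cotangentDeriv W z (1, 0)))
  rw [hlap]
  linarith

/-- The differential of `|p|²` is at most `2 |p|` times the Sasaki norm. -/
theorem connectionMap_modelSharp_sq_le (ξ : Cotangent F L) (η : F × (F →L[ℝ] ℝ)) :
    (connectionMap (F := F) g ξ η (modelSharp g ξ.proj (modelCovector ξ))) ^ 2 ≤
      -(DiffForm.extDeriv (cotangentModel F) (liouville F L) ξ ![η, modelSasakiJ g ξ η]) *
        conormSq g ξ := by
  rw [liouville_sasakiJ]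
  have h1 := modelInner_self_nonneg g ξ.proj η.1
  have h2 := conormSq_nonneg g ξ
  refine (apply_modelSharp_sq_le g ξ.proj _ _).trans ?_
  rw [add_mul]
  exact le_add_of_nonneg_left (mul_nonneg h1 h2)

end Subharmonic

/-! ### The function `|p|²` and the distance to the Lagrangian submanifold -/

section Metric

variable {E : Type*} [NormedAddCommGroup E] [NormedSpace ℝ E]
  {M : Type*} [TopologicalSpace M] [ChartedSpace E M]
  (Ω : DiffForm 𝓘(ℝ, E) (N := M) 2)
  (J : ∀ x : M, TangentSpace 𝓘(ℝ, E) x →L[ℝ] TangentSpace 𝓘(ℝ, E) x)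

/-- The value `Ω(u, w)`, with the tangent space identified with the model space. -/
def modelForm (x : M) (u w : E) : ℝ := Ω x ![u, w]

/-- The endomorphism `J` at `x`, on the model space. -/
def modelStructure (x : M) : E →L[ℝ] E := J x

theorem modelForm_smul (x : M) (c : ℝ) (u w : E) :
    modelForm Ω x (c • u) (c • w) = c ^ 2 * modelForm Ω x u w := by
  let β : E [⋀^Fin 2]→L[ℝ] ℝ := Ω x
  have h : β (fun i => c • (![u, w] : Fin 2 → E) i) = _ :=
    β.toContinuousMultilinearMap.map_smul_univ (fun _ => c) ![u, w]
  have h2 : (fun i => c • (![u, w] : Fin 2 → E) i) = ![c • u, c • w] := by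
    ext i; fin_cases i <;> rfl
  simp only [Finset.prod_const, Finset.card_univ, Fintype.card_fin, smul_eq_mul] at h
  rw [h2] at h
  exact h

/-- The derivative of a map into `M`, as a vector of the model space. -/
def modelDeriv {D : Type*} [NormedAddCommGroup D] [NormedSpace ℝ D] (γ : D → M) (z e : D) : E :=
  mfderiv 𝓘(ℝ, D) 𝓘(ℝ, E) γ z e

/-- The square of the norm of `u` in the metric `Ω(·, J ·)`. -/
def metricSq (x : M) (u : E) : ℝ := modelForm Ω x u (modelStructure J x u)

/-- The norm of the metric `Ω(·, J ·)` on the tangent spaces. -/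
@[reducible]
def metricENorm : ∀ x : M, ENorm (TangentSpace 𝓘(ℝ, E) x) :=
  fun x => ⟨fun u => ENNReal.ofReal (Real.sqrt (Ω x ![u, J x u]))⟩

theorem dist_eq_riemannianEDist (x y : M) :
    letI := metricENorm Ω J
    dist Ω J x y = Manifold.riemannianEDist 𝓘(ℝ, E) x y := rfl

/-- The norm is absolutely homogeneous, whether or not `Ω(·, J ·)` is positive; the Riemannian
distance is therefore symmetric. -/
theorem enormSMulClass_metricENorm :
    letI := metricENorm Ω J
    ∀ x : M, ENormSMulClass ℝ (TangentSpace 𝓘(ℝ, E) x) := by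
  let := metricENorm Ω J
  intro x
  refine ⟨fun c u => ?_⟩
  have h1 : Ω x ![c • u, J x (c • u)] = c ^ 2 * Ω x ![u, J x u] := by
    rw [map_smul]; exact modelForm_smul Ω x c u (J x u)
  change ENNReal.ofReal √(Ω x ![c • u, J x (c • u)]) = ‖c‖ₑ * ENNReal.ofReal √(Ω x ![u, J x u])
  rw [h1, Real.sqrt_mul (sq_nonneg c), Real.sqrt_sq_eq_abs, ENNReal.ofReal_mul (abs_nonneg c),
    ← Real.enorm_eq_ofReal_abs]

theorem dist_le_of_path {x y : M} {γ : ℝ → M} (hγ : ContMDiffOn 𝓘(ℝ, ℝ) 𝓘(ℝ, E) 1 γ (Icc 0 1))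
    (h0 : γ 0 = x) (h1 : γ 1 = y) {ℓ : ℝ≥0∞}
    (hℓ : ∀ t ∈ Ioo (0 : ℝ) 1, ENNReal.ofReal √(metricSq Ω J (γ t) (modelDeriv γ t 1)) ≤ ℓ) :
    dist Ω J x y ≤ ℓ := by
  let := metricENorm Ω J
  have := enormSMulClass_metricENorm Ω J
  rw [dist_eq_riemannianEDist]
  refine (Manifold.riemannianEDist_le_pathELength hγ h0 h1 zero_le_one).trans ?_
  rw [Manifold.pathELength_eq_lintegral_mfderiv_Ioo]
  calc _ ≤ ∫⁻ _ in Ioo (0 : ℝ) 1, ℓ := setLIntegral_mono' measurableSet_Ioo fun t ht => hℓ t ht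
    _ = ℓ := by simp

theorem exists_path_of_dist_lt {x y : M} {r : ℝ≥0∞} (h : dist Ω J x y < r) :
    ∃ γ : ℝ → M, γ 0 = y ∧ γ 1 = x ∧ ContMDiff 𝓘(ℝ, ℝ) 𝓘(ℝ, E) 1 γ ∧
      ∫⁻ t in Icc (0 : ℝ) 1, ENNReal.ofReal √(metricSq Ω J (γ t) (modelDeriv γ t 1)) < r := by
  let := metricENorm Ω J
  have := enormSMulClass_metricENorm Ω J
  rw [dist_eq_riemannianEDist, Manifold.riemannianEDist_comm] at h
  obtain ⟨γ, h0, h1, hγ, hlen, -, -⟩ :=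
    Manifold.exists_lt_locally_constant_of_riemannianEDist_lt h zero_lt_one
  refine ⟨γ, h0, h1, hγ, ?_⟩
  rw [Manifold.pathELength_eq_lintegral_mfderiv_Icc] at hlen
  exact hlen

/-- The expression of `Ω` in the preferred chart around `y`. -/
theorem inChart_apply (y : M) (w u u' : E) : Ω.inChart 𝓘(ℝ, E) y w ![u, u'] =
    modelForm Ω ((extChartAt 𝓘(ℝ, E) y).symm w) (chartFrame y w u) (chartFrame y w u') := by
  have h : (chartFrame y w ∘ ![u, u'] : Fin 2 → E) = ![chartFrame y w u, chartFrame y w u'] := by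
    ext i; fin_cases i <;> rfl
  let β : E [⋀^Fin 2]→L[ℝ] ℝ := Ω ((extChartAt 𝓘(ℝ, E) y).symm w)
  exact congrArg (fun m => β m) h

theorem isOpen_interior_strip : IsOpen {z : ℝ × ℝ | z.2 ∈ Ioo (0 : ℝ) 1} :=
  isOpen_Ioo.preimage continuous_snd

theorem interior_strip_subset : {z : ℝ × ℝ | z.2 ∈ Ioo (0 : ℝ) 1} ⊆ strip := fun _ hz =>
  ⟨mem_univ _, Ioo_subset_Icc_self hz⟩

theorem strip_mem_nhds {z : ℝ × ℝ} (hz : z.2 ∈ Ioo (0 : ℝ) 1) : strip ∈ 𝓝 z :=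
  mem_of_superset (isOpen_interior_strip.mem_nhds hz) interior_strip_subset

theorem partialDeriv_eq_modelDeriv (v : ℝ × ℝ → M) (e : ℝ × ℝ) {z : ℝ × ℝ}
    (hz : z.2 ∈ Ioo (0 : ℝ) 1) : partialDeriv (E := E) v e z = modelDeriv (E := E) v z e := by
  rw [partialDeriv, modelDeriv, mfderivWithin_of_mem_nhds (strip_mem_nhds hz)]

end Metric

section DarbouxNhd

variable {E : Type*} [NormedAddCommGroup E] [NormedSpace ℝ E]
  {M : Type*} [TopologicalSpace M] [ChartedSpace E M]
  {F : Type*} [NormedAddCommGroup F] [NormedSpace ℝ F]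
  {L : Type*} [TopologicalSpace L] [ChartedSpace F L] [IsManifold 𝓘(ℝ, F) ∞ L]
  {Ω : DiffForm 𝓘(ℝ, E) (N := M) 2} {ι : L → M}
  {Ψ : OpenPartialHomeomorph M (Cotangent F L)} {V : Set M}

theorem IsInnerDarbouxNhd.subset_source (hV : IsInnerDarbouxNhd ι Ψ V) : V ⊆ Ψ.source :=
  subset_closure.trans hV.closure_subset

/-- The derivative of the Darboux chart, between the model spaces. -/
def darbouxDeriv (Ψ : OpenPartialHomeomorph M (Cotangent F L)) (x : M) : E →L[ℝ] F × (F →L[ℝ] ℝ) :=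
  mfderiv 𝓘(ℝ, E) (cotangentModel F) Ψ x

theorem IsDarbouxChart.mdifferentiableAt (hΨ : IsDarbouxChart Ω ι Ψ) {x : M} (hx : x ∈ Ψ.source) :
    MDifferentiableAt 𝓘(ℝ, E) (cotangentModel F) Ψ x :=
  (hΨ.smooth.contMDiffAt (Ψ.open_source.mem_nhds hx)).mdifferentiableAt (by simp)

theorem cotangentDeriv_darboux (hΨ : IsDarbouxChart Ω ι Ψ) {D : Type*} [NormedAddCommGroup D]
    [NormedSpace ℝ D] {γ : D → M} {z : D} (hγ : MDifferentiableAt 𝓘(ℝ, D) 𝓘(ℝ, E) γ z)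
    (hz : γ z ∈ Ψ.source) (e : D) :
    cotangentDeriv (fun w => Ψ (γ w)) z e =
      darbouxDeriv (E := E) Ψ (γ z) (modelDeriv γ z e) :=
  DFunLike.congr_fun (mfderiv_comp z (hΨ.mdifferentiableAt hz) hγ) e

/-- The fibre of `T*L` through `ξ`, traversed from `ξ` to the zero covector. -/
def fibrePath (ξ : Cotangent F L) (t : ℝ) : Cotangent F L := ⟨ξ.proj, (1 - t) • covector ξ⟩

theorem extChartAt_fibrePath (ξ : Cotangent F L) (s t : ℝ) :
    extChartAt (cotangentModel F) (fibrePath ξ s) (fibrePath ξ t) =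
      (extChartAt 𝓘(ℝ, F) ξ.proj ξ.proj, (1 - t) • modelCovector ξ) := by
  rw [extChartAt_cotangent (fibrePath ξ s) (fibrePath ξ t) (mem_chart_source F ξ.proj)]
  refine Prod.ext rfl ?_
  ext u
  exact congrArg ((1 - t) • covector ξ) (chartFrame_self ξ.proj u)

theorem contMDiff_fibrePath (ξ : Cotangent F L) :
    ContMDiff 𝓘(ℝ, ℝ) (cotangentModel F) 1 (fibrePath ξ) := by
  have h1 : fibrePath ξ = fun t => (extChartAt (cotangentModel F) (fibrePath ξ 0)).symm
      (extChartAt 𝓘(ℝ, F) ξ.proj ξ.proj, (1 - t) • modelCovector ξ) := by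
    ext1 t
    rw [← extChartAt_fibrePath ξ 0 t]
    exact ((extChartAt (cotangentModel F) (fibrePath ξ 0)).left_inv (x := fibrePath ξ t)
      (mem_extChartAt_cotangent_source.2 (mem_chart_source F ξ.proj))).symm
  rw [h1]
  have h2 : ContDiff ℝ 1 (fun t : ℝ =>
      ((extChartAt 𝓘(ℝ, F) ξ.proj ξ.proj, (1 - t) • modelCovector ξ) : F × (F →L[ℝ] ℝ))) :=
    contDiff_const.prodMk ((contDiff_const.sub contDiff_id).smul contDiff_const)
  have h3 := contMDiffOn_extChartAt_symm (n := 1) (I := cotangentModel F) (fibrePath ξ 0)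
  intro t
  refine ContMDiffAt.comp t (h3.contMDiffAt ((isOpen_extChartAt_target _).mem_nhds ?_))
    h2.contMDiff.contMDiffAt
  rw [extChartAt_cotangent_target]
  exact ⟨mem_extChartAt_target (I := 𝓘(ℝ, F)) ξ.proj, mem_univ _⟩

theorem cotangentDeriv_fibrePath (ξ : Cotangent F L) (t : ℝ) :
    cotangentDeriv (fibrePath ξ) t 1 = (0, -modelCovector ξ) := by
  rw [cotangentDeriv_eq_fderiv ((contMDiff_fibrePath ξ t).mdifferentiableAt one_ne_zero)]
  simp only [extChartAt_fibrePath]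
  have h0 : HasDerivAt (fun s : ℝ => (1 - s) • modelCovector ξ) (-modelCovector ξ) t := by
    simpa using ((hasDerivAt_id' t).const_sub 1).smul_const (modelCovector ξ)
  have h : HasDerivAt (fun s : ℝ => ((extChartAt 𝓘(ℝ, F) ξ.proj ξ.proj, (1 - s) • modelCovector ξ) :
      F × (F →L[ℝ] ℝ))) (0, -modelCovector ξ) t :=
    (hasDerivAt_const t _).prodMk h0
  exact h.deriv

variable [FiniteDimensional ℝ F] {g : Metric F L}
  {J : ∀ x : M, TangentSpace 𝓘(ℝ, E) x →L[ℝ] TangentSpace 𝓘(ℝ, E) x}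

theorem IsSasakiOn.darbouxDeriv_eq (hJ : IsSasakiOn g Ψ V J) {x : M} (hx : x ∈ V) (u : E) :
    darbouxDeriv Ψ x (modelStructure J x u) = modelSasakiJ g (Ψ x) (darbouxDeriv Ψ x u) :=
  hJ x hx u

/-- On `V` the metric `Ω(·, J ·)` is the pullback of the Sasaki metric. -/
theorem metricSq_sasaki (hΨ : IsDarbouxChart Ω ι Ψ) (hVs : V ⊆ Ψ.source)
    (hJ : IsSasakiOn g Ψ V J) {x : M} (hx : x ∈ V) (u : E) :
    metricSq Ω J x u =
      -(DiffForm.extDeriv (cotangentModel F) (liouville F L) (Ψ x)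
        ![darbouxDeriv Ψ x u, modelSasakiJ g (Ψ x) (darbouxDeriv Ψ x u)]) := by
  rw [metricSq, ← hJ.darbouxDeriv_eq hx]
  exact (hΨ.symplectic x (hVs hx) u (J x u)).symm

theorem metricSq_sasaki_nonneg (hΨ : IsDarbouxChart Ω ι Ψ) (hVs : V ⊆ Ψ.source)
    (hJ : IsSasakiOn g Ψ V J) {x : M} (hx : x ∈ V) (u : E) :
    0 ≤ metricSq Ω J x u := by
  rw [metricSq_sasaki hΨ hVs hJ hx, liouville_sasakiJ]
  exact add_nonneg (modelInner_self_nonneg g _ _) (apply_modelSharp_self_nonneg g _ _)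

theorem contDiffAt_conormSq_darboux (hΨ : IsDarbouxChart Ω ι Ψ) {D : Type*} [NormedAddCommGroup D]
    [NormedSpace ℝ D] {γ : D → M} {z : D} {n : ℕ∞} (hγ : ContMDiffAt 𝓘(ℝ, D) 𝓘(ℝ, E) n γ z)
    (hz : γ z ∈ Ψ.source) : ContDiffAt ℝ n (fun w => conormSq g (Ψ (γ w))) z :=
  contDiffAt_conormSq_comp g (((hΨ.smooth.contMDiffAt (Ψ.open_source.mem_nhds hz)).of_le
    (m := n) (by exact_mod_cast le_top)).comp z hγ)

/-- The differential of `|p|²` is at most `2 |p|` in the metric `Ω(·, J ·)`. -/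
theorem fderiv_conormSq_darboux_sq_le (hΨ : IsDarbouxChart Ω ι Ψ) (hVs : V ⊆ Ψ.source)
    (hJ : IsSasakiOn g Ψ V J) {D : Type*} [NormedAddCommGroup D] [NormedSpace ℝ D] {γ : D → M} {z : D}
    (hγ : MDifferentiableAt 𝓘(ℝ, D) 𝓘(ℝ, E) γ z) (hz : γ z ∈ V) (e : D) :
    fderiv ℝ (fun w => conormSq g (Ψ (γ w))) z e ^ 2 ≤
      4 * (metricSq Ω J (γ z) (modelDeriv γ z e) * conormSq g (Ψ (γ z))) := by
  have hW : MDifferentiableAt 𝓘(ℝ, D) (cotangentModel F) (fun w => Ψ (γ w)) z :=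
    (hΨ.mdifferentiableAt (hVs hz)).comp z hγ
  rw [fderiv_conormSq_comp g hW, cotangentDeriv_darboux hΨ hγ (hVs hz),
    metricSq_sasaki hΨ hVs hJ hz, mul_pow]
  have := connectionMap_modelSharp_sq_le g (Ψ (γ z))
    (darbouxDeriv (E := E) Ψ (γ z) (modelDeriv γ z e))
  norm_num
  linarith

variable (g) in
/-- Along a path in `V` that starts on `L`, the function `|p|` is at most the length. -/
theorem sqrt_conormSq_le_length (hΨ : IsDarbouxChart Ω ι Ψ) (hVs : V ⊆ Ψ.source)
    (hJ : IsSasakiOn g Ψ V J) {γ : ℝ → M} (hγ : ContMDiff 𝓘(ℝ, ℝ) 𝓘(ℝ, E) 1 γ) {b : ℝ}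
    (hb : 0 ≤ b) (hγV : ∀ t ∈ Icc 0 b, γ t ∈ V) (h0 : conormSq g (Ψ (γ 0)) = 0) :
    ENNReal.ofReal √(conormSq g (Ψ (γ b))) ≤
      ∫⁻ t in Icc 0 b, ENNReal.ofReal √(metricSq Ω J (γ t) (modelDeriv γ t 1)) := by
  set u : ℝ → ℝ := fun t => conormSq g (Ψ (γ t)) with hu
  have hun : ∀ t, 0 ≤ u t := fun t => conormSq_nonneg g _
  have hus : ∀ t ∈ Icc 0 b, ContDiffAt ℝ 1 u t := fun t ht =>
    contDiffAt_conormSq_darboux (n := 1) hΨ (hγ t) (hVs (hγV t ht))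
  refine ENNReal.le_of_forall_pos_le_add fun ε hε _ => ?_
  -- `|p|` is not smooth along the zero section; `√(|p|² + ε²)` is
  have hpos : ∀ t, 0 < u t + (ε : ℝ) ^ 2 := fun t => by have := hun t; positivity
  have hfs : ∀ t ∈ Icc 0 b, ContDiffAt ℝ 1 (fun t => √(u t + (ε : ℝ) ^ 2)) t := fun t ht =>
    ((hus t ht).add contDiffAt_const).sqrt (hpos t).ne'
  have hftc := enorm_sub_le_lintegral_deriv_of_contDiffOn_Icc
    (fun t ht => (hfs t ht).contDiffWithinAt) hb
  have hder : ∀ t ∈ Icc 0 b, ‖deriv (fun t => √(u t + (ε : ℝ) ^ 2)) t‖ₑ ≤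
      ENNReal.ofReal √(metricSq Ω J (γ t) (modelDeriv γ t 1)) := fun t ht => by
    have hd : HasDerivAt u (deriv u t) t :=
      ((hus t ht).differentiableAt one_ne_zero).hasDerivAt
    have h1 := ((hd.add_const ((ε : ℝ) ^ 2)).sqrt (hpos t).ne').deriv
    have h2 := fderiv_conormSq_darboux_sq_le hΨ hVs hJ
      ((hγ t).mdifferentiableAt one_ne_zero) (hγV t ht) 1
    have h3 : fderiv ℝ u t 1 = deriv u t := rfl
    rw [← hu, h3] at h2
    rw [h1, Real.enorm_eq_ofReal_abs]
    refine ENNReal.ofReal_le_ofReal (Real.abs_le_sqrt ?_)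
    rw [div_pow, mul_pow, Real.sq_sqrt (hpos t).le, div_le_iff₀ (by have := hpos t; positivity)]
    refine h2.trans ?_
    have h4 := metricSq_sasaki_nonneg hΨ hVs hJ (hγV t ht) (modelDeriv γ t 1)
    have h6 : conormSq g (Ψ (γ t)) = u t := rfl
    rw [h6]
    nlinarith [mul_nonneg h4 (sq_nonneg (ε : ℝ))]
  have h5 : √(u 0 + (ε : ℝ) ^ 2) = ε := by
    rw [show u 0 = 0 from h0, zero_add, Real.sqrt_sq ε.coe_nonneg]
  have h6 : ENNReal.ofReal √(u b) ≤ ‖√(u b + (ε : ℝ) ^ 2) - √(u 0 + (ε : ℝ) ^ 2)‖ₑ + ε := by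
    rw [h5, Real.enorm_eq_ofReal_abs, ← ENNReal.ofReal_coe_nnreal,
      ← ENNReal.ofReal_add (abs_nonneg _) ε.coe_nonneg]
    refine ENNReal.ofReal_le_ofReal ?_
    have h7 : √(u b) ≤ √(u b + (ε : ℝ) ^ 2) := Real.sqrt_le_sqrt (by have := sq_nonneg (ε : ℝ); linarith)
    have := le_abs_self (√(u b + (ε : ℝ) ^ 2) - ε)
    linarith
  refine h6.trans (add_le_add_left (hftc.trans (setLIntegral_mono' measurableSet_Icc hder)) _)

theorem continuousOn_conormSq_darboux (hΨ : IsDarbouxChart Ω ι Ψ) :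
    ContinuousOn (fun x => conormSq g (Ψ x)) Ψ.source := fun x hx =>
  ((hasMFDerivAt_conormSq g (Ψ x)).1.continuousAt.comp
    (hΨ.mdifferentiableAt hx).continuousAt).continuousWithinAt

/-- The open disc bundle of radius the size of `V`, as far as it lies in the image of the Darboux
chart, is contained in `V`. -/
theorem mem_of_conormSq_lt_size (hV : IsInnerDarbouxNhd ι Ψ V) {x : M} (hx : x ∈ Ψ.source)
    (h : ENNReal.ofReal √(conormSq g (Ψ x)) < size g Ψ V) : x ∈ V := by
  by_contra hxV
  refine absurd h (not_lt.2 ?_)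
  refine iInf₂_le (Ψ x) ?_
  rintro ⟨y, hy, hyx⟩
  exact hxV (Ψ.injOn (hV.subset_source hy) hx hyx ▸ hy)

/-- A path that leaves the disc bundle `{|p| < r}`, with `r` less than the size of `V`, meets its
boundary before it leaves `V`. -/
theorem exists_first_exit (hΨ : IsDarbouxChart Ω ι Ψ) (hV : IsInnerDarbouxNhd ι Ψ V) {r : ℝ}
    (hr : 0 ≤ r) (hrV : ENNReal.ofReal r < size g Ψ V) {γ : ℝ → M} (hγ : ContinuousOn γ (Icc 0 1))
    (h0 : γ 0 ∈ V) (h0' : conormSq g (Ψ (γ 0)) < r ^ 2)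
    {t₁ : ℝ} (ht₁ : t₁ ∈ Icc (0 : ℝ) 1) (h1 : ¬(γ t₁ ∈ V ∧ conormSq g (Ψ (γ t₁)) < r ^ 2)) :
    ∃ b ∈ Icc (0 : ℝ) 1, (∀ t ∈ Icc 0 b, γ t ∈ V ∧ conormSq g (Ψ (γ t)) ≤ r ^ 2) ∧
      conormSq g (Ψ (γ b)) = r ^ 2 := by
  set D : Set M := {x | x ∈ V ∧ conormSq g (Ψ x) < r ^ 2} with hD
  have hDo : IsOpen D :=
    ((continuousOn_conormSq_darboux (g := g) hΨ).mono hV.subset_source).isOpen_inter_preimage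
      hV.isOpen isOpen_Iio
  have hclosed : IsClosed (Icc (0 : ℝ) 1 ∩ γ ⁻¹' Dᶜ) :=
    hγ.preimage_isClosed_of_isClosed isClosed_Icc hDo.isClosed_compl
  obtain ⟨b, ⟨hb, hbD⟩, hmin⟩ := (isCompact_Icc.of_isClosed_subset hclosed
    inter_subset_left).exists_isLeast ⟨t₁, ht₁, h1⟩
  have hlt : ∀ t ∈ Ico 0 b, γ t ∈ D := fun t ht => by
    by_contra h
    exact absurd (hmin ⟨⟨ht.1, ht.2.le.trans hb.2⟩, h⟩) (not_le.2 ht.2)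
  have hb0 : 0 < b := by
    rcases hb.1.eq_or_lt with h | h
    · exact absurd ⟨h0, h0'⟩ (h ▸ hbD)
    · exact h
  have hclos : ∀ {s : Set M}, (∀ t ∈ Ico 0 b, γ t ∈ s) → γ b ∈ closure s := fun {s} hs => by
    have hc : ContinuousWithinAt γ (Ico 0 b) b :=
      (hγ b hb).mono fun t ht => ⟨ht.1, ht.2.le.trans hb.2⟩
    refine hc.mem_closure ?_ hs
    rw [closure_Ico hb0.ne]
    exact right_mem_Icc.2 hb0.le
  have hbs : γ b ∈ Ψ.source := hV.closure_subset (hclos fun t ht => (hlt t ht).1)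
  have hle : conormSq g (Ψ (γ b)) ≤ r ^ 2 := by
    by_contra! h
    have hopen : IsOpen (Ψ.source ∩ (fun x => conormSq g (Ψ x)) ⁻¹' Ioi (r ^ 2)) :=
      (continuousOn_conormSq_darboux hΨ).isOpen_inter_preimage Ψ.open_source isOpen_Ioi
    obtain ⟨y, hy, hyD⟩ := mem_closure_iff.1 (hclos hlt) _ hopen ⟨hbs, h⟩
    exact absurd hy.2 (not_lt.2 hyD.2.le)
  have hbV : γ b ∈ V := by
    refine mem_of_conormSq_lt_size hV hbs (lt_of_le_of_lt (ENNReal.ofReal_le_ofReal ?_) hrV)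
    exact Real.sqrt_le_iff.2 ⟨hr, hle⟩
  refine ⟨b, hb, fun t ht => ?_, le_antisymm hle ?_⟩
  · rcases ht.2.eq_or_lt with h | h
    · exact h ▸ ⟨hbV, hle⟩
    · exact ⟨(hlt t ⟨ht.1, h⟩).1, (hlt t ⟨ht.1, h⟩).2.le⟩
  · by_contra! h
    exact hbD ⟨hbV, h⟩

theorem conormSq_zeroCovector (q : L) : conormSq g (zeroCovector q) = 0 := rfl

theorem conormSq_of_mem_range (hΨ : IsDarbouxChart Ω ι Ψ) {x : M} (hx : x ∈ range ι) :
    conormSq g (Ψ x) = 0 := by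
  obtain ⟨q, rfl⟩ := hx
  rw [hΨ.map_zero, conormSq_zeroCovector]

/-- A point at distance at most `m` from `L` lies in the disc bundle `{|p| ≤ m}`, provided that `m`
is less than the size of `V`. The path that realizes the distance may leave `V`, but only after
it has crossed the boundary of a slightly larger disc bundle, which takes too much length. -/
theorem mem_of_distToSet_le (hΨ : IsDarbouxChart Ω ι Ψ) (hV : IsInnerDarbouxNhd ι Ψ V)
    (hJ : IsSasakiOn g Ψ V J) {m : ℝ} (hm : 0 ≤ m) (hmV : ENNReal.ofReal m < size g Ψ V) {x : M}
    (hx : distToSet Ω J x (range ι) ≤ ENNReal.ofReal m) :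
    x ∈ V ∧ conormSq g (Ψ x) ≤ m ^ 2 := by
  have key : ∀ r : ℝ, m < r → ENNReal.ofReal r < size g Ψ V → x ∈ V ∧ conormSq g (Ψ x) < r ^ 2 := by
    intro r hmr hrV
    have hr : 0 < r := hm.trans_lt hmr
    have h1 : distToSet Ω J x (range ι) < ENNReal.ofReal r :=
      hx.trans_lt ((ENNReal.ofReal_lt_ofReal_iff hr).2 hmr)
    simp only [distToSet, iInf_lt_iff] at h1
    obtain ⟨y, hy, hxy⟩ := h1
    obtain ⟨γ, hγ0, hγ1, hγ, hlen⟩ := exists_path_of_dist_lt Ω J hxy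
    by_contra hcon
    have hN0 : conormSq g (Ψ (γ 0)) = 0 := by rw [hγ0]; exact conormSq_of_mem_range hΨ hy
    obtain ⟨b, hb, hbV, hbr⟩ := exists_first_exit hΨ hV hr.le hrV hγ.continuous.continuousOn
      (by rw [hγ0]; exact hV.subset hy) (by rw [hN0]; positivity) (right_mem_Icc.2 zero_le_one)
      (by rwa [hγ1])
    have h2 := sqrt_conormSq_le_length g hΨ hV.subset_source hJ hγ hb.1
      (fun t ht => (hbV t ht).1) hN0
    rw [hbr, Real.sqrt_sq hr.le] at h2
    exact absurd (h2.trans (lintegral_mono_set (Icc_subset_Icc_right hb.2))) (not_le.2 hlen)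
  -- letting `r` decrease to `m`
  obtain ⟨r₀, hr₀, hr₀'⟩ : ∃ r : ℝ, m < r ∧ ENNReal.ofReal r < size g Ψ V := by
    obtain ⟨c, hc1, hc2⟩ := ENNReal.lt_iff_exists_nnreal_btwn.1 hmV
    refine ⟨c, ?_, by rwa [ENNReal.ofReal_coe_nnreal]⟩
    rw [← ENNReal.ofReal_coe_nnreal, ENNReal.ofReal_lt_ofReal_iff'] at hc1
    exact hc1.1
  refine ⟨(key r₀ hr₀ hr₀').1, ?_⟩
  by_contra! hlt
  have h3 : m < √(conormSq g (Ψ x)) := Real.lt_sqrt_of_sq_lt hlt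
  set r := min r₀ (√(conormSq g (Ψ x))) with hr
  have h4 := (key r (lt_min hr₀ h3)
    (lt_of_le_of_lt (ENNReal.ofReal_le_ofReal (min_le_left _ _)) hr₀')).2
  have h5 : r ^ 2 ≤ conormSq g (Ψ x) := by
    rw [← Real.sq_sqrt (conormSq_nonneg g (Ψ x))]
    exact pow_le_pow_left₀ (hm.trans (lt_min hr₀ h3).le) (min_le_right _ _) 2
  linarith

theorem conormSq_fibrePath (ξ : Cotangent F L) (t : ℝ) :
    conormSq g (fibrePath ξ t) = (1 - t) ^ 2 * conormSq g ξ := by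
  have h1 : modelSharp g ξ.proj ((1 - t) • modelCovector ξ) =
      (1 - t) • modelSharp g ξ.proj (modelCovector ξ) :=
    map_smul (LinearEquiv.ofBijective (g.inner ξ.proj).toLinearMap (flat_bijective g ξ.proj)).symm _ _
  have h2 : conormSq g (fibrePath ξ t) = ((1 - t) • modelCovector ξ)
    (modelSharp g ξ.proj ((1 - t) • modelCovector ξ)) := rfl
  rw [h2, h1, conormSq]
  simp only [smul_apply, map_smul, smul_eq_mul]
  ring

/-- A point of `V` in the disc bundle `{|p| ≤ m}` is at distance at most `m` from `L`, provided that
`m` is less than the size of `V`: the fibre through it has length `|p|`. -/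
theorem distToSet_le_of_conormSq_le (hΨ : IsDarbouxChart Ω ι Ψ) (hV : IsInnerDarbouxNhd ι Ψ V)
    (hJ : IsSasakiOn g Ψ V J) {m : ℝ} (hm : 0 ≤ m) (hmV : ENNReal.ofReal m < size g Ψ V) {x : M}
    (hx : x ∈ V) (hxm : conormSq g (Ψ x) ≤ m ^ 2) :
    distToSet Ω J x (range ι) ≤ ENNReal.ofReal m := by
  have hmem : ∀ t ∈ Icc (0 : ℝ) 1, fibrePath (Ψ x) t ∈ Ψ '' V := fun t ht => by
    by_contra h
    refine absurd hmV (not_lt.2 ((iInf₂_le (fibrePath (Ψ x) t) h).trans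
      (ENNReal.ofReal_le_ofReal ?_)))
    rw [conorm_eq_sqrt, conormSq_fibrePath]
    refine Real.sqrt_le_iff.2 ⟨hm, ?_⟩
    have h1 : (1 - t) ^ 2 ≤ 1 := by nlinarith [ht.1, ht.2]
    nlinarith [conormSq_nonneg g (Ψ x)]
  have hVt : ∀ t ∈ Icc (0 : ℝ) 1, fibrePath (Ψ x) t ∈ Ψ.target ∧ Ψ.symm (fibrePath (Ψ x) t) ∈ V ∧
      Ψ (Ψ.symm (fibrePath (Ψ x) t)) = fibrePath (Ψ x) t := fun t ht => by
    obtain ⟨y, hy, hyt⟩ := hmem t ht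
    have hys := hV.subset_source hy
    rw [← hyt]
    exact ⟨Ψ.map_source hys, by rwa [Ψ.left_inv hys], by rw [Ψ.left_inv hys]⟩
  set γ : ℝ → M := fun t => Ψ.symm (fibrePath (Ψ x) t) with hγ
  have hγs : ∀ t ∈ Icc (0 : ℝ) 1, ContMDiffAt 𝓘(ℝ, ℝ) 𝓘(ℝ, E) 1 γ t := fun t ht =>
    ((hΨ.smooth_symm.contMDiffAt (Ψ.open_target.mem_nhds (hVt t ht).1)).of_le (by simp)).comp t
      (contMDiff_fibrePath (Ψ x) t)
  have h1 : γ 1 = ι (Ψ x).proj := by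
    have h2 : fibrePath (Ψ x) 1 = Ψ (ι (Ψ x).proj) := by
      rw [hΨ.map_zero]
      simp [fibrePath, zeroCovector]
    rw [hγ]
    simp only
    rw [h2, Ψ.left_inv (hΨ.mem_source _)]
  have h0 : γ 0 = x := by
    have h2 : fibrePath (Ψ x) 0 = Ψ x := by simp [fibrePath, covector]
    rw [hγ]
    simp only
    rw [h2, Ψ.left_inv (hV.subset_source hx)]
  refine (iInf₂_le (ι (Ψ x).proj) (mem_range_self _)).trans ?_
  refine dist_le_of_path Ω J (fun t ht => (hγs t ht).contMDiffWithinAt) h0 h1 fun t ht => ?_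
  have ht' := Ioo_subset_Icc_self ht
  refine ENNReal.ofReal_le_ofReal (Real.sqrt_le_iff.2 ⟨hm, ?_⟩)
  rw [metricSq_sasaki hΨ hV.subset_source hJ (x := γ t) (hVt t ht').2.1, ← cotangentDeriv_darboux hΨ
    ((hγs t ht').mdifferentiableAt one_ne_zero) (hV.subset_source (hVt t ht').2.1),
    show Ψ (γ t) = fibrePath (Ψ x) t from (hVt t ht').2.2]
  have hev : (fun w => Ψ (γ w)) =ᶠ[𝓝 t] fibrePath (Ψ x) := by
    filter_upwards [Icc_mem_nhds ht.1 ht.2] with s hs using (hVt s hs).2.2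
  have hdv : cotangentDeriv (fun w => Ψ (γ w)) t 1 = (0, -modelCovector (Ψ x)) :=
    (DFunLike.congr_fun hev.mfderiv_eq 1).trans (cotangentDeriv_fibrePath (Ψ x) t)
  rw [hdv, liouville_sasakiJ]
  have hK : connectionMap (F := F) g (fibrePath (Ψ x) t) (0, -modelCovector (Ψ x)) =
      -modelCovector (Ψ x) := by
    rw [connectionMap_eq, christoffel_zero, sub_zero]
  rw [hK]
  have hneg : modelSharp g (Ψ x).proj (-modelCovector (Ψ x)) =
      -modelSharp g (Ψ x).proj (modelCovector (Ψ x)) :=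
    map_neg (LinearEquiv.ofBijective (g.inner (Ψ x).proj).toLinearMap
      (flat_bijective g (Ψ x).proj)).symm _
  have hfin : modelInner g (fibrePath (Ψ x) t).proj 0 0 + (-modelCovector (Ψ x))
      (modelSharp g (fibrePath (Ψ x) t).proj (-modelCovector (Ψ x))) = conormSq g (Ψ x) := by
    change modelInner g (Ψ x).proj 0 0 + (-modelCovector (Ψ x))
      (modelSharp g (Ψ x).proj (-modelCovector (Ψ x))) = _
    rw [hneg]
    simp [conormSq]
  exact hfin.le.trans hxm

end DarbouxNhd

/-! ### Local energy bounds for holomorphic strips -/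

section LocalEnergy

variable {E : Type*} [NormedAddCommGroup E] [NormedSpace ℝ E]
  {M : Type*} [TopologicalSpace M] [ChartedSpace E M] [IsManifold 𝓘(ℝ, E) ∞ M]
  {Ω : DiffForm 𝓘(ℝ, E) (N := M) 2}
  {J : ∀ x : M, TangentSpace 𝓘(ℝ, E) x →L[ℝ] TangentSpace 𝓘(ℝ, E) x}

variable (J) in
/-- The expression of `J` in the preferred chart around `y`. -/
def chartStructure (y : M) (w : E) : E →L[ℝ] E :=
  ContinuousLinearMap.inCoordinates E (fun x : M => TangentSpace 𝓘(ℝ, E) x) E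
    (fun x : M => TangentSpace 𝓘(ℝ, E) x) y ((extChartAt 𝓘(ℝ, E) y).symm w) y
    ((extChartAt 𝓘(ℝ, E) y).symm w) (J ((extChartAt 𝓘(ℝ, E) y).symm w))

theorem chartFrame_chartStructure {y : M} {w : E} (hw : w ∈ (extChartAt 𝓘(ℝ, E) y).target) (u : E) :
    chartFrame y w (chartStructure J y w u) =
      modelStructure J ((extChartAt 𝓘(ℝ, E) y).symm w) (chartFrame y w u) := by
  have hx : (extChartAt 𝓘(ℝ, E) y).symm w ∈ (chartAt E y).source := by
    have := (extChartAt 𝓘(ℝ, E) y).map_target hw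
    rwa [extChartAt_source] at this
  have hb : (extChartAt 𝓘(ℝ, E) y).symm w ∈
      (trivializationAt E (TangentSpace 𝓘(ℝ, E)) y).baseSet := by simpa using hx
  have h1 : ∀ u : E, (trivializationAt E (TangentSpace 𝓘(ℝ, E)) y).symmL ℝ
      ((extChartAt 𝓘(ℝ, E) y).symm w) u = chartFrame y w u := fun u => by
    rw [symmL_trivializationAt_eq_chartFrame hx, (extChartAt 𝓘(ℝ, E) y).right_inv hw]
  rw [← h1, ← h1]
  exact Trivialization.symmL_continuousLinearMapAt _ hb _

theorem chartFrame_injective {y : M} {w : E} (hw : w ∈ (extChartAt 𝓘(ℝ, E) y).target) :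
    Function.Injective (chartFrame y w : E → E) := by
  have hx : (extChartAt 𝓘(ℝ, E) y).symm w ∈ (chartAt E y).source := by
    have := (extChartAt 𝓘(ℝ, E) y).map_target hw
    rwa [extChartAt_source] at this
  obtain ⟨B, -, hB⟩ := exists_chartFrame_inverse hx
  rw [(extChartAt 𝓘(ℝ, E) y).right_inv hw] at hB
  exact Function.LeftInverse.injective hB

theorem contDiffAt_chartStructure (hJ : IsCompatible Ω J) (y : M) :
    ContDiffAt ℝ ∞ (chartStructure J y) (extChartAt 𝓘(ℝ, E) y y) := by
  have h2 := ((contMDiffAt_hom_bundle _).1 (hJ.smooth y)).2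
  have h3 : ContMDiffAt 𝓘(ℝ, E) 𝓘(ℝ, E) ∞ (extChartAt 𝓘(ℝ, E) y).symm (extChartAt 𝓘(ℝ, E) y y) :=
    (contMDiffOn_extChartAt_symm y).contMDiffAt
      ((isOpen_extChartAt_target y).mem_nhds (mem_extChartAt_target y))
  exact contMDiffAt_iff_contDiffAt.1 (ContMDiffAt.comp_of_eq h2 h3 (extChartAt_to_inv y))

theorem IsCompatible.metricSq_pos (hJ : IsCompatible Ω J) (x : M) {u : E} (hu : u ≠ 0) :
    0 < metricSq Ω J x u := hJ.pos x u hu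

variable [FiniteDimensional ℝ E]

/-- Near a point, the metric `Ω(·, J ·)` dominates the norm of the coordinates. -/
theorem exists_metricSq_lower_bound (hΩ : Ω.IsSmooth) (hJ : IsCompatible Ω J) (y : M) :
    ∃ r : ℝ, 0 < r ∧ ∃ c : ℝ, 0 < c ∧ ∀ w ∈ Metric.closedBall (extChartAt 𝓘(ℝ, E) y y) r, ∀ u : E,
      c * ‖u‖ ^ 2 ≤ metricSq Ω J ((extChartAt 𝓘(ℝ, E) y).symm w) (chartFrame y w u) := by
  set y₀ := extChartAt 𝓘(ℝ, E) y y with hy₀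
  have hto : (extChartAt 𝓘(ℝ, E) y).target ∈ 𝓝 y₀ :=
    (isOpen_extChartAt_target y).mem_nhds (mem_extChartAt_target y)
  have hJc : ∀ᶠ w in 𝓝 y₀, ContinuousAt (chartStructure J y) w := by
    have h := ((contDiffAt_chartStructure hJ y).of_le (m := 1) (by simp)).eventually (by simp)
    filter_upwards [h] with w hw using hw.continuousAt
  obtain ⟨r, hr, hball⟩ := Metric.nhds_basis_closedBall.mem_iff.1 (inter_mem hto hJc)
  have hcont : ContinuousOn (fun p : E × E => Ω.inChart 𝓘(ℝ, E) y p.1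
      ![p.2, chartStructure J y p.1 p.2]) (Metric.closedBall y₀ r ×ˢ Metric.sphere 0 1) := by
    have h1 : ContinuousOn (fun p : E × E => Ω.inChart 𝓘(ℝ, E) y p.1)
        (Metric.closedBall y₀ r ×ˢ Metric.sphere 0 1) :=
      (hΩ y).continuousOn.comp continuousOn_fst fun p hp => (hball hp.1).1
    have h2 : ContinuousOn (fun p : E × E => chartStructure J y p.1)
        (Metric.closedBall y₀ r ×ˢ Metric.sphere 0 1) := fun p hp =>
      (ContinuousAt.comp (f := Prod.fst) (hball hp.1).2 continuousAt_fst).continuousWithinAt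
    have h3 := h2.clm_apply continuousOn_snd
    have h4 : ContinuousOn (fun p : E × E => (![p.2, chartStructure J y p.1 p.2] : Fin 2 → E))
        (Metric.closedBall y₀ r ×ˢ Metric.sphere 0 1) := by
      refine continuousOn_pi.2 fun i => ?_
      fin_cases i
      · exact continuousOn_snd
      · exact h3
    exact h1.eval h4
  have hval : ∀ w ∈ Metric.closedBall y₀ r, ∀ u, Ω.inChart 𝓘(ℝ, E) y w ![u, chartStructure J y w u] =
      metricSq Ω J ((extChartAt 𝓘(ℝ, E) y).symm w) (chartFrame y w u) := fun w hw u => by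
    rw [inChart_apply, chartFrame_chartStructure (hball hw).1, metricSq]
  obtain ⟨c, hc, hmin⟩ := ((isCompact_closedBall y₀ r).prod (isCompact_sphere 0 1)).exists_forall_le'
    hcont (a := 0) (fun p hp => by
      rw [hval p.1 hp.1]
      refine hJ.metricSq_pos _ fun h0 => ?_
      have h1 : p.2 = 0 := chartFrame_injective (hball hp.1).1 (h0.trans (map_zero _).symm)
      have h2 := hp.2
      simp [h1] at h2)
  refine ⟨r, hr, c, hc, fun w hw u => ?_⟩
  -- both sides are homogeneous of degree two in `u`
  by_cases hu : u = 0
  · subst hu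
    have h1 : ∀ x : M, metricSq Ω J x (chartFrame y w 0) = 0 := fun x => by
      rw [map_zero, metricSq, map_zero]
      simpa using modelForm_smul Ω x 0 (0 : E) 0
    rw [h1]
    simp
  have hun : 0 < ‖u‖ := norm_pos_iff.2 hu
  have h1 := hmin (w, ‖u‖⁻¹ • u) ⟨hw, by simp [norm_smul, hun.ne']⟩
  rw [hval w hw, metricSq, map_smul, map_smul, modelForm_smul, ← metricSq] at h1
  rw [inv_pow, ← div_eq_inv_mul, le_div_iff₀ (by positivity)] at h1
  exact h1

/-- A strip that is holomorphic over the open set `U`, has its boundary outside of `U`, and passes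
through a point near `y ∈ U` with non-zero derivative, has a definite amount of area. -/
theorem exists_area_lower_bound [T2Space M] (hΩ : Ω.IsSmooth) (hJ : IsCompatible Ω J) {U : Set M}
    (hU : IsOpen U) {y : M} (hy : y ∈ U) :
    ∃ N ∈ 𝓝 y, ∃ c : ℝ, 0 < c ∧ ∀ v : ℝ × ℝ → M, ContMDiffOn 𝓘(ℝ, ℝ × ℝ) 𝓘(ℝ, E) ∞ v strip →
      (∀ z : ℝ × ℝ, z.2 ∈ Ioo (0 : ℝ) 1 → v z ∈ U →
        modelDeriv v z (1, 0) + modelStructure J (v z) (modelDeriv v z (0, 1)) = 0) →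
      (∀ τ, v (τ, 0) ∉ U) → (∀ τ, v (τ, 1) ∉ U) →
      ∀ z₀ : ℝ × ℝ, z₀.2 ∈ Ioo (0 : ℝ) 1 → v z₀ ∈ N → modelDeriv (E := E) v z₀ (0, 1) ≠ 0 →
        ENNReal.ofReal c ≤ area Ω v := by
  set φ := extChartAt 𝓘(ℝ, E) y with hφ
  set y₀ := φ y with hy₀
  obtain ⟨r₁, hr₁, c₁, hc₁, hlow⟩ := exists_metricSq_lower_bound hΩ hJ y
  have hto : φ.target ∈ 𝓝 y₀ := (isOpen_extChartAt_target y).mem_nhds (mem_extChartAt_target y)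
  have hUn : φ.symm ⁻¹' U ∈ 𝓝 y₀ := by
    refine (continuousAt_extChartAt_symm y).preimage_mem_nhds ?_
    rw [extChartAt_to_inv]
    exact hU.mem_nhds hy
  have hJs : ∀ᶠ w in 𝓝 y₀, ContDiffAt ℝ 1 (chartStructure J y) w :=
    ((contDiffAt_chartStructure hJ y).of_le (m := 1) (by simp)).eventually (by simp)
  obtain ⟨r, hr, hball⟩ := Metric.nhds_basis_ball.mem_iff.1
    (inter_mem (inter_mem hto hUn) (inter_mem hJs (Metric.closedBall_mem_nhds y₀ hr₁)))
  set W := Metric.ball y₀ r with hW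
  have hJJ : ∀ w ∈ W, ∀ u, chartStructure J y w (chartStructure J y w u) = -u := fun w hw u => by
    refine chartFrame_injective (hball hw).1.1 ?_
    rw [chartFrame_chartStructure (hball hw).1.1, chartFrame_chartStructure (hball hw).1.1, map_neg]
    exact hJ.sq _ _
  obtain ⟨R, hR, c, hc, hmain⟩ := exists_energy_lower_bound_of_cauchyRiemann Metric.isOpen_ball
    (fun w hw => ContDiffAt.contDiffWithinAt (hball hw).2.1) hJJ (Metric.mem_ball_self hr)
  have hopen : ∀ ρ : ℝ, IsOpen (φ.source ∩ φ ⁻¹' Metric.ball y₀ ρ) := fun ρ =>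
    (continuousOn_extChartAt y).isOpen_inter_preimage (isOpen_extChartAt_source y)
      Metric.isOpen_ball
  refine ⟨(φ.source ∩ φ ⁻¹' W) ∩ (φ.source ∩ φ ⁻¹' Metric.ball y₀ R), inter_mem
    ((hopen r).mem_nhds ⟨mem_extChartAt_source y, Metric.mem_ball_self hr⟩)
    ((hopen R).mem_nhds ⟨mem_extChartAt_source y, Metric.mem_ball_self hR⟩), c₁ * c,
    mul_pos hc₁ hc, fun v hv hCR hb0 hb1 z₀ hz₀ hvz₀ hne => ?_⟩
  set O : Set (ℝ × ℝ) := {z | z.2 ∈ Ioo (0 : ℝ) 1} ∩ v ⁻¹' (φ.source ∩ φ ⁻¹' W) with hOdef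
  have hvc : ContinuousOn v strip := hv.continuousOn
  have hO : IsOpen O := (hvc.mono interior_strip_subset).isOpen_inter_preimage
    isOpen_interior_strip (hopen r)
  have hOs : O ⊆ strip := inter_subset_left.trans interior_strip_subset
  have hvs : ∀ z ∈ O, ContMDiffAt 𝓘(ℝ, ℝ × ℝ) 𝓘(ℝ, E) ∞ v z := fun z hz =>
    hv.contMDiffAt (strip_mem_nhds hz.1)
  have hchart : ∀ z ∈ O, v z ∈ (chartAt E y).source := fun z hz => by
    have := hz.2.1
    rwa [hφ, extChartAt_source] at this
  have hOU : ∀ z ∈ O, v z ∈ U := fun z hz => by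
    have := (hball hz.2.2).1.2
    rwa [mem_preimage, φ.left_inv hz.2.1] at this
  set w : ℝ × ℝ → E := fun z => φ (v z) with hw
  have hws : ∀ z ∈ O, ContDiffAt ℝ 2 w z := fun z hz => by
    rw [← contMDiffAt_iff_contDiffAt]
    exact ((contMDiffAt_extChartAt' (hchart z hz)).of_le le_rfl).comp z
      ((hvs z hz).of_le (WithTop.coe_le_coe.2 (le_top : (2 : ℕ∞) ≤ ⊤)))
  have hdv : ∀ z ∈ O, ∀ e, modelDeriv v z e = chartFrame y (w z) (fderiv ℝ w z e) := fun z hz e =>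
    mfderiv_eq_chartFrame y ((hvs z hz).mdifferentiableAt (by simp)) (hchart z hz) e
  have hback : ∀ z ∈ O, φ.symm (w z) = v z := fun z hz => φ.left_inv hz.2.1
  have hCR' : ∀ z ∈ O, fderiv ℝ w z (1, 0) + chartStructure J y (w z) (fderiv ℝ w z (0, 1)) = 0 :=
    fun z hz => by
    refine chartFrame_injective (hball hz.2.2).1.1 ?_
    rw [map_add, map_zero, chartFrame_chartStructure (hball hz.2.2).1.1, ← hφ]
    change chartFrame y (w z) _ + modelStructure J (φ.symm (w z)) (chartFrame y (w z) _) = 0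
    rw [hback z hz, ← hdv z hz, ← hdv z hz]
    exact hCR z hz.1 (hOU z hz)
  -- properness: the boundary of the strip stays outside of `U`
  have hproper : ∀ K ⊆ W, IsCompact K → IsClosed {z | z ∈ O ∧ w z ∈ K} := fun K hK hKc => by
    have hKt : K ⊆ φ.target := fun x hx => (hball (hK hx)).1.1
    have hKc' : IsClosed (φ.symm '' K) :=
      (hKc.image_of_continuousOn ((continuousOn_extChartAt_symm y).mono hKt)).isClosed
    have hKU : φ.symm '' K ⊆ U := by
      rintro _ ⟨x, hx, rfl⟩
      exact (hball (hK hx)).1.2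
    have heq : {z | z ∈ O ∧ w z ∈ K} = strip ∩ v ⁻¹' (φ.symm '' K) := by
      ext z
      refine ⟨fun hz => ⟨hOs hz.1, w z, hz.2, hback z hz.1⟩, ?_⟩
      rintro ⟨hz, x, hx, hxz⟩
      have h1 : w z = x := by rw [hw]; simp only; rw [← hxz, φ.right_inv (hKt hx)]
      have h2 : z.2 ∈ Ioo (0 : ℝ) 1 := by
        have h3 : v z ∈ U := hKU ⟨x, hx, hxz⟩
        refine ⟨lt_of_le_of_ne hz.2.1 fun h => hb0 z.1 ?_, lt_of_le_of_ne hz.2.2 fun h => hb1 z.1 ?_⟩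
        · rw [h]; exact h3
        · rw [← h]; exact h3
      refine ⟨⟨h2, ?_, ?_⟩, h1 ▸ hx⟩
      · rw [← hxz]; exact φ.map_target (hKt hx)
      · change w z ∈ W
        rw [h1]
        exact hK hx
    rw [heq]
    have hstrip : IsClosed strip := isClosed_univ.prod isClosed_Icc
    exact hvc.preimage_isClosed_of_isClosed hstrip hKc'
  have hz₀O : z₀ ∈ O := ⟨hz₀, hvz₀.1⟩
  have hen := hmain O w z₀ hO hOs hws (fun z hz => hz.2.2) hCR' hproper hz₀O hvz₀.2.2
    (fun h => hne (by rw [hdv z₀ hz₀O, h, map_zero]))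
  have hpt : ∀ z ∈ O, ENNReal.ofReal c₁ * ENNReal.ofReal (‖fderiv ℝ w z (1, 0)‖ ^ 2) ≤
      ENNReal.ofReal (Ω (v z) ![partialDeriv (E := E) v (1, 0) z,
        partialDeriv (E := E) v (0, 1) z]) := fun z hz => by
    have h1 : modelStructure J (v z) (modelDeriv v z (1, 0)) = modelDeriv v z (0, 1) := by
      rw [eq_neg_of_add_eq_zero_left (hCR z hz.1 (hOU z hz)), map_neg]
      exact neg_eq_iff_eq_neg.2 (hJ.sq _ _)
    rw [partialDeriv_eq_modelDeriv v _ hz.1, partialDeriv_eq_modelDeriv v _ hz.1, ← h1,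
      ← ENNReal.ofReal_mul hc₁.le]
    refine ENNReal.ofReal_le_ofReal ((hlow (w z) (hball hz.2.2).2.2 (fderiv ℝ w z (1, 0))).trans ?_)
    rw [← hdv z hz, ← hφ, hback z hz]
    exact le_rfl
  calc ENNReal.ofReal (c₁ * c) = ENNReal.ofReal c₁ * ENNReal.ofReal c := ENNReal.ofReal_mul hc₁.le
    _ ≤ ENNReal.ofReal c₁ * ∫⁻ z in O, ENNReal.ofReal (‖fderiv ℝ w z (1, 0)‖ ^ 2) := by gcongr
    _ = ∫⁻ z in O, ENNReal.ofReal c₁ * ENNReal.ofReal (‖fderiv ℝ w z (1, 0)‖ ^ 2) :=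
        (lintegral_const_mul' _ _ ENNReal.ofReal_ne_top).symm
    _ ≤ ∫⁻ z in O, ENNReal.ofReal (Ω (v z) ![partialDeriv (E := E) v (1, 0) z,
        partialDeriv (E := E) v (0, 1) z]) := setLIntegral_mono' hO.measurableSet hpt
    _ ≤ area Ω v := lintegral_mono_set hOs

/-- The area bound of `exists_area_lower_bound`, uniformly over a compact subset of `U`. -/
theorem exists_area_lower_bound_of_isCompact [T2Space M] (hΩ : Ω.IsSmooth) (hJ : IsCompatible Ω J)
    {U : Set M} (hU : IsOpen U) {K : Set M} (hK : IsCompact K) (hKU : K ⊆ U) :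
    ∃ c : ℝ, 0 < c ∧ ∀ v : ℝ × ℝ → M, ContMDiffOn 𝓘(ℝ, ℝ × ℝ) 𝓘(ℝ, E) ∞ v strip →
      (∀ z : ℝ × ℝ, z.2 ∈ Ioo (0 : ℝ) 1 → v z ∈ U →
        modelDeriv v z (1, 0) + modelStructure J (v z) (modelDeriv v z (0, 1)) = 0) →
      (∀ τ, v (τ, 0) ∉ U) → (∀ τ, v (τ, 1) ∉ U) →
      ∀ z₀ : ℝ × ℝ, z₀.2 ∈ Ioo (0 : ℝ) 1 → v z₀ ∈ K → modelDeriv (E := E) v z₀ (0, 1) ≠ 0 →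
        ENNReal.ofReal c ≤ area Ω v := by
  refine hK.induction_on (p := fun S => ∃ c : ℝ, 0 < c ∧ ∀ v : ℝ × ℝ → M,
    ContMDiffOn 𝓘(ℝ, ℝ × ℝ) 𝓘(ℝ, E) ∞ v strip →
      (∀ z : ℝ × ℝ, z.2 ∈ Ioo (0 : ℝ) 1 → v z ∈ U →
        modelDeriv v z (1, 0) + modelStructure J (v z) (modelDeriv v z (0, 1)) = 0) →
      (∀ τ, v (τ, 0) ∉ U) → (∀ τ, v (τ, 1) ∉ U) →
      ∀ z₀ : ℝ × ℝ, z₀.2 ∈ Ioo (0 : ℝ) 1 → v z₀ ∈ S → modelDeriv (E := E) v z₀ (0, 1) ≠ 0 →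
        ENNReal.ofReal c ≤ area Ω v) ?_ ?_ ?_ ?_
  · exact ⟨1, one_pos, fun _ _ _ _ _ _ _ h => h.elim⟩
  · rintro S T hST ⟨c, hc, h⟩
    exact ⟨c, hc, fun v hv hCR h0 h1 z hz hvz => h v hv hCR h0 h1 z hz (hST hvz)⟩
  · rintro S T ⟨c, hc, h⟩ ⟨c', hc', h'⟩
    refine ⟨min c c', lt_min hc hc', fun v hv hCR h0 h1 z hz hvz hne => ?_⟩
    rcases hvz with hvz | hvz
    · exact (ENNReal.ofReal_le_ofReal (min_le_left _ _)).trans (h v hv hCR h0 h1 z hz hvz hne)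
    · exact (ENNReal.ofReal_le_ofReal (min_le_right _ _)).trans (h' v hv hCR h0 h1 z hz hvz hne)
  · intro y hy
    obtain ⟨N, hN, c, hc, h⟩ := exists_area_lower_bound hΩ hJ hU (hKU hy)
    exact ⟨N, mem_nhdsWithin_of_mem_nhds hN, c, hc, h⟩

end LocalEnergy

/-! ### Confined strips and escaping strips -/

section Strips

variable {E : Type*} [NormedAddCommGroup E] [NormedSpace ℝ E]
  {M : Type*} [TopologicalSpace M] [ChartedSpace E M]
  {F : Type*} [NormedAddCommGroup F] [NormedSpace ℝ F]
  {L : Type*} [TopologicalSpace L] [ChartedSpace F L] [IsManifold 𝓘(ℝ, F) ∞ L]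
  {Ω : DiffForm 𝓘(ℝ, E) (N := M) 2} {ι : L → M}
  {Ψ : OpenPartialHomeomorph M (Cotangent F L)} {V : Set M}
  {J : ∀ x : M, TangentSpace 𝓘(ℝ, E) x →L[ℝ] TangentSpace 𝓘(ℝ, E) x}

theorem IsHolomorphicStrip.add_eq_zero {L₀ L₁ : Set M} {v : ℝ × ℝ → M}
    (hv : IsHolomorphicStrip J L₀ L₁ v) {z : ℝ × ℝ} (hz : z.2 ∈ Ioo (0 : ℝ) 1) :
    modelDeriv v z (1, 0) + modelStructure J (v z) (modelDeriv v z (0, 1)) = 0 := by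
  rw [← partialDeriv_eq_modelDeriv v _ hz, ← partialDeriv_eq_modelDeriv v _ hz]
  exact hv.cauchyRiemann z (interior_strip_subset hz)

theorem IsHolomorphicStrip.contMDiffAt {L₀ L₁ : Set M} {v : ℝ × ℝ → M}
    (hv : IsHolomorphicStrip J L₀ L₁ v) {z : ℝ × ℝ} (hz : z.2 ∈ Ioo (0 : ℝ) 1) :
    ContMDiffAt 𝓘(ℝ, ℝ × ℝ) 𝓘(ℝ, E) ∞ v z :=
  hv.smooth.contMDiffAt (strip_mem_nhds hz)

/-- A map that pulls a form back to a nondegenerate form is an immersion. -/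
theorem IsSymplectic.darbouxDeriv_injective (hΩ : IsSymplectic Ω) (hΨ : IsDarbouxChart Ω ι Ψ) {x : M}
    (hx : x ∈ Ψ.source) : Function.Injective (darbouxDeriv (E := E) Ψ x) := by
  refine (injective_iff_map_eq_zero _).2 fun u hu => hΩ.nondegenerate x u fun w => ?_
  have h1 := (extDeriv_liouville (Ψ x) (darbouxDeriv (E := E) Ψ x u)
    (darbouxDeriv (E := E) Ψ x w))
  rw [hu] at h1
  have h2 := hΨ.symplectic x hx u w
  rw [← h2]
  refine neg_eq_zero.2 ?_
  have h3 : mfderiv 𝓘(ℝ, E) (cotangentModel F) Ψ x u = (0 : F × (F →L[ℝ] ℝ)) := hu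
  rw [h3]
  refine h1.trans ?_
  simp

variable [FiniteDimensional ℝ F] {g : Metric F L}

/-- The Sasaki structure determines the almost complex structure on `V`. -/
theorem IsSasakiOn.modelStructure_eq (hΩ : IsSymplectic Ω) (hΨ : IsDarbouxChart Ω ι Ψ)
    (hVs : V ⊆ Ψ.source) {J' : ∀ x : M, TangentSpace 𝓘(ℝ, E) x →L[ℝ] TangentSpace 𝓘(ℝ, E) x}
    (hJ : IsSasakiOn g Ψ V J) (hJ' : IsSasakiOn g Ψ V J') {x : M} (hx : x ∈ V) (u : E) :
    modelStructure J x u = modelStructure J' x u :=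
  hΩ.darbouxDeriv_injective hΨ (hVs hx)
    ((hJ.darbouxDeriv_eq hx u).trans (hJ'.darbouxDeriv_eq hx u).symm)

/-- A holomorphic strip inside `V` lies in the disc bundle `{|p|² ≤ m}` if its boundary does: the
function `|p|²` is bounded and subharmonic along the strip. -/
theorem IsHolomorphicStrip.conormSq_le (hΨ : IsDarbouxChart Ω ι Ψ) (hV : IsInnerDarbouxNhd ι Ψ V)
    (hJ : IsSasakiOn g Ψ V J) (hJJ : ∀ (x : M) (u : E), modelStructure J x (modelStructure J x u) = -u)
    {L₀ L₁ : Set M} {v : ℝ × ℝ → M} (hv : IsHolomorphicStrip J L₀ L₁ v) (hvV : v '' strip ⊆ V)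
    {m : ℝ} (h0 : ∀ τ, conormSq g (Ψ (v (τ, 0))) ≤ m) (h1 : ∀ τ, conormSq g (Ψ (v (τ, 1))) ≤ m) :
    ∀ z ∈ strip, conormSq g (Ψ (v z)) ≤ m := by
  have hmem : ∀ z ∈ strip, v z ∈ V := fun z hz => hvV (mem_image_of_mem v hz)
  obtain ⟨B, hB⟩ := (hV.isCompact_closure.image_of_continuousOn
    ((continuousOn_conormSq_darboux (g := g) hΨ).mono hV.closure_subset)).bddAbove
  refine le_of_lap_nonneg_of_boundary (B := B) ?_ (fun z hz => ?_) (fun z hz => ?_) (fun z hz => ?_)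
    h0 h1
  · exact (continuousOn_conormSq_darboux hΨ).comp hv.smooth.continuousOn fun z hz =>
      hV.subset_source (hmem z hz)
  · exact contDiffAt_conormSq_darboux (n := 2) hΨ ((hv.contMDiffAt hz).of_le
      (WithTop.coe_le_coe.2 (le_top : (2 : ℕ∞) ≤ ⊤)))
      (hV.subset_source (hmem z (interior_strip_subset hz)))
  · have hzV := hV.subset_source (hmem z (interior_strip_subset hz))
    have hW : ContMDiffAt 𝓘(ℝ, ℝ × ℝ) (cotangentModel F) ∞ (fun w => Ψ (v w)) z :=
      (hΨ.smooth.contMDiffAt (Ψ.open_source.mem_nhds hzV)).comp z (hv.contMDiffAt hz)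
    have hev : ∀ᶠ w in 𝓝 z, w ∈ {w : ℝ × ℝ | w.2 ∈ Ioo (0 : ℝ) 1} :=
      isOpen_interior_strip.mem_nhds hz
    have hd : ∀ w ∈ {w : ℝ × ℝ | w.2 ∈ Ioo (0 : ℝ) 1}, ∀ e,
        cotangentDeriv (fun w => Ψ (v w)) w e = darbouxDeriv (E := E) Ψ (v w) (modelDeriv v w e) :=
      fun w hw e => cotangentDeriv_darboux hΨ ((hv.contMDiffAt hw).mdifferentiableAt (by simp))
        (hV.subset_source (hmem w (interior_strip_subset hw))) e
    refine lap_conormSq_nonneg g (hW.of_le (WithTop.coe_le_coe.2 (le_top : (2 : ℕ∞) ≤ ⊤))) ?_ ?_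
    · filter_upwards [hev] with w hw
      rw [hd w hw, hd w hw, ← hJ.darbouxDeriv_eq (hmem w (interior_strip_subset hw)), ← map_neg,
        eq_neg_of_add_eq_zero_left (hv.add_eq_zero hw)]
    · filter_upwards [hev] with w hw
      rw [hd w hw, hd w hw, ← hJ.darbouxDeriv_eq (hmem w (interior_strip_subset hw)),
        eq_neg_of_add_eq_zero_left (hv.add_eq_zero hw), map_neg, hJJ, neg_neg]
  · exact hB (mem_image_of_mem _ (subset_closure (hmem z hz)))

/-- A strip with upper boundary on `L` that does not stay in `V` passes through the annulus
`{ρ₁ ≤ |p| ≤ ρ₂}`, at an interior point where its vertical derivative does not vanish. -/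
theorem IsHolomorphicStrip.exists_crossing (hΨ : IsDarbouxChart Ω ι Ψ)
    (hV : IsInnerDarbouxNhd ι Ψ V) (hJ : IsSasakiOn g Ψ V J) {L₀ : Set M} {v : ℝ × ℝ → M}
    (hv : IsHolomorphicStrip J L₀ (range ι) v) (hvV : ¬v '' strip ⊆ V) {ρ₁ ρ₂ : ℝ} (hρ₁ : 0 ≤ ρ₁)
    (hρ : ρ₁ < ρ₂) (hρ₂ : ENNReal.ofReal ρ₂ < size g Ψ V) :
    ∃ z : ℝ × ℝ, z.2 ∈ Ioo (0 : ℝ) 1 ∧ v z ∈ V ∧ ρ₁ ^ 2 ≤ conormSq g (Ψ (v z)) ∧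
      conormSq g (Ψ (v z)) ≤ ρ₂ ^ 2 ∧ modelDeriv (E := E) v z (0, 1) ≠ 0 := by
  obtain ⟨_, ⟨z₁, hz₁, rfl⟩, hz₁V⟩ := not_subset.1 hvV
  -- follow the vertical segment through `z₁` downwards, starting on `L`
  set ℓ : ℝ → ℝ × ℝ := fun t => (z₁.1, 1 - t) with hℓ
  have hℓc : Continuous ℓ := by fun_prop
  have hℓs : MapsTo ℓ (Icc 0 1) strip := fun t ht =>
    ⟨mem_univ _, by simp only [hℓ]; linarith [ht.2], by simp only [hℓ]; linarith [ht.1]⟩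
  have hγc : ContinuousOn (fun t => v (ℓ t)) (Icc 0 1) :=
    hv.smooth.continuousOn.comp hℓc.continuousOn hℓs
  have hγ0 : v (ℓ 0) ∈ range ι := by simpa [hℓ] using hv.top z₁.1
  have hN0 : conormSq g (Ψ (v (ℓ 0))) = 0 := conormSq_of_mem_range hΨ hγ0
  have hρ₂' : 0 < ρ₂ := hρ₁.trans_lt hρ
  obtain ⟨b, hb, hbV, hbr⟩ := exists_first_exit hΨ hV hρ₂'.le hρ₂ hγc (hV.subset hγ0)
    (by rw [hN0]; positivity) (t₁ := 1 - z₁.2) ⟨by linarith [hz₁.2.2], by linarith [hz₁.2.1]⟩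
    (by
      have h : ℓ (1 - z₁.2) = z₁ := by simp [hℓ]
      rw [h]
      exact fun h => hz₁V h.1)
  set h : ℝ → ℝ := fun t => conormSq g (Ψ (v (ℓ t))) with hh
  have hhc : ContinuousOn h (Icc 0 b) :=
    (continuousOn_conormSq_darboux hΨ).comp (hγc.mono (Icc_subset_Icc_right hb.2)) fun t ht =>
      hV.subset_source (hbV t ht).1
  -- `a` is the last time before `b` at which `|p| ≤ ρ₁`
  have hclosed : IsClosed (Icc 0 b ∩ h ⁻¹' Iic (ρ₁ ^ 2)) :=
    hhc.preimage_isClosed_of_isClosed isClosed_Icc isClosed_Iic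
  obtain ⟨a, ⟨ha, haρ⟩, hmax⟩ := (isCompact_Icc.of_isClosed_subset hclosed
    inter_subset_left).exists_isGreatest ⟨0, left_mem_Icc.2 hb.1, by
      change conormSq g (Ψ (v (ℓ 0))) ≤ _; rw [hN0]; positivity⟩
  have hsq : ρ₁ ^ 2 < ρ₂ ^ 2 := by nlinarith
  have haρ' : h a ≤ ρ₁ ^ 2 := haρ
  have hab : a < b := lt_of_le_of_ne ha.2 fun hab => by
    rw [hab] at haρ'
    exact absurd (hbr.symm.le.trans haρ') (not_le.2 hsq)
  have hint : ∀ t ∈ Ioo a b, (ℓ t).2 ∈ Ioo (0 : ℝ) 1 := fun t ht =>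
    ⟨by simp only [hℓ]; linarith [ht.2, hb.2], by simp only [hℓ]; linarith [ht.1, ha.1]⟩
  have htI : ∀ t ∈ Ioo a b, t ∈ Icc 0 b := fun t ht => ⟨ha.1.trans ht.1.le, ht.2.le⟩
  have hder : ∀ t ∈ Ioo a b, HasDerivAt h
      (fderiv ℝ (fun w => conormSq g (Ψ (v w))) (ℓ t) (0, -1)) t := fun t ht => by
    have h1 : DifferentiableAt ℝ (fun w => conormSq g (Ψ (v w))) (ℓ t) :=
      (contDiffAt_conormSq_darboux (n := 1) hΨ ((hv.contMDiffAt (hint t ht)).of_le (by simp))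
        (hV.subset_source (hbV t (htI t ht)).1)).differentiableAt one_ne_zero
    have h2 : HasDerivAt ℓ ((0 : ℝ), (-1 : ℝ)) t :=
      (hasDerivAt_const t z₁.1).prodMk ((hasDerivAt_id' t).const_sub 1)
    exact h1.hasFDerivAt.comp_hasDerivAt t h2
  obtain ⟨c, hc, hcd⟩ := exists_hasDerivAt_eq_slope h _ hab
    (hhc.mono (Icc_subset_Icc_left ha.1)) hder
  refine ⟨ℓ c, hint c hc, (hbV c (htI c hc)).1, ?_, (hbV c (htI c hc)).2, fun hzero => ?_⟩
  · by_contra! hlt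
    exact absurd (hmax ⟨htI c hc, hlt.le⟩) (not_le.2 hc.1)
  · have h1 := fderiv_conormSq_darboux_sq_le hΨ hV.subset_source hJ
      ((hv.contMDiffAt (hint c hc)).mdifferentiableAt (by simp)) (hbV c (htI c hc)).1 (0, 1)
    have h2 : metricSq Ω J (v (ℓ c)) 0 = 0 := by
      rw [metricSq, map_zero]
      simpa using modelForm_smul Ω (v (ℓ c)) 0 (0 : E) 0
    rw [hzero, h2, zero_mul, mul_zero] at h1
    have h3 : fderiv ℝ (fun w => conormSq g (Ψ (v w))) (ℓ c) (0, 1) = 0 := by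
      nlinarith [sq_nonneg (fderiv ℝ (fun w => conormSq g (Ψ (v w))) (ℓ c) (0, 1))]
    have h4 : ((0 : ℝ), (-1 : ℝ)) = -(0, 1) := by simp
    rw [h4, map_neg, h3, neg_zero] at hcd
    have h5 : 0 < (h b - h a) / (b - a) := div_pos (by
      have : h b = ρ₂ ^ 2 := hbr
      linarith) (by linarith)
    linarith

end Strips

end LocalFloer

end

open LocalFloer in
theorem mainTheorem1
    {E : Type*} [NormedAddCommGroup E] [NormedSpace ℝ E] [FiniteDimensional ℝ E]
    {M : Type*} [TopologicalSpace M] [T2Space M] [SecondCountableTopology M]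
    [ChartedSpace E M] [IsManifold 𝓘(ℝ, E) ∞ M]
    {F : Type*} [NormedAddCommGroup F] [NormedSpace ℝ F] [FiniteDimensional ℝ F]
    {L : Type*} [TopologicalSpace L] [CompactSpace L] [T2Space L]
    [ChartedSpace F L] [IsManifold 𝓘(ℝ, F) ∞ L]
    (Ω : DiffForm 𝓘(ℝ, E) (N := M) 2) (hΩ : IsSymplectic Ω)
    (ι : L → M) (hι : IsLagrangianEmbedding (F := F) Ω ι)
    (Ψ : OpenPartialHomeomorph M (Cotangent F L)) (hΨ : IsDarbouxChart Ω ι Ψ)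
    (V : Set M) (hV : IsInnerDarbouxNhd ι Ψ V)
    (g : LocalFloer.Metric F L)
    (δ : ℝ≥0) (hδ : (δ : ℝ≥0∞) < size g Ψ V) :
    ∃ C : ℝ, 0 < C ∧
      ∀ J₀ : ∀ x : M, TangentSpace 𝓘(ℝ, E) x →L[ℝ] TangentSpace 𝓘(ℝ, E) x,
        IsCompatible Ω J₀ → IsSasakiOn g Ψ V J₀ →
      ∀ (H : ℝ → M → ℝ) (φ : ℝ → (M ≃ₘ^∞⟮𝓘(ℝ, E), 𝓘(ℝ, E)⟯ M)),
        IsHamiltonianPath Ω H φ →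
        (∀ t ∈ Icc (0 : ℝ) 1, φ t '' range ι ⊆ V) →
        dBar Ω J₀ (φ 1) (Diffeomorph.refl 𝓘(ℝ, E) M ∞) ≤ δ →
      ∀ v : ℝ × ℝ → M, IsHolomorphicStrip J₀ (φ 1 '' range ι) (range ι) v →
        (v '' strip ⊆ nbhd Ω J₀ δ (range ι) ∧ nbhd Ω J₀ δ (range ι) ⊆ V ∧
          ∀ z ∈ strip, distToSet Ω J₀ (v z) (range ι)
            ≤ hausdorffDist Ω J₀ (φ 1 '' range ι) (range ι)) ∨
        (¬ v '' strip ⊆ V ∧ ENNReal.ofReal C ≤ area Ω v) := by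
  have hδ' : ENNReal.ofReal (δ : ℝ) < size g Ψ V := by rwa [ENNReal.ofReal_coe_nnreal]
  -- all the structures to be considered coincide on `V`, so `C` may be found from one of them
  by_cases hex : ∃ J, IsCompatible Ω J ∧ IsSasakiOn g Ψ V J
  swap
  · exact ⟨1, one_pos, fun J₀ h1 h2 => (hex ⟨J₀, h1, h2⟩).elim⟩
  obtain ⟨J, hJ, hJV⟩ := hex
  obtain ⟨ρ₁, hρ₁, hρ₁'⟩ := ENNReal.lt_iff_exists_nnreal_btwn.1 hδ
  obtain ⟨ρ₂, hρ₂, hρ₂'⟩ := ENNReal.lt_iff_exists_nnreal_btwn.1 hρ₁'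
  have hδρ : (δ : ℝ) < ρ₁ := by exact_mod_cast hρ₁
  have hρ : (ρ₁ : ℝ) < ρ₂ := by exact_mod_cast hρ₂
  rw [← ENNReal.ofReal_coe_nnreal] at hρ₂'
  -- the boundary of a strip stays outside of `U`, and an escaping strip meets the compact set `K`
  set U : Set M := V ∩ (fun x => conormSq g (Ψ x)) ⁻¹' Ioi ((δ : ℝ) ^ 2) with hU
  have hUo : IsOpen U := ((continuousOn_conormSq_darboux hΨ).mono
    hV.subset_source).isOpen_inter_preimage hV.isOpen isOpen_Ioi
  set K : Set M := closure V ∩ (fun x => conormSq g (Ψ x)) ⁻¹' Icc ((ρ₁ : ℝ) ^ 2) ((ρ₂ : ℝ) ^ 2)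
    with hK
  have hKc : IsCompact K := hV.isCompact_closure.of_isClosed_subset
    (((continuousOn_conormSq_darboux hΨ).mono hV.closure_subset).preimage_isClosed_of_isClosed
      isClosed_closure isClosed_Icc) inter_subset_left
  have hKU : K ⊆ U := by
    rintro x ⟨hx, hx1, hx2⟩
    refine ⟨mem_of_conormSq_lt_size hV (hV.closure_subset hx) (lt_of_le_of_lt
      (ENNReal.ofReal_le_ofReal (Real.sqrt_le_iff.2 ⟨ρ₂.coe_nonneg, hx2⟩)) hρ₂'), ?_⟩
    change (δ : ℝ) ^ 2 < _
    exact lt_of_lt_of_le (by nlinarith [δ.coe_nonneg]) hx1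
  obtain ⟨C, hC, harea⟩ := exists_area_lower_bound_of_isCompact hΩ.smooth hJ hUo hKc hKU
  refine ⟨C, hC, fun J₀ hJ₀ hJ₀V H φ _ _ hd v hv => ?_⟩
  -- the minimum also covers `d_H = ∞`, and gives both inclusions of the first alternative
  set μ : ℝ≥0∞ := min (hausdorffDist Ω J₀ (φ 1 '' range ι) (range ι)) δ with hμ
  have hμδ : μ ≤ δ := min_le_right _ _
  have hμtop : μ ≠ ⊤ := (hμδ.trans_lt ENNReal.coe_lt_top).ne
  have hμr : ENNReal.ofReal μ.toReal = μ := ENNReal.ofReal_toReal hμtop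
  have hμδ' : μ.toReal ≤ δ := ENNReal.toReal_le_coe_of_le_coe hμδ
  have hμsize : ENNReal.ofReal μ.toReal < size g Ψ V := by rw [hμr]; exact hμδ.trans_lt hδ
  -- the lower boundary lies within distance `μ` of `L`
  have hbot : ∀ τ, v (τ, 0) ∈ V ∧ conormSq g (Ψ (v (τ, 0))) ≤ μ.toReal ^ 2 := fun τ => by
    refine mem_of_distToSet_le hΨ hV hJ₀V ENNReal.toReal_nonneg hμsize ?_
    rw [hμr]
    refine le_min ?_ ?_
    · exact (le_iSup₂ (f := fun x _ => distToSet Ω J₀ x (range ι)) (v (τ, 0)) (hv.bottom τ)).trans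
        (le_max_left _ _)
    · obtain ⟨_, ⟨q, rfl⟩, hq⟩ := hv.bottom τ
      refine (iInf₂_le (ι q) (mem_range_self q)).trans (le_trans ?_ hd)
      rw [← hq]
      exact (le_iSup (fun x => dist Ω J₀ (φ 1 x) x) (ι q)).trans (le_max_left _ _)
  have htop : ∀ τ, conormSq g (Ψ (v (τ, 1))) = 0 := fun τ => conormSq_of_mem_range hΨ (hv.top τ)
  by_cases hvV : v '' strip ⊆ V
  · refine Or.inl ?_
    have hle := hv.conormSq_le hΨ hV hJ₀V hJ₀.sq hvV (fun τ => (hbot τ).2)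
      (fun τ => (htop τ).le.trans (sq_nonneg _))
    have hdist : ∀ z ∈ strip, distToSet Ω J₀ (v z) (range ι) ≤ μ := fun z hz => by
      rw [← hμr]
      exact distToSet_le_of_conormSq_le hΨ hV hJ₀V ENNReal.toReal_nonneg hμsize
        (hvV (mem_image_of_mem v hz)) (hle z hz)
    refine ⟨?_, fun x hx => ?_, fun z hz => (hdist z hz).trans (min_le_left _ _)⟩
    · rintro _ ⟨z, hz, rfl⟩
      exact (hdist z hz).trans hμδ
    · refine (mem_of_distToSet_le hΨ hV hJ₀V δ.coe_nonneg hδ' ?_).1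
      rw [ENNReal.ofReal_coe_nnreal]
      exact hx
  · refine Or.inr ⟨hvV, ?_⟩
    obtain ⟨z, hz, hzV, hz1, hz2, hne⟩ :=
      hv.exists_crossing hΨ hV hJ₀V hvV ρ₁.coe_nonneg hρ hρ₂'
    refine harea v hv.smooth (fun w hw hwU => ?_) (fun τ hτ => ?_) (fun τ hτ => ?_) z hz
      ⟨subset_closure hzV, hz1, hz2⟩ hne
    · rw [hJV.modelStructure_eq hΩ hΨ hV.subset_source hJ₀V hwU.1]
      exact hv.add_eq_zero hw
    · have h1 : (δ : ℝ) ^ 2 < conormSq g (Ψ (v (τ, 0))) := hτ.2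
      have h2 : μ.toReal ^ 2 ≤ (δ : ℝ) ^ 2 := pow_le_pow_left₀ ENNReal.toReal_nonneg hμδ' 2
      linarith [(hbot τ).2]
    · have h1 : (δ : ℝ) ^ 2 < conormSq g (Ψ (v (τ, 1))) := hτ.2
      rw [htop] at h1
      exact absurd h1 (not_lt.2 (sq_nonneg _))
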